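/- **Theorem 1.** There is a strongly polynomial-time $(1+\sqrt3)$-approximation algorithm for Euclidean Priority $k$-Supplier in arbitrary dimension. *The problem.* An instance consists of a dimension $d$, a finite family $I$ of suppliers and a finite family $J$ of clients, each given by its coordinates in $\mathbb{R}^d$, a priority function $p\colon J\to\mathbb{R}_{\ge 0}$, and $k\in\mathbb{N}$; $d,|I|,|J|,k$ are all part of the input. For $C\subseteq I$ the objective value is $\max_{v\in J} p(v)\cdot d(v,C)$, where $d(v,C)=\min_{u\in C}\|v-u\|_2$ (with $d(v,\emptyset)=\infty$, $0\cdot\infty=0$, and value $0$ if $J=\emptyset$). Let $\mathrm{OPT}$ be the minimum objective value over all $C\subseteq I$ with $|C|\le k$. *The claim.* There are a single random-access program, whose only operations on the numerical data (coordinates and priorities) are $+$, $-$, $\times$, comparison, copying and the use of natural-number constants, and a polynomial $q$, such that on every instance the program halts and outputs a set $C\subseteq I$ with $|C|\le k$ and $$\max_{v\in J} p(v)\cdot d(v,C)\;\le\;(1+\sqrt3)\cdot \mathrm{OPT}.$$ Moreover: 1. for instances with real data, the cost of the run is at most $q(N)$, where each operation on real numbers has constant cost, operations on natural numbers (indices,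 counters, $k$) are charged the binary lengths of the numbers involved, and $N=d+|I|+|J|+\operatorname{size}(k)+(|I|+|J|)d+|J|$, with $\operatorname{size}(k)$ the binary length of $k$; 2. for instances with rational data, the cost of the run of the same program is at most $q(N)$, where every operation is charged the binary lengths of all numbers involved, and $N$ is the sum of $d$, $|I|$, $|J|$, $\operatorname{size}(k)$ and the lengths of the binary encodings of all coordinates and priorities. -/

import Mathlib

namespace PrioritySupplier

/-! ### Random-access programs over an ordered ring

A program has finitely many array variables: natural-number arrays (indices, counters, flags) and
arrays over a ring `K` (the numerical data of the instance). A scalar variable is a cell of an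
array. The only operations on numerical data are `+`, `-`, `*`, comparison, copying and natural
constants; in particular there are no square roots, no rounding and no constants from `K`. -/

/-- Memory contents: cell `i` of the natural-number array `a` is `nat a i`, cell `i` of the numerical
array `a` is `num a i`. -/
structure Memory (K : Type) where
  nat : ℕ → ℕ → ℕ
  num : ℕ → ℕ → K

/-- Expressions of natural-number type; `sub` is truncated subtraction. -/
inductive NatExp where
  | const (c : ℕ)
  | get (a : ℕ) (i : NatExp)
  | add (e₁ e₂ : NatExp)
  | sub (e₁ e₂ : NatExp)
  | mul (e₁ e₂ : NatExp)

/-- Expressions of numerical type. -/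
inductive NumExp where
  | const (c : ℕ)
  | get (a : ℕ) (i : NatExp)
  | add (e₁ e₂ : NumExp)
  | sub (e₁ e₂ : NumExp)
  | mul (e₁ e₂ : NumExp)

/-- Tests. -/
inductive Test where
  | natLe (e₁ e₂ : NatExp)
  | numLe (e₁ e₂ : NumExp)
  | not (b : Test)
  | and (b₁ b₂ : Test)

/-- Programs. `setNat a i e` writes the value of `e` into cell `i` of the natural-number array `a`;
`setNum a i e` does the same for numerical arrays. -/
inductive Program where
  | skip
  | setNat (a : ℕ) (i e : NatExp)
  | setNum (a : ℕ) (i : NatExp) (e : NumExp)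
  | seq (P Q : Program)
  | ite (b : Test) (P Q : Program)
  | while (b : Test) (P : Program)

section Semantics

variable {K : Type}

def Memory.setNat (s : Memory K) (a i v : ℕ) : Memory K :=
  { s with nat := Function.update s.nat a (Function.update (s.nat a) i v) }

def Memory.setNum (s : Memory K) (a i : ℕ) (v : K) : Memory K :=
  { s with num := Function.update s.num a (Function.update (s.num a) i v) }

def NatExp.eval (s : Memory K) : NatExp → ℕ
  | .const c => c
  | .get a i => s.nat a (i.eval s)
  | .add e₁ e₂ => e₁.eval s + e₂.eval s
  | .sub e₁ e₂ => e₁.eval s - e₂.eval s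
  | .mul e₁ e₂ => e₁.eval s * e₂.eval s

/-- Evaluation cost: every node of the expression (hence every operand, address and result) is
charged one unit plus the binary length of its value. -/
def NatExp.cost (s : Memory K) : NatExp → ℕ
  | .const c => 1 + Nat.size c
  | .get a i => i.cost s + 1 + Nat.size (s.nat a (i.eval s))
  | .add e₁ e₂ => e₁.cost s + e₂.cost s + 1 + Nat.size (e₁.eval s + e₂.eval s)
  | .sub e₁ e₂ => e₁.cost s + e₂.cost s + 1 + Nat.size (e₁.eval s - e₂.eval s)
  | .mul e₁ e₂ => e₁.cost s + e₂.cost s + 1 + Nat.size (e₁.eval s * e₂.eval s)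

variable [Ring K]

def NumExp.eval (s : Memory K) : NumExp → K
  | .const c => (c : K)
  | .get a i => s.num a (i.eval s)
  | .add e₁ e₂ => e₁.eval s + e₂.eval s
  | .sub e₁ e₂ => e₁.eval s - e₂.eval s
  | .mul e₁ e₂ => e₁.eval s * e₂.eval s

/-- Evaluation cost of a numerical expression, where a number `x : K` that occurs as the value of a
node is charged `1 + sz x`. -/
def NumExp.cost (sz : K → ℕ) (s : Memory K) : NumExp → ℕ
  | .const c => 1 + sz (c : K)
  | .get a i => i.cost s + 1 + sz (s.num a (i.eval s))
  | .add e₁ e₂ => e₁.cost sz s + e₂.cost sz s + 1 + sz (e₁.eval s + e₂.eval s)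
  | .sub e₁ e₂ => e₁.cost sz s + e₂.cost sz s + 1 + sz (e₁.eval s - e₂.eval s)
  | .mul e₁ e₂ => e₁.cost sz s + e₂.cost sz s + 1 + sz (e₁.eval s * e₂.eval s)

def Test.Holds [LE K] (s : Memory K) : Test → Prop
  | .natLe e₁ e₂ => e₁.eval s ≤ e₂.eval s
  | .numLe e₁ e₂ => e₁.eval s ≤ e₂.eval s
  | .not b => ¬ b.Holds s
  | .and b₁ b₂ => b₁.Holds s ∧ b₂.Holds s

def Test.cost (sz : K → ℕ) (s : Memory K) : Test → ℕ
  | .natLe e₁ e₂ => e₁.cost s + e₂.cost s + 1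
  | .numLe e₁ e₂ => e₁.cost sz s + e₂.cost sz s + 1
  | .not b => b.cost sz s + 1
  | .and b₁ b₂ => b₁.cost sz s + b₂.cost sz s + 1

/-- `Exec sz P s s' t`: the program `P`, started in the memory `s`, halts in the memory `s'`, and
the total cost of the run is `t`. -/
inductive Exec [LE K] (sz : K → ℕ) : Program → Memory K → Memory K → ℕ → Prop
  | skip (s : Memory K) : Exec sz .skip s s 1
  | setNat (a : ℕ) (i e : NatExp) (s : Memory K) :
      Exec sz (.setNat a i e) s (s.setNat a (i.eval s) (e.eval s)) (i.cost s + e.cost s + 1)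
  | setNum (a : ℕ) (i : NatExp) (e : NumExp) (s : Memory K) :
      Exec sz (.setNum a i e) s (s.setNum a (i.eval s) (e.eval s)) (i.cost s + e.cost sz s + 1)
  | seq {P Q : Program} {s s' s'' : Memory K} {t t' : ℕ} :
      Exec sz P s s' t → Exec sz Q s' s'' t' → Exec sz (.seq P Q) s s'' (t + t')
  | ite_true {b : Test} {P Q : Program} {s s' : Memory K} {t : ℕ} :
      b.Holds s → Exec sz P s s' t → Exec sz (.ite b P Q) s s' (b.cost sz s + 1 + t)
  | ite_false {b : Test} {P Q : Program} {s s' : Memory K} {t : ℕ} :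
      ¬ b.Holds s → Exec sz Q s s' t → Exec sz (.ite b P Q) s s' (b.cost sz s + 1 + t)
  | while_false {b : Test} {P : Program} {s : Memory K} :
      ¬ b.Holds s → Exec sz (.while b P) s s (b.cost sz s + 1)
  | while_true {b : Test} {P : Program} {s s' s'' : Memory K} {t t' : ℕ} :
      b.Holds s → Exec sz P s s' t → Exec sz (.while b P) s' s'' t' →
      Exec sz (.while b P) s s'' (b.cost sz s + 1 + t + t')

end Semantics

/-- Unit cost: every number counts one. -/
def unitSize (_ : ℝ) : ℕ := 1

/-- Length of the binary encoding of a rational number: sign, numerator and denominator. -/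
def bitSize (x : ℚ) : ℕ := 1 + Nat.size x.num.natAbs + Nat.size x.den

/-! ### The problem -/

/-- An instance of Euclidean Priority `k`-Supplier with numerical data in `K`: `m` suppliers and `n`
clients, given by their coordinates in dimension `d`, nonnegative client priorities, and the bound
`k` on the number of chosen suppliers. -/
structure Instance (K : Type) [Zero K] [LE K] where
  m : ℕ
  n : ℕ
  k : ℕ
  d : ℕ
  supplier : Fin m → Fin d → K
  client : Fin n → Fin d → K
  priority : Fin n → K
  priority_nonneg : ∀ v, 0 ≤ priority v

namespace Instance

noncomputable section

/-- `p(v) · d(v, C)` for a client `v`, with `d(v, C) = min_{u ∈ C} d(v, u)` the Euclidean distance to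
the nearest member of `C` (so `d(v, ∅) = ∞`). -/
def priorityDist (X : Instance ℝ) (C : Finset (Fin X.m)) (v : Fin X.n) : ENNReal :=
  ENNReal.ofReal (X.priority v) *
    ⨅ u ∈ C, edist (WithLp.toLp 2 (X.client v) : EuclideanSpace ℝ (Fin X.d))
      (WithLp.toLp 2 (X.supplier u))

/-- The objective value `max_v p(v) · d(v, C)`. -/
def objective (X : Instance ℝ) (C : Finset (Fin X.m)) : ENNReal :=
  ⨆ v : Fin X.n, X.priorityDist C v

/-- The optimal value: the least objective value of a set of at most `k` suppliers. -/
def opt (X : Instance ℝ) : ENNReal :=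
  ⨅ C : Finset (Fin X.m), ⨅ _ : C.card ≤ X.k, X.objective C

/-- `C` is a feasible solution whose objective value is at most `α` times the optimal value. -/
def IsApproxSolution (X : Instance ℝ) (α : ℝ) (C : Finset (Fin X.m)) : Prop :=
  C.card ≤ X.k ∧ X.objective C ≤ ENNReal.ofReal α * X.opt

/-- A rational instance, seen as a real one. -/
def toReal (X : Instance ℚ) : Instance ℝ where
  m := X.m
  n := X.n
  k := X.k
  d := X.d
  supplier u i := (X.supplier u i : ℝ)
  client v i := (X.client v i : ℝ)
  priority v := (X.priority v : ℝ)
  priority_nonneg v := Rat.cast_nonneg.mpr (X.priority_nonneg v)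

end

section Encoding

variable {K : Type}

/-- The array that lists the rows of a matrix one after the other, followed by zeros. -/
def rowMajor [Zero K] {r d : ℕ} (A : Fin r → Fin d → K) (i : ℕ) : K :=
  if h : i < r * d then A (Fin.divNat ⟨i, h⟩) (Fin.modNat ⟨i, h⟩) else 0

/-- The initial memory. The first four cells of the natural-number array `0` hold `m`, `n`, `k`,
`d`; the numerical arrays `0`, `1`, `2` hold the supplier coordinates, the client coordinates and
the priorities; all other cells hold zero. -/
def input [Zero K] [LE K] (X : Instance K) : Memory K where
  nat a i := if a = 0 then [X.m, X.n, X.k, X.d].getD i 0 else 0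
  num a i :=
    if a = 0 then rowMajor X.supplier i
    else if a = 1 then rowMajor X.client i
    else if a = 2 then (if h : i < X.n then X.priority ⟨i, h⟩ else 0)
    else 0

/-- The size of an instance, where the binary length of `k` and the size `sz x` of every number
`x` of the input are counted. -/
def size [Zero K] [LE K] (sz : K → ℕ) (X : Instance K) : ℕ :=
  X.m + X.n + X.d + Nat.size X.k + (∑ u, ∑ i, sz (X.supplier u i)) +
    (∑ v, ∑ i, sz (X.client v i)) + ∑ v, sz (X.priority v)

end Encoding

end Instance

/-- The output of a halted program: supplier `u` is chosen iff cell `u` of the natural-number array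
`1` is nonzero. -/
def Memory.chosen {K : Type} (s : Memory K) (m : ℕ) : Finset (Fin m) :=
  Finset.univ.filter fun u => s.nat 1 u ≠ 0

end PrioritySupplier

namespace PrioritySupplier

/-! All comparisons are between squares `p(v)² ‖v - u‖²`, so no roots are needed. A nonempty
solution has as objective value the root of one of the `n * m` numbers `PW v u` (client `v`,
supplier `u`), and the algorithm tries each of them as a threshold `R`. For fixed `R`, clients are
selected by decreasing priority, and a selected client `v` removes every client `w` with `p(w)² ‖w -
v‖² ≤ 3R`.

If some solution with at most `k` suppliers serves every client within `R`, then each of its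
suppliers serves at most two selected clients: seen from the supplier, any two of them enclose an
angle above 120 degrees (`inner_lt_of_far`), which is impossible for three vectors
(`false_of_three_far`). So the selected clients fall into at most `k` classes of size at most two,
each with a common supplier. Padded with dummies to `2 * min k n` vertices, this is a perfect
matching of the graph that joins two vertices covered by a common supplier (`exists_pairing`,
`not_infeasible`). Conversely, a perfect matching yields one supplier per edge, hence at most `k`
suppliers (`Feasible.card_le`). Every client `w` is close to a selected client `v` with `p(w) ≤
p(v)`, and `v` is served within `R` by some chosen `u`. Hence `p(w) ‖w - u‖ ≤ √(3R) + √R`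
(`priority_mul_dist_le`). The least accepted threshold is at most `OPT²`, which gives the ratio.

Perfect matchings are found by Edmonds' blossom search. Instead of parent pointers, every outer
vertex `u` carries a complete matching `N u` that exposes `u` in place of the root. Growing,
augmenting and shrinking then become edits of rows (`grow`, `augment`, `walk_step`, `shrink`). If
the search is stuck, deleting the inner vertices leaves more odd pieces than there are inner
vertices, so no perfect matching exists (`not_perfect`).

Cost is separated from correctness. `wp` certifies a final memory and a bound on the rounds of all
loops. `Runs.exec` converts this into a polynomial cost for tame programs, in which an assignment
lengthens numbers by an amount that depends on the input only. Correctness is proved over any `K`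
with a strictly monotone ring homomorphism into `ℝ`, which covers `ℝ` and `ℚ` at once. -/

/-! ### Bounded executions and their cost -/

section Bounded

variable {K : Type} [Ring K] [LE K]

/-- `Iterates b R j s s'`: the loop with test `b` and body relation `R` leads from `s` to `s'` in
exactly `j` rounds. -/
def Iterates (b : Memory K → Prop) (R : Memory K → Memory K → Prop) :
    ℕ → Memory K → Memory K → Prop
  | 0, s, out => ¬ b s ∧ out = s
  | j + 1, s, out => b s ∧ ∃ s₁, R s s₁ ∧ Iterates b R j s₁ out

/-- `Runs L P s s'`: the program `P` leads from `s` to `s'`, and every loop that is entered on the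
way is left after at most `L` rounds. -/
def Runs (L : ℕ) : Program → Memory K → Memory K → Prop
  | .skip, s, out => out = s
  | .setNat a i e, s, out => out = s.setNat a (i.eval s) (e.eval s)
  | .setNum a i e, s, out => out = s.setNum a (i.eval s) (e.eval s)
  | .seq P Q, s, out => ∃ s₁, Runs L P s s₁ ∧ Runs L Q s₁ out
  | .ite b P Q, s, out => (b.Holds s ∧ Runs L P s out) ∨ (¬ b.Holds s ∧ Runs L Q s out)
  | .while b P, s, out => ∃ j ≤ L, Iterates b.Holds (Runs L P) j s out

/-- `wp L P Q s`: the program `P`, started in `s`, halts within the loop bound `L` in a memory that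
satisfies `Q`. -/
def wp (L : ℕ) (P : Program) (Q : Memory K → Prop) (s : Memory K) : Prop :=
  ∃ s', Runs L P s s' ∧ Q s'

end Bounded

/-! #### Syntactic measures -/

/-- Counts nodes and the bit lengths of constants. Since lengths at worst add up under one
operation, a value computed from cells of length `β` has length at most `weight * (β + 1)`. -/
def NatExp.weight : NatExp → ℕ
  | .const c => 1 + Nat.size c
  | .get _ i => 1 + i.weight
  | .add e₁ e₂ => 1 + e₁.weight + e₂.weight
  | .sub e₁ e₂ => 1 + e₁.weight + e₂.weight
  | .mul e₁ e₂ => 1 + e₁.weight + e₂.weight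

def NumExp.weight : NumExp → ℕ
  | .const c => 2 + Nat.size c
  | .get _ i => 1 + i.weight
  | .add e₁ e₂ => 1 + e₁.weight + e₂.weight
  | .sub e₁ e₂ => 1 + e₁.weight + e₂.weight
  | .mul e₁ e₂ => 1 + e₁.weight + e₂.weight

def Test.weight : Test → ℕ
  | .natLe e₁ e₂ => 1 + e₁.weight + e₂.weight
  | .numLe e₁ e₂ => 1 + e₁.weight + e₂.weight
  | .not b => 1 + b.weight
  | .and b₁ b₂ => 1 + b₁.weight + b₂.weight

def Program.weight : Program → ℕ
  | .skip => 1
  | .setNat _ i e => 1 + i.weight + e.weight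
  | .setNum _ i e => 1 + i.weight + e.weight
  | .seq P Q => P.weight + Q.weight
  | .ite b P Q => 1 + b.weight + P.weight + Q.weight
  | .while b P => 1 + b.weight + P.weight

/-- The expression contains no multiplication. -/
def NatExp.Additive : NatExp → Bool
  | .const _ => true
  | .get _ _ => true
  | .add e₁ e₂ => e₁.Additive && e₂.Additive
  | .sub e₁ e₂ => e₁.Additive && e₂.Additive
  | .mul _ _ => false

/-- The expression reads only the numerical input arrays. -/
def NumExp.InputOnly : NumExp → Bool
  | .const _ => true
  | .get a _ => decide (a < 3)
  | .add e₁ e₂ => e₁.InputOnly && e₂.InputOnly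
  | .sub e₁ e₂ => e₁.InputOnly && e₂.InputOnly
  | .mul e₁ e₂ => e₁.InputOnly && e₂.InputOnly

/-- At most one leaf of the expression reads a numerical array that is not part of the input. -/
def NumExp.AlmostInput : NumExp → Bool
  | .const _ => true
  | .get _ _ => true
  | .add e₁ e₂ => (e₁.AlmostInput && e₂.InputOnly) || (e₁.InputOnly && e₂.AlmostInput)
  | .sub e₁ e₂ => (e₁.AlmostInput && e₂.InputOnly) || (e₁.InputOnly && e₂.AlmostInput)
  | .mul e₁ e₂ => (e₁.AlmostInput && e₂.InputOnly) || (e₁.InputOnly && e₂.AlmostInput)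

/-- A program whose assignments increase the bit lengths of the stored numbers only by a bounded
amount, and which does not overwrite the numerical input. -/
def Program.Tame : Program → Bool
  | .skip => true
  | .setNat _ _ e => e.Additive
  | .setNum a _ e => decide (3 ≤ a) && e.AlmostInput
  | .seq P Q => P.Tame && Q.Tame
  | .ite _ P Q => P.Tame && Q.Tame
  | .while _ P => P.Tame

/-- The number of elementary steps of a run in which every loop has at most `X` rounds. -/
noncomputable def Program.steps : Program → Polynomial ℕ
  | .skip => 1
  | .setNat _ _ _ => 1
  | .setNum _ _ _ => 1
  | .seq P Q => P.steps + Q.steps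
  | .ite _ P Q => 1 + P.steps + Q.steps
  | .while _ P => Polynomial.X * (1 + P.steps) + 1

/-! ### Bit lengths under arithmetic operations. -/

theorem size_add_le (a b : ℕ) : Nat.size (a + b) ≤ max (Nat.size a) (Nat.size b) + 1 := by
  rw [Nat.size_le, pow_succ]
  have h₁ : a < 2 ^ max (Nat.size a) (Nat.size b) :=
    (Nat.lt_size_self a).trans_le (Nat.pow_le_pow_right (by norm_num) (le_max_left _ _))
  have h₂ : b < 2 ^ max (Nat.size a) (Nat.size b) :=
    (Nat.lt_size_self b).trans_le (Nat.pow_le_pow_right (by norm_num) (le_max_right _ _))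
  omega

theorem size_mul_le (a b : ℕ) : Nat.size (a * b) ≤ Nat.size a + Nat.size b := by
  rw [Nat.size_le, pow_add]
  exact Nat.mul_lt_mul'' (Nat.lt_size_self a) (Nat.lt_size_self b)

theorem size_le_self (a : ℕ) : Nat.size a ≤ a := by
  rw [Nat.size_le]; exact Nat.lt_two_pow_self

/-- The size function `sz` is, up to constants, bounded by a height `h` that is subadditive under
the ring operations. -/
structure SizeModel {K : Type} [Ring K] (sz h : K → ℕ) : Prop where
  sz_le : ∀ x, sz x ≤ 2 * h x + 1
  le_sz : ∀ x, h x ≤ sz x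
  cast : ∀ c : ℕ, h (c : K) ≤ Nat.size c + 1
  add : ∀ x y, h (x + y) ≤ h x + h y + 1
  sub : ∀ x y, h (x - y) ≤ h x + h y + 1
  mul : ∀ x y, h (x * y) ≤ h x + h y + 1

section Cost

variable {K : Type} [Ring K] {sz h : K → ℕ}

/-- All cells have bit length at most `β`. -/
def Memory.Bounded (h : K → ℕ) (s : Memory K) (β : ℕ) : Prop :=
  (∀ a i, Nat.size (s.nat a i) ≤ β) ∧ ∀ a i, h (s.num a i) ≤ β

/-- All cells of the numerical input arrays have bit length at most `β`. -/
def Memory.InputBounded (h : K → ℕ) (s : Memory K) (β : ℕ) : Prop :=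
  ∀ a < 3, ∀ i, h (s.num a i) ≤ β

theorem NatExp.size_eval_le {K : Type} {s : Memory K} {β : ℕ} (hs : ∀ a i, Nat.size (s.nat a i) ≤ β)
    (e : NatExp) : Nat.size (e.eval s) ≤ e.weight * (β + 1) := by
  induction e with
  | const c => simp only [eval, weight]; nlinarith [Nat.zero_le (Nat.size c * β)]
  | get a i _ => simp only [eval, weight]; have := hs a (i.eval s); nlinarith
  | add e₁ e₂ h₁ h₂ =>
    simp only [eval, weight]
    have := size_add_le (e₁.eval s) (e₂.eval s)
    have : max (Nat.size (e₁.eval s)) (Nat.size (e₂.eval s)) ≤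
      Nat.size (e₁.eval s) + Nat.size (e₂.eval s) := by omega
    nlinarith
  | sub e₁ e₂ h₁ h₂ =>
    simp only [eval, weight]
    have := Nat.size_le_size (Nat.sub_le (e₁.eval s) (e₂.eval s))
    nlinarith
  | mul e₁ e₂ h₁ h₂ =>
    simp only [eval, weight]
    have := size_mul_le (e₁.eval s) (e₂.eval s)
    nlinarith

/-- There are at most `weight` nodes, each charged for a value of length at most `weight * (β + 1)`;
hence the square. -/
theorem NatExp.cost_le {s : Memory K} {β : ℕ} (hs : ∀ a i, Nat.size (s.nat a i) ≤ β)
    (e : NatExp) : e.cost s ≤ e.weight ^ 2 * (β + 2) := by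
  induction e with
  | const c => simp only [cost, weight]; nlinarith [Nat.zero_le (Nat.size c * β), Nat.zero_le ((1 + Nat.size c)^2 * β)]
  | get a i ih =>
    simp only [cost, weight]; have := hs a (i.eval s)
    nlinarith [Nat.zero_le (i.weight * β), Nat.zero_le (i.weight ^ 2 * β)]
  | add e₁ e₂ h₁ h₂ =>
    have := NatExp.size_eval_le hs (.add e₁ e₂)
    simp only [eval, weight, cost] at this ⊢
    nlinarith [Nat.zero_le (e₁.weight * β), Nat.zero_le (e₂.weight * β),
      Nat.zero_le (e₁.weight * e₂.weight * β), Nat.zero_le (e₁.weight * e₂.weight)]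
  | sub e₁ e₂ h₁ h₂ =>
    have := NatExp.size_eval_le hs (.sub e₁ e₂)
    simp only [eval, weight, cost] at this ⊢
    nlinarith [Nat.zero_le (e₁.weight * β), Nat.zero_le (e₂.weight * β),
      Nat.zero_le (e₁.weight * e₂.weight * β), Nat.zero_le (e₁.weight * e₂.weight)]
  | mul e₁ e₂ h₁ h₂ =>
    have := NatExp.size_eval_le hs (.mul e₁ e₂)
    simp only [eval, weight, cost] at this ⊢
    nlinarith [Nat.zero_le (e₁.weight * β), Nat.zero_le (e₂.weight * β),
      Nat.zero_le (e₁.weight * e₂.weight * β), Nat.zero_le (e₁.weight * e₂.weight)]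

/-- Here `β` enters with factor one, so the bound survives polynomially many assignments. An address
below `get` may still contain products: only the value read counts. -/
theorem NatExp.size_eval_le_of_additive {s : Memory K} {β : ℕ}
    (hs : ∀ a i, Nat.size (s.nat a i) ≤ β) (e : NatExp) (he : e.Additive = true) :
    Nat.size (e.eval s) ≤ β + e.weight := by
  induction e with
  | const c => simp only [eval, weight]; omega
  | get a i _ => simp only [eval, weight]; have := hs a (i.eval s); omega
  | add e₁ e₂ h₁ h₂ =>
    simp only [Additive, Bool.and_eq_true] at he
    simp only [eval, weight]
    have := size_add_le (e₁.eval s) (e₂.eval s)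
    have := h₁ he.1
    have := h₂ he.2
    omega
  | sub e₁ e₂ h₁ h₂ =>
    simp only [Additive, Bool.and_eq_true] at he
    simp only [eval, weight]
    have := Nat.size_le_size (Nat.sub_le (e₁.eval s) (e₂.eval s))
    have := h₁ he.1
    omega
  | mul e₁ e₂ h₁ h₂ => simp [Additive] at he

theorem NumExp.height_eval_le (H : SizeModel sz h) {s : Memory K} {β : ℕ}
    (hs : ∀ a i, h (s.num a i) ≤ β) (e : NumExp) : h (e.eval s) ≤ e.weight * (β + 1) := by
  induction e with
  | const c =>
    simp only [eval, weight]; have := H.cast c; nlinarith [Nat.zero_le (Nat.size c * β)]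
  | get a i => simp only [eval, weight]; have := hs a (i.eval s); nlinarith
  | add e₁ e₂ h₁ h₂ =>
    simp only [eval, weight]; have := H.add (e₁.eval s) (e₂.eval s); nlinarith
  | sub e₁ e₂ h₁ h₂ =>
    simp only [eval, weight]; have := H.sub (e₁.eval s) (e₂.eval s); nlinarith
  | mul e₁ e₂ h₁ h₂ =>
    simp only [eval, weight]; have := H.mul (e₁.eval s) (e₂.eval s); nlinarith

theorem NumExp.cost_le (H : SizeModel sz h) {s : Memory K} {β : ℕ} (hs : s.Bounded h β)
    (e : NumExp) : e.cost sz s ≤ 4 * e.weight ^ 2 * (β + 2) := by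
  have key := fun e : NumExp => (H.sz_le (e.eval s)).trans
    (Nat.add_le_add_right (Nat.mul_le_mul_left 2 (e.height_eval_le H hs.2)) 1)
  induction e with
  | const c =>
    have := H.sz_le (c : K)
    have := H.cast c
    simp only [cost, weight]
    nlinarith [Nat.zero_le (Nat.size c * β), Nat.zero_le ((2 + Nat.size c)^2 * β)]
  | get a i =>
    have h₁ := H.sz_le (s.num a (i.eval s))
    have h₂ := hs.2 a (i.eval s)
    have h₃ := i.cost_le hs.1
    simp only [cost, weight]
    nlinarith [Nat.zero_le (i.weight * β), Nat.zero_le (i.weight ^ 2 * β)]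
  | add e₁ e₂ h₁ h₂ =>
    have := key (.add e₁ e₂)
    simp only [eval, weight, cost] at this ⊢
    nlinarith [Nat.zero_le (e₁.weight * β), Nat.zero_le (e₂.weight * β),
      Nat.zero_le (e₁.weight * e₂.weight * β), Nat.zero_le (e₁.weight * e₂.weight)]
  | sub e₁ e₂ h₁ h₂ =>
    have := key (.sub e₁ e₂)
    simp only [eval, weight, cost] at this ⊢
    nlinarith [Nat.zero_le (e₁.weight * β), Nat.zero_le (e₂.weight * β),
      Nat.zero_le (e₁.weight * e₂.weight * β), Nat.zero_le (e₁.weight * e₂.weight)]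
  | mul e₁ e₂ h₁ h₂ =>
    have := key (.mul e₁ e₂)
    simp only [eval, weight, cost] at this ⊢
    nlinarith [Nat.zero_le (e₁.weight * β), Nat.zero_le (e₂.weight * β),
      Nat.zero_le (e₁.weight * e₂.weight * β), Nat.zero_le (e₁.weight * e₂.weight)]

theorem NumExp.height_eval_le_of_inputOnly (H : SizeModel sz h) {s : Memory K} {β : ℕ}
    (hs : s.InputBounded h β) (e : NumExp) (he : e.InputOnly = true) :
    h (e.eval s) ≤ e.weight * (β + 1) := by
  induction e with
  | const c =>
    simp only [eval, weight]; have := H.cast c; nlinarith [Nat.zero_le (Nat.size c * β)]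
  | get a i =>
    simp only [InputOnly, decide_eq_true_eq] at he
    simp only [eval, weight]; have := hs a he (i.eval s); nlinarith
  | add e₁ e₂ h₁ h₂ =>
    simp only [InputOnly, Bool.and_eq_true] at he
    have := h₁ he.1
    have := h₂ he.2
    simp only [eval, weight]; have := H.add (e₁.eval s) (e₂.eval s); nlinarith
  | sub e₁ e₂ h₁ h₂ =>
    simp only [InputOnly, Bool.and_eq_true] at he
    have := h₁ he.1
    have := h₂ he.2
    simp only [eval, weight]; have := H.sub (e₁.eval s) (e₂.eval s); nlinarith
  | mul e₁ e₂ h₁ h₂ =>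
    simp only [InputOnly, Bool.and_eq_true] at he
    have := h₁ he.1
    have := h₂ he.2
    simp only [eval, weight]; have := H.mul (e₁.eval s) (e₂.eval s); nlinarith

/-- Only one leaf can carry the current bound `β`; all other operands are controlled by the fixed
input bound `β₀`. An assignment therefore adds an amount independent of `β`, whereas repeated
squaring of a stored number would double `β` each time. -/
theorem NumExp.height_eval_le_of_almostInput (H : SizeModel sz h) {s : Memory K} {β₀ β : ℕ}
    (hs : ∀ a i, h (s.num a i) ≤ β) (hs₀ : s.InputBounded h β₀) (e : NumExp)
    (he : e.AlmostInput = true) : h (e.eval s) ≤ β + e.weight * (β₀ + 1) := by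
  induction e with
  | const c =>
    simp only [eval, weight]; have := H.cast c; nlinarith [Nat.zero_le (Nat.size c * β₀)]
  | get a i => simp only [eval, weight]; have := hs a (i.eval s); nlinarith
  | add e₁ e₂ h₁ h₂ =>
    simp only [AlmostInput, Bool.or_eq_true, Bool.and_eq_true] at he
    have := H.add (e₁.eval s) (e₂.eval s)
    simp only [eval, weight]
    rcases he with ⟨k₁, k₂⟩ | ⟨k₁, k₂⟩
    · have := h₁ k₁
      have := e₂.height_eval_le_of_inputOnly H hs₀ k₂
      nlinarith
    · have := h₂ k₂
      have := e₁.height_eval_le_of_inputOnly H hs₀ k₁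
      nlinarith
  | sub e₁ e₂ h₁ h₂ =>
    simp only [AlmostInput, Bool.or_eq_true, Bool.and_eq_true] at he
    have := H.sub (e₁.eval s) (e₂.eval s)
    simp only [eval, weight]
    rcases he with ⟨k₁, k₂⟩ | ⟨k₁, k₂⟩
    · have := h₁ k₁
      have := e₂.height_eval_le_of_inputOnly H hs₀ k₂
      nlinarith
    · have := h₂ k₂
      have := e₁.height_eval_le_of_inputOnly H hs₀ k₁
      nlinarith
  | mul e₁ e₂ h₁ h₂ =>
    simp only [AlmostInput, Bool.or_eq_true, Bool.and_eq_true] at he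
    have := H.mul (e₁.eval s) (e₂.eval s)
    simp only [eval, weight]
    rcases he with ⟨k₁, k₂⟩ | ⟨k₁, k₂⟩
    · have := h₁ k₁
      have := e₂.height_eval_le_of_inputOnly H hs₀ k₂
      nlinarith
    · have := h₂ k₂
      have := e₁.height_eval_le_of_inputOnly H hs₀ k₁
      nlinarith

theorem Test.cost_le (H : SizeModel sz h) {s : Memory K} {β : ℕ} (hs : s.Bounded h β)
    (b : Test) : b.cost sz s ≤ 4 * b.weight ^ 2 * (β + 2) := by
  induction b with
  | natLe e₁ e₂ =>
    have := e₁.cost_le hs.1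
    have := e₂.cost_le hs.1
    simp only [cost, weight]
    nlinarith [Nat.zero_le (e₁.weight * e₂.weight * (β + 2)), Nat.zero_le (e₁.weight * (β + 2)),
      Nat.zero_le (e₂.weight * (β + 2)), Nat.zero_le (e₁.weight ^ 2 * (β + 2)),
      Nat.zero_le (e₂.weight ^ 2 * (β + 2))]
  | numLe e₁ e₂ =>
    have := e₁.cost_le H hs
    have := e₂.cost_le H hs
    simp only [cost, weight]
    nlinarith [Nat.zero_le (e₁.weight * e₂.weight * (β + 2)), Nat.zero_le (e₁.weight * (β + 2)),
      Nat.zero_le (e₂.weight * (β + 2))]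
  | not b ih => simp only [cost, weight]; nlinarith [Nat.zero_le (b.weight * (β + 2))]
  | and b₁ b₂ h₁ h₂ =>
    simp only [cost, weight]
    nlinarith [Nat.zero_le (b₁.weight * b₂.weight * (β + 2)), Nat.zero_le (b₁.weight * (β + 2)),
      Nat.zero_le (b₂.weight * (β + 2))]

theorem Memory.Bounded.mono {s : Memory K} {β β' : ℕ} (hs : s.Bounded h β) (hβ : β ≤ β') :
    s.Bounded h β' :=
  ⟨fun a i => (hs.1 a i).trans hβ, fun a i => (hs.2 a i).trans hβ⟩

theorem Memory.Bounded.setNat {s : Memory K} {β : ℕ} (hs : s.Bounded h β) (a i : ℕ) {v : ℕ}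
    (hv : Nat.size v ≤ β) : (s.setNat a i v).Bounded h β := by
  refine ⟨fun a' i' => ?_, hs.2⟩
  simp only [Memory.setNat, Function.update_apply]
  split_ifs with h₁
  · subst h₁
    simp only [Function.update_apply]
    split_ifs
    exacts [hv, hs.1 _ _]
  · exact hs.1 _ _

theorem Memory.Bounded.setNum {s : Memory K} {β : ℕ} (hs : s.Bounded h β) (a i : ℕ) {v : K}
    (hv : h v ≤ β) : (s.setNum a i v).Bounded h β := by
  refine ⟨hs.1, fun a' i' => ?_⟩
  simp only [Memory.setNum, Function.update_apply]
  split_ifs with h₁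
  · subst h₁
    simp only [Function.update_apply]
    split_ifs
    exacts [hv, hs.2 _ _]
  · exact hs.2 _ _

/-- A bounded run of a tame program has a cost that is polynomial in the loop bound and in the
bit lengths of the initial memory. -/
theorem Runs.exec [LE K] (H : SizeModel sz h) {L W β₀ B : ℕ} {P : Program} (hW : P.weight ≤ W)
    (hP : P.Tame = true) {s s' : Memory K} {β : ℕ} (hs : s.Bounded h β)
    (hs₀ : s.InputBounded h β₀) (hr : Runs L P s s')
    (hB : β + P.steps.eval L * (W * (β₀ + 1)) ≤ B) :
    ∃ t, Exec sz P s s' t ∧ t ≤ P.steps.eval L * (4 * W ^ 2 * (B + 2)) ∧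
      s'.Bounded h (β + P.steps.eval L * (W * (β₀ + 1))) ∧ s'.InputBounded h β₀ := by
  induction P generalizing s s' β with
  | skip =>
    obtain rfl := hr
    refine ⟨_, .skip _, ?_, hs.mono (by omega), hs₀⟩
    simp only [Program.weight] at hW
    simp only [Program.steps, Polynomial.eval_one, one_mul]
    nlinarith [Nat.zero_le (W ^ 2 * B)]
  | setNat a i e =>
    obtain rfl := hr
    simp only [Program.weight] at hW
    simp only [Program.Tame] at hP
    simp only [Program.steps, Polynomial.eval_one, one_mul] at hB ⊢
    refine ⟨_, .setNat _ _ _ _, ?_, (hs.mono (by omega)).setNat _ _ ?_, hs₀⟩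
    · have h₁ := i.cost_le hs.1
      have h₂ := e.cost_le hs.1
      have h₃ : 4 * (1 + i.weight + e.weight) ^ 2 * (β + 2) ≤ 4 * W ^ 2 * (B + 2) := by
        gcongr; omega
      nlinarith [Nat.zero_le (i.weight * e.weight * (β + 2)), Nat.zero_le (i.weight * (β + 2)),
        Nat.zero_le (e.weight * (β + 2)), Nat.zero_le (i.weight ^ 2 * (β + 2)),
        Nat.zero_le (e.weight ^ 2 * (β + 2))]
    · have := e.size_eval_le_of_additive hs.1 hP
      nlinarith [Nat.zero_le (W * β₀)]
  | setNum a i e =>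
    obtain rfl := hr
    simp only [Program.weight] at hW
    simp only [Program.Tame, Bool.and_eq_true, decide_eq_true_eq] at hP
    simp only [Program.steps, Polynomial.eval_one, one_mul] at hB ⊢
    refine ⟨_, .setNum _ _ _ _, ?_, (hs.mono (by omega)).setNum _ _ ?_, ?_⟩
    · have h₁ := i.cost_le hs.1
      have h₂ := e.cost_le H hs
      have h₃ : 4 * (1 + i.weight + e.weight) ^ 2 * (β + 2) ≤ 4 * W ^ 2 * (B + 2) := by
        gcongr; omega
      nlinarith [Nat.zero_le (i.weight * e.weight * (β + 2)), Nat.zero_le (i.weight * (β + 2)),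
        Nat.zero_le (e.weight * (β + 2)), Nat.zero_le (i.weight ^ 2 * (β + 2)),
        Nat.zero_le (e.weight ^ 2 * (β + 2))]
    · have := e.height_eval_le_of_almostInput H hs.2 hs₀ hP.2
      have : e.weight * (β₀ + 1) ≤ W * (β₀ + 1) := by gcongr; omega
      omega
    · intro a' ha' i'
      have : a' ≠ a := by omega
      simpa [Memory.setNum, Function.update_apply, this] using hs₀ a' ha' i'
  | seq P Q ihP ihQ =>
    obtain ⟨s₁, h₁, h₂⟩ := hr
    simp only [Program.weight] at hW
    simp only [Program.Tame, Bool.and_eq_true] at hP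
    simp only [Program.steps, Polynomial.eval_add] at hB ⊢
    -- Each elementary step may lengthen the numbers by `W * (β₀ + 1)`. This allowance is additive
    -- under composition because `β₀` does not change during the run.
    have e₁ : (P.steps.eval L + Q.steps.eval L) * (W * (β₀ + 1)) =
      P.steps.eval L * (W * (β₀ + 1)) + Q.steps.eval L * (W * (β₀ + 1)) := by ring
    rw [e₁] at hB ⊢
    obtain ⟨t₁, x₁, c₁, b₁, i₁⟩ := ihP (by omega) hP.1 hs hs₀ h₁ (by omega)
    obtain ⟨t₂, x₂, c₂, b₂, i₂⟩ := ihQ (by omega) hP.2 b₁ i₁ h₂ (by omega)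
    exact ⟨_, .seq x₁ x₂, by rw [add_mul]; omega, b₂.mono (by omega), i₂⟩
  | ite b P Q ihP ihQ =>
    simp only [Program.weight] at hW
    simp only [Program.Tame, Bool.and_eq_true] at hP
    simp only [Program.steps, Polynomial.eval_add, Polynomial.eval_one] at hB ⊢
    have e₁ : (1 + P.steps.eval L + Q.steps.eval L) * (W * (β₀ + 1)) = (W * (β₀ + 1)) +
      P.steps.eval L * (W * (β₀ + 1)) + Q.steps.eval L * (W * (β₀ + 1)) := by ring
    rw [e₁] at hB ⊢
    have hc : b.cost sz s + 1 ≤ 4 * W ^ 2 * (B + 2) := by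
      have h₁ := b.cost_le H hs
      have h₃ : 4 * (1 + b.weight) ^ 2 * (β + 2) ≤ 4 * W ^ 2 * (B + 2) := by
        gcongr <;> omega
      nlinarith [Nat.zero_le (b.weight * (β + 2)), Nat.zero_le (b.weight ^ 2 * (β + 2))]
    rcases hr with ⟨hb, h₁⟩ | ⟨hb, h₁⟩
    · obtain ⟨t₁, x₁, c₁, b₁, i₁⟩ := ihP (by omega) hP.1 hs hs₀ h₁ (by omega)
      exact ⟨_, .ite_true hb x₁, by rw [add_mul, add_mul]; omega, b₁.mono (by omega), i₁⟩
    · obtain ⟨t₁, x₁, c₁, b₁, i₁⟩ := ihQ (by omega) hP.2 hs hs₀ h₁ (by omega)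
      exact ⟨_, .ite_false hb x₁, by rw [add_mul, add_mul]; omega, b₁.mono (by omega), i₁⟩
  | _ b P ih =>
    obtain ⟨j, hj, hr⟩ := hr
    simp only [Program.weight] at hW
    simp only [Program.Tame] at hP
    simp only [Program.steps, Polynomial.eval_add, Polynomial.eval_one, Polynomial.eval_mul,
      Polynomial.eval_X] at hB ⊢
    set T := P.steps.eval L with hT
    set Δ := W * (β₀ + 1) with hΔ
    have hmono : (j * (1 + T) + 1) ≤ L * (1 + T) + 1 := by gcongr
    -- The induction needs the bound for the actual number `j` of rounds; the claim with `L` follows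
    -- from `j ≤ L`.
    suffices hmain : ∃ t, Exec sz (.while b P) s s' t ∧
        t ≤ (j * (1 + T) + 1) * (4 * W ^ 2 * (B + 2)) ∧
        s'.Bounded h (β + (j * (1 + T) + 1) * Δ) ∧ s'.InputBounded h β₀ by
      obtain ⟨t, x₁, c₁, b₁, i₁⟩ := hmain
      refine ⟨t, x₁, c₁.trans (by gcongr), b₁.mono (by gcongr), i₁⟩
    have hB' : β + (j * (1 + T) + 1) * Δ ≤ B := le_trans (by gcongr) hB
    have hcost : ∀ {s : Memory K} {β : ℕ}, s.Bounded h β → β ≤ B →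
        b.cost sz s + 1 ≤ 4 * W ^ 2 * (B + 2) := by
      intro s β hs hβ
      have h₁ := b.cost_le H hs
      have h₃ : 4 * (1 + b.weight) ^ 2 * (β + 2) ≤ 4 * W ^ 2 * (B + 2) := by
        gcongr; omega
      nlinarith [Nat.zero_le (b.weight * (β + 2)), Nat.zero_le (b.weight ^ 2 * (β + 2))]
    clear hB hj hmono
    induction j generalizing s β with
    | zero =>
      obtain ⟨hb, rfl⟩ := hr
      refine ⟨_, .while_false hb, ?_, hs.mono (by omega), hs₀⟩
      have := hcost hs (by omega)
      simpa using this
    | succ j ihj =>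
      obtain ⟨hb, s₁, h₁, h₂⟩ := hr
      have e₁ : ((j + 1) * (1 + T) + 1) * Δ = Δ + T * Δ + (j * (1 + T) + 1) * Δ := by ring
      rw [e₁] at hB'
      obtain ⟨t₁, x₁, c₁, b₁, i₁⟩ := ih (by omega) hP hs hs₀ h₁ (by omega)
      obtain ⟨t₂, x₂, c₂, b₂, i₂⟩ := ihj (b₁.mono (Nat.le_refl _)) i₁ h₂ (by omega)
      refine ⟨_, .while_true hb x₁ x₂, ?_, b₂.mono (by rw [e₁]; omega), i₂⟩
      have := hcost hs (by omega)
      have e₂ : ((j + 1) * (1 + T) + 1) * (4 * W ^ 2 * (B + 2)) = (4 * W ^ 2 * (B + 2)) +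
        T * (4 * W ^ 2 * (B + 2)) + (j * (1 + T) + 1) * (4 * W ^ 2 * (B + 2)) := by ring
      rw [e₂]
      omega

end Cost

/-! ### Program logic -/

section Logic

variable {K : Type}

@[simp] theorem Memory.setNat_nat (s : Memory K) (a i v b j : ℕ) :
    (s.setNat a i v).nat b j = if b = a ∧ j = i then v else s.nat b j := by
  simp only [Memory.setNat, Function.update_apply]
  by_cases h : b = a
  · subst h; simp [Function.update_apply]
  · simp [h]

@[simp] theorem Memory.setNat_nat_of_ne (s : Memory K) {a b : ℕ} (i v : ℕ) (h : b ≠ a) :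
    (s.setNat a i v).nat b = s.nat b := by
  funext j; simp [h]

@[simp] theorem Memory.setNum_num_of_ne (s : Memory K) {a b : ℕ} (i : ℕ) (v : K) (h : b ≠ a) :
    (s.setNum a i v).num b = s.num b := by
  simp [Memory.setNum, h]

@[simp] theorem Memory.setNat_num (s : Memory K) (a i v : ℕ) : (s.setNat a i v).num = s.num := rfl

@[simp] theorem Memory.setNum_nat (s : Memory K) (a i : ℕ) (v : K) :
    (s.setNum a i v).nat = s.nat := rfl

@[simp] theorem Memory.setNum_num (s : Memory K) (a i : ℕ) (v : K) (b j : ℕ) :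
    (s.setNum a i v).num b j = if b = a ∧ j = i then v else s.num b j := by
  simp only [Memory.setNum, Function.update_apply]
  by_cases h : b = a
  · subst h; simp [Function.update_apply]
  · simp [h]

/-- The natural-number arrays that a program may write. -/
def Program.natWrites : Program → List ℕ
  | .skip => []
  | .setNat a _ _ => [a]
  | .setNum _ _ _ => []
  | .seq P Q => P.natWrites ++ Q.natWrites
  | .ite _ P Q => P.natWrites ++ Q.natWrites
  | .while _ P => P.natWrites

/-- The numerical arrays that a program may write. -/
def Program.numWrites : Program → List ℕ
  | .skip => []
  | .setNat _ _ _ => []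
  | .setNum a _ _ => [a]
  | .seq P Q => P.numWrites ++ Q.numWrites
  | .ite _ P Q => P.numWrites ++ Q.numWrites
  | .while _ P => P.numWrites

/-- `s'` agrees with `s` on all arrays that `P` does not write. -/
structure Frame (P : Program) (s s' : Memory K) : Prop where
  nat : ∀ a, a ∉ P.natWrites → s'.nat a = s.nat a
  num : ∀ a, a ∉ P.numWrites → s'.num a = s.num a

theorem Frame.refl (P : Program) (s : Memory K) : Frame P s s := ⟨fun _ _ => rfl, fun _ _ => rfl⟩

theorem Frame.trans {P : Program} {s s' s'' : Memory K} (h : Frame P s s') (h' : Frame P s' s'') :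
    Frame P s s'' :=
  ⟨fun a ha => (h'.nat a ha).trans (h.nat a ha), fun a ha => (h'.num a ha).trans (h.num a ha)⟩

theorem Frame.mono {P Q : Program} {s s' : Memory K} (h : Frame P s s')
    (h₁ : P.natWrites ⊆ Q.natWrites) (h₂ : P.numWrites ⊆ Q.numWrites) : Frame Q s s' :=
  ⟨fun a ha => h.nat a fun h => ha (h₁ h), fun a ha => h.num a fun h => ha (h₂ h)⟩

variable [Ring K] [LE K]

theorem Runs.frame {L : ℕ} {P : Program} {s s' : Memory K} (h : Runs L P s s') :
    Frame P s s' := by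
  induction P generalizing s s' with
  | skip => obtain rfl := h; exact .refl _ _
  | setNat a i e =>
    obtain rfl := h
    refine ⟨fun b hb => ?_, fun _ _ => rfl⟩
    simp only [Program.natWrites, List.mem_singleton] at hb
    simp [Memory.setNat, hb]
  | setNum a i e =>
    obtain rfl := h
    refine ⟨fun _ _ => rfl, fun b hb => ?_⟩
    simp only [Program.numWrites, List.mem_singleton] at hb
    simp [Memory.setNum, hb]
  | seq P Q ihP ihQ =>
    obtain ⟨s₁, h₁, h₂⟩ := h
    exact ((ihP h₁).mono (by simp [Program.natWrites]) (by simp [Program.numWrites])).trans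
      ((ihQ h₂).mono (by simp [Program.natWrites]) (by simp [Program.numWrites]))
  | ite b P Q ihP ihQ =>
    rcases h with ⟨_, h₁⟩ | ⟨_, h₁⟩
    · exact (ihP h₁).mono (by simp [Program.natWrites]) (by simp [Program.numWrites])
    · exact (ihQ h₁).mono (by simp [Program.natWrites]) (by simp [Program.numWrites])
  | _ b P ih =>
    obtain ⟨j, -, h⟩ := h
    induction j generalizing s with
    | zero => obtain ⟨-, rfl⟩ := h; exact .refl _ _
    | succ j ihj =>
      obtain ⟨-, s₁, h₁, h₂⟩ := h
      exact ((ih h₁).mono (by simp [Program.natWrites]) (by simp [Program.numWrites])).trans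
        (ihj h₂)

variable {L : ℕ} {s : Memory K} {Q R : Memory K → Prop}

/-- The continuation also receives the frame of the run, so a specification need only mention arrays
that the program writes. -/
theorem wp_mono {P : Program} (h : wp L P R s) (hR : ∀ s', Frame P s s' → R s' → Q s') :
    wp L P Q s :=
  h.imp fun _ hs => ⟨hs.1, hR _ hs.1.frame hs.2⟩

@[simp] theorem wp_skip : wp L .skip Q s ↔ Q s := by simp [wp, Runs]

@[simp] theorem wp_setNat {a : ℕ} {i e : NatExp} :
    wp L (.setNat a i e) Q s ↔ Q (s.setNat a (i.eval s) (e.eval s)) := by simp [wp, Runs]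

@[simp] theorem wp_setNum {a : ℕ} {i : NatExp} {e : NumExp} :
    wp L (.setNum a i e) Q s ↔ Q (s.setNum a (i.eval s) (e.eval s)) := by simp [wp, Runs]

@[simp] theorem wp_seq {P P' : Program} :
    wp L (.seq P P') Q s ↔ wp L P (wp L P' Q) s := by
  simp only [wp, Runs]
  constructor
  · rintro ⟨s', ⟨s₁, h₁, h₂⟩, h₃⟩
    exact ⟨s₁, h₁, s', h₂, h₃⟩
  · rintro ⟨s₁, h₁, s', h₂, h₃⟩
    exact ⟨s', ⟨s₁, h₁, h₂⟩, h₃⟩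

theorem wp_ite {b : Test} {P P' : Program} (h₁ : b.Holds s → wp L P Q s)
    (h₂ : ¬ b.Holds s → wp L P' Q s) : wp L (.ite b P P') Q s := by
  by_cases hb : b.Holds s
  · obtain ⟨s', h, h'⟩ := h₁ hb
    exact ⟨s', .inl ⟨hb, h⟩, h'⟩
  · obtain ⟨s', h, h'⟩ := h₂ hb
    exact ⟨s', .inr ⟨hb, h⟩, h'⟩

/-- The measure bounds the number of remaining rounds, which is why its initial value has to be at
most `L`. Frames are relative to the entry of the loop. -/
theorem wp_while {b : Test} {P : Program} (I : Memory K → Prop) (μ : Memory K → ℕ)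
    (h₀ : I s) (hμ : μ s ≤ L)
    (hstep : ∀ s', Frame P s s' → I s' → b.Holds s' →
      wp L P (fun s'' => I s'' ∧ μ s'' < μ s') s')
    (hend : ∀ s', Frame P s s' → I s' → ¬ b.Holds s' → Q s') : wp L (.while b P) Q s := by
  have key : ∀ j (s' : Memory K), μ s' ≤ j → Frame P s s' → I s' →
      ∃ i ≤ j, ∃ s'', Iterates b.Holds (Runs L P) i s' s'' ∧ Q s'' := by
    intro j
    induction j with
    | zero =>
      intro s' hj hf hI
      by_cases hb : b.Holds s'
      · obtain ⟨s'', -, -, h⟩ := hstep s' hf hI hb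
        omega
      · exact ⟨0, le_rfl, s', ⟨hb, rfl⟩, hend s' hf hI hb⟩
    | succ j ih =>
      intro s' hj hf hI
      by_cases hb : b.Holds s'
      · obtain ⟨s₁, hr, hI₁, hlt⟩ := hstep s' hf hI hb
        obtain ⟨i, hi, s'', hit, hQ⟩ := ih s₁ (by omega) (hf.trans hr.frame) hI₁
        exact ⟨i + 1, by omega, s'', ⟨hb, s₁, hr, hit⟩, hQ⟩
      · exact ⟨0, by omega, s', ⟨hb, rfl⟩, hend s' hf hI hb⟩
  obtain ⟨i, hi, s', hit, hQ⟩ := key _ s le_rfl (.refl _ _) h₀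
  exact ⟨s', ⟨i, hi.trans hμ, hit⟩, hQ⟩

end Logic

/-! #### Derived constructs -/

/-- The scalar variable stored in cell `0` of the natural-number array `a`. -/
def NatExp.var (a : ℕ) : NatExp := .get a (.const 0)

def Program.setVar (a : ℕ) (e : NatExp) : Program := .setNat a (.const 0) e

def Test.natLt (e₁ e₂ : NatExp) : Test := .natLe (.add e₁ (.const 1)) e₂

def Test.natEq (e₁ e₂ : NatExp) : Test := .and (.natLe e₁ e₂) (.natLe e₂ e₁)

def Test.or (b₁ b₂ : Test) : Test := .not (.and (.not b₁) (.not b₂))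

/-- `for i = 0, …, e - 1 do P`. -/
def Program.forLoop (i : ℕ) (e : NatExp) (P : Program) : Program :=
  .seq (.setVar i (.const 0))
    (.while (.natLt (.var i) e) (.seq P (.setVar i (.add (.var i) (.const 1)))))

@[simp] theorem Program.forLoop_natWrites (i : ℕ) (e : NatExp) (P : Program) :
    (Program.forLoop i e P).natWrites = i :: (P.natWrites ++ [i]) := rfl

@[simp] theorem Program.forLoop_numWrites (i : ℕ) (e : NatExp) (P : Program) :
    (Program.forLoop i e P).numWrites = P.numWrites ++ [] := rfl

attribute [simp] NatExp.eval NumExp.eval Test.Holds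

section Derived

variable {K : Type} [Ring K] [LE K] {L : ℕ} {s : Memory K} {Q : Memory K → Prop}

@[simp] theorem NatExp.eval_var (a : ℕ) : (NatExp.var a).eval s = s.nat a 0 := rfl

@[simp] theorem wp_setVar {a : ℕ} {e : NatExp} :
    wp L (.setVar a e) Q s ↔ Q (s.setNat a 0 (e.eval s)) := wp_setNat

@[simp] theorem Test.holds_natLt {e₁ e₂ : NatExp} :
    (Test.natLt e₁ e₂).Holds s ↔ e₁.eval s < e₂.eval s := Iff.rfl

@[simp] theorem Test.holds_natEq {e₁ e₂ : NatExp} :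
    (Test.natEq e₁ e₂).Holds s ↔ e₁.eval s = e₂.eval s :=
  (le_antisymm_iff (a := e₁.eval s)).symm

@[simp] theorem Test.holds_or {b₁ b₂ : Test} :
    (Test.or b₁ b₂).Holds s ↔ b₁.Holds s ∨ b₂.Holds s := by
  simp only [Test.or, Test.Holds]; tauto

/-- The invariant is stated for the memory after the counter has been advanced, hence the `setNat`
in the hypotheses. The bound `e` is evaluated anew in every round and so must be constant on the
whole frame. -/
theorem wp_forLoop {i : ℕ} {e : NatExp} {P : Program} (n : ℕ) (I : ℕ → Memory K → Prop)
    (hn : n ≤ L) (hi : i ∉ P.natWrites)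
    (he : ∀ s', Frame (Program.forLoop i e P) s s' → e.eval s' = n)
    (h₀ : I 0 (s.setNat i 0 0))
    (hstep : ∀ j s', j < n → Frame (Program.forLoop i e P) s s' → s'.nat i 0 = j → I j s' →
      wp L P (fun s'' => I (j + 1) (s''.setNat i 0 (j + 1))) s')
    (hend : ∀ s', Frame (Program.forLoop i e P) s s' → I n s' → Q s') :
    wp L (Program.forLoop i e P) Q s := by
  have hf₀ : Frame (Program.forLoop i e P) s (s.setNat i 0 0) := by
    refine ⟨fun a ha => ?_, fun _ _ => rfl⟩
    simp only [Program.forLoop_natWrites, List.mem_cons, not_or] at ha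
    funext j
    simp [ha.1]
  have hmono : ∀ {s₁ s₂ : Memory K},
      Frame (.seq P (.setVar i (.add (.var i) (.const 1)))) s₁ s₂ →
      Frame (Program.forLoop i e P) s₁ s₂ := fun h =>
    h.mono (by simp [Program.natWrites, Program.setVar]) (by simp [Program.numWrites, Program.setVar])
  rw [Program.forLoop, wp_seq, wp_setVar]
  refine wp_while (fun s' => s'.nat i 0 ≤ n ∧ I (s'.nat i 0) s') (fun s' => n - s'.nat i 0)
    (by simpa [NatExp.eval] using h₀) (by omega) ?_ ?_
  · rintro s' hf ⟨hle, hI⟩ hb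
    have hf' := hf₀.trans (hmono hf)
    simp only [Test.holds_natLt, NatExp.eval_var, he s' hf'] at hb
    rw [wp_seq]
    refine wp_mono (hstep _ s' hb hf' rfl hI) fun s'' hf'' hI'' => ?_
    have hi' : s''.nat i 0 = s'.nat i 0 := by rw [hf''.nat i hi]
    simp only [wp_setVar, NatExp.eval, NatExp.eval_var, hi']
    refine ⟨⟨by simpa using hb, by simpa using hI''⟩, ?_⟩
    simp
    omega
  · rintro s' hf ⟨hle, hI⟩ hb
    have hf' := hf₀.trans (hmono hf)
    simp only [Test.holds_natLt, NatExp.eval_var, he s' hf'] at hb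
    have : s'.nat i 0 = n := by omega
    exact hend s' hf' (this ▸ hI)

end Derived

/-- Distinct matrix entries occupy distinct cells; only the column indices need to be in range. -/
theorem mul_add_inj {c u u' x x' : ℕ} (hx : x < c) (hx' : x' < c) :
    u * c + x = u' * c + x' ↔ u = u' ∧ x = x' := by
  constructor
  · intro h
    have h₁ : (u * c + x) / c = u := by
      rw [mul_comm, Nat.mul_add_div (by omega), Nat.div_eq_of_lt hx, add_zero]
    have h₂ : (u' * c + x') / c = u' := by
      rw [mul_comm, Nat.mul_add_div (by omega), Nat.div_eq_of_lt hx', add_zero]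
    have : u = u' := by rw [← h₁, h, h₂]
    subst this
    exact ⟨rfl, by omega⟩
  · rintro ⟨rfl, rfl⟩; rfl

/-! ### Matchings and the blossom search

Vertices are the numbers below `V`; a matching is an involution whose fixed points are the exposed
vertices. -/

/-- `M` is a matching of the graph `adj` on the vertices below `V`. -/
structure IsMatching (V : ℕ) (adj : ℕ → ℕ → Prop) (M : ℕ → ℕ) : Prop where
  lt : ∀ x < V, M x < V
  invol : ∀ x < V, M (M x) = x
  adj : ∀ x < V, M x ≠ x → adj x (M x)

/-- The state of a search for an augmenting path from the exposed vertex `r` of the matching `M`.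
A vertex is unseen (`lab x = 0`), inner (`lab x = 1`) or outer (`lab x = 2`). The outer vertices are
partitioned into blossoms, `b x` being a name of the blossom of `x`; for every outer vertex `u` there
is a matching `N u` that exposes `u` instead of `r`. -/
structure SearchState (V : ℕ) (adj : ℕ → ℕ → Prop) (M : ℕ → ℕ) (r : ℕ) (lab b : ℕ → ℕ)
    (N : ℕ → ℕ → ℕ) : Prop where
  root_lt : r < V
  root : lab r = 2
  lab_le : ∀ x < V, lab x ≤ 2
  matching : ∀ u < V, lab u = 2 → IsMatching V adj (N u)
  self : ∀ u < V, lab u = 2 → N u u = u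
  exposed : ∀ u < V, lab u = 2 → ∀ x < V, N u x = x → x = u ∨ (lab x = 0 ∧ M x = x)
  unseen : ∀ u < V, lab u = 2 → ∀ x < V, lab x = 0 → N u x = M x ∧ lab (N u x) = 0
  inner : ∀ u < V, lab u = 2 → ∀ a < V, lab a = 1 → lab (N u a) = 2
  name : ∀ c < V, lab c = 2 → b c < V ∧ lab (b c) = 2
  /-- Every blossom has exactly one vertex that is exposed or matched to an inner vertex. -/
  port : ∀ u < V, lab u = 2 → ∀ c < V, lab c = 2 → ∃ y < V, lab y = 2 ∧ b y = b c ∧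
    (y = u ∨ lab (N u y) = 1) ∧ ∀ z < V, lab z = 2 → b z = b c → z ≠ y →
      z ≠ u ∧ lab (N u z) = 2 ∧ b (N u z) = b c
  /-- An inner vertex has neighbours in at most two blossoms. -/
  two : ∀ a < V, lab a = 1 → ∀ u₁ < V, lab u₁ = 2 → ∀ u₂ < V, lab u₂ = 2 → ∀ u₃ < V, lab u₃ = 2 →
    b (N u₁ a) = b (N u₂ a) ∨ b (N u₁ a) = b (N u₃ a) ∨ b (N u₂ a) = b (N u₃ a)

namespace SearchState

variable {V : ℕ} {adj : ℕ → ℕ → Prop} {M : ℕ → ℕ} {r : ℕ} {lab b : ℕ → ℕ} {N : ℕ → ℕ → ℕ}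

/-- Only `r` is outer, so only its row and its name matter; all other rows and names are arbitrary.
-/
theorem start (hM : IsMatching V adj M) (hr : r < V) (hMr : M r = r) (hlab : ∀ x < V, x ≠ r → lab x = 0)
    (hlabr : lab r = 2) (hb : b r = r) (hN : ∀ x < V, N r x = M x) :
    SearchState V adj M r lab b N := by
  have key : ∀ u < V, lab u = 2 → u = r := by
    intro u hu h
    by_contra hne
    have := hlab u hu hne
    omega
  have no1 : ∀ u < V, lab u ≠ 1 := by
    intro u hu h
    by_cases hne : u = r
    · subst hne; omega
    · have := hlab u hu hne
      omega
  refine ⟨hr, hlabr, ?_, ?_, ?_, ?_, ?_, ?_, ?_, ?_, ?_⟩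
  · intro x hx
    by_cases h : x = r
    · subst h; omega
    · rw [hlab x hx h]; omega
  · intro u hu h
    obtain rfl := key u hu h
    refine ⟨fun x hx => by rw [hN x hx]; exact hM.lt x hx, fun x hx => ?_, fun x hx => ?_⟩
    · rw [hN x hx, hN _ (hM.lt x hx), hM.invol x hx]
    · rw [hN x hx]; exact hM.adj x hx
  · intro u hu h
    obtain rfl := key u hu h
    rw [hN _ hr, hMr]
  · intro u hu h x hx hfix
    obtain rfl := key u hu h
    by_cases hxr : x = u
    · exact .inl hxr
    · exact .inr ⟨hlab x hx hxr, by rw [← hN x hx, hfix]⟩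
  · intro u hu h x hx hlx
    obtain rfl := key u hu h
    refine ⟨hN x hx, ?_⟩
    rw [hN x hx]
    refine hlab _ (hM.lt x hx) fun h' => ?_
    have := hM.invol x hx
    rw [h', hMr] at this
    subst this
    omega
  · exact fun u _ _ a ha h => absurd h (no1 a ha)
  · intro c hc h
    obtain rfl := key c hc h
    rw [hb]; exact ⟨hr, hlabr⟩
  · intro u hu h c hc h'
    obtain rfl := key u hu h
    obtain rfl := key c hc h'
    exact ⟨c, hr, hlabr, rfl, .inl rfl, fun z hz hz' _ hne => absurd (key z hz hz') hne⟩
  · exact fun a ha h => absurd h (no1 a ha)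

/-- Two vertices of a blossom that are matched to inner vertices coincide. -/
theorem port_unique (I : SearchState V adj M r lab b N)
    {u y y' : ℕ} (hu : u < V) (hlu : lab u = 2) (hy : y < V) (hly : lab y = 2)
    (hy' : y' < V) (hly' : lab y' = 2) (hb : b y = b y') (h : y = u ∨ lab (N u y) = 1)
    (h' : y' = u ∨ lab (N u y') = 1) : y = y' := by
  obtain ⟨z, -, -, -, -, hz⟩ := I.port u hu hlu y hy hly
  have h₁ : y = z := by
    by_contra hne
    have := hz y hy hly rfl hne
    rcases h with h | h
    · exact this.1 h
    · omega
  have h₂ : y' = z := by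
    by_contra hne
    have := hz y' hy' hly' hb.symm hne
    rcases h' with h | h
    · exact this.1 h
    · omega
  rw [h₁, h₂]

/-- In the row `N u` the port of the blossom of `u` is `u` itself, which leaves no vertex there for
an inner partner. -/
theorem inner_blossom_ne (I : SearchState V adj M r lab b N)
    {u a : ℕ} (hu : u < V) (hlu : lab u = 2) (ha : a < V) (hla : lab a = 1) :
    b (N u a) ≠ b u := by
  intro h
  have m := I.matching u hu hlu
  have h₁ := I.port_unique hu hlu (m.lt a ha) (I.inner u hu hlu a ha hla) hu hlu h
    (.inr (by rw [m.invol a ha]; exact hla)) (.inl rfl)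
  have h₂ := m.invol a ha
  rw [h₁, I.self u hu hlu] at h₂
  subst h₂
  omega

/-- Both partners would be the port of the same blossom, hence equal. -/
theorem inner_blossom_inj (I : SearchState V adj M r lab b N)
    {u a a' : ℕ} (hu : u < V) (hlu : lab u = 2) (ha : a < V)
    (hla : lab a = 1) (ha' : a' < V) (hla' : lab a' = 1) (h : b (N u a) = b (N u a')) :
    a = a' := by
  have m := I.matching u hu hlu
  have h₁ := I.port_unique hu hlu (m.lt a ha) (I.inner u hu hlu a ha hla) (m.lt a' ha')
    (I.inner u hu hlu a' ha' hla') h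
    (.inr (by rw [m.invol a ha]; exact hla)) (.inr (by rw [m.invol a' ha']; exact hla'))
  rw [← m.invol a ha, h₁, m.invol a' ha']

/-- A set of seen vertices that is a union of blossoms and inner vertices and is mapped into itself
by one of the matchings has one more blossom than inner vertices. -/
theorem card_blossoms (I : SearchState V adj M r lab b N)
    {S : ℕ → Prop} [DecidablePred S] {v : ℕ} (hv : v < V) (hlv : lab v = 2)
    (hSv : S v) (hclass : ∀ x < V, ∀ y < V, lab x = 2 → lab y = 2 → b x = b y → S x → S y)
    (hmap : ∀ x < V, S x → S (N v x)) :
    (((Finset.range V).filter fun x => S x ∧ lab x = 2).image b).card =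
      ((Finset.range V).filter fun x => S x ∧ lab x = 1).card + 1 := by
  have m := I.matching v hv hlv
  have hmem : b v ∈ ((Finset.range V).filter fun x => S x ∧ lab x = 2).image b :=
    Finset.mem_image_of_mem b (by simp [hv, hSv, hlv])
  -- The row `N v` matches the inner vertices of `S` bijectively to the ports of the blossoms of `S`
  -- other than that of `v`, whose port is `v`.
  rw [← Finset.card_erase_add_one hmem, add_left_inj, eq_comm]
  refine Finset.card_bij (fun a _ => b (N v a)) ?_ ?_ ?_
  · intro a ha
    simp only [Finset.mem_filter, Finset.mem_range] at ha
    refine Finset.mem_erase.mpr ⟨I.inner_blossom_ne hv hlv ha.1 ha.2.2,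
      Finset.mem_image_of_mem b ?_⟩
    simp only [Finset.mem_filter, Finset.mem_range]
    exact ⟨m.lt a ha.1, hmap a ha.1 ha.2.1, I.inner v hv hlv a ha.1 ha.2.2⟩
  · intro a ha a' ha' h
    simp only [Finset.mem_filter, Finset.mem_range] at ha ha'
    exact I.inner_blossom_inj hv hlv ha.1 ha.2.2 ha'.1 ha'.2.2 h
  · intro c hc
    obtain ⟨hne, hc⟩ := Finset.mem_erase.mp hc
    obtain ⟨x, hx, rfl⟩ := Finset.mem_image.mp hc
    simp only [Finset.mem_filter, Finset.mem_range] at hx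
    obtain ⟨y, hy, hly, hby, hport, -⟩ := I.port v hv hlv x hx.1 hx.2.2
    have hport : lab (N v y) = 1 := by
      rcases hport with rfl | h
      · exact absurd hby.symm hne
      · exact h
    refine ⟨N v y, ?_, ?_⟩
    · simp only [Finset.mem_filter, Finset.mem_range]
      exact ⟨m.lt y hy, hmap y hy (hclass x hx.1 y hy hx.2.2 hly hby.symm hx.2.1), hport⟩
    · simp only [m.invol y hy, hby]

/-- If `S` has one more blossom than inner vertices and the matching `N u` matches the inner
vertices of `S` inside `S`, then at most one vertex of `S` is matched outside `S`, and none if `u`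
lies in `S`. -/
theorem port_union (I : SearchState V adj M r lab b N)
    {S : ℕ → Prop} [DecidablePred S] (hSV : ∀ x, S x → x < V ∧ lab x ≠ 0)
    (hclass : ∀ x < V, ∀ y < V, lab x = 2 → lab y = 2 → b x = b y → S x → S y)
    (hcard : (((Finset.range V).filter fun x => S x ∧ lab x = 2).image b).card =
      ((Finset.range V).filter fun x => S x ∧ lab x = 1).card + 1)
    {u : ℕ} (hu : u < V) (hlu : lab u = 2) (hin : ∀ a < V, S a → lab a = 1 → S (N u a)) :
    ∃ y < V, S y ∧ lab y = 2 ∧ (y = u ∨ (lab (N u y) = 1 ∧ ¬ S (N u y))) ∧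
      ∀ z < V, S z → z ≠ y → z ≠ u ∧ S (N u z) := by
  have m := I.matching u hu hlu
  set Cl := ((Finset.range V).filter fun x => S x ∧ lab x = 2).image b with hCl
  set A := (Finset.range V).filter fun x => S x ∧ lab x = 1 with hA
  have hsub : A.image (fun a => b (N u a)) ⊆ Cl := by
    intro c hc
    obtain ⟨a, ha, rfl⟩ := Finset.mem_image.mp hc
    simp only [hA, Finset.mem_filter, Finset.mem_range] at ha
    refine Finset.mem_image_of_mem b ?_
    simp only [Finset.mem_filter, Finset.mem_range]
    exact ⟨m.lt a ha.1, hin a ha.1 ha.2.1 ha.2.2, I.inner u hu hlu a ha.1 ha.2.2⟩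
  have hcardA : (A.image (fun a => b (N u a))).card = A.card := by
    refine Finset.card_image_of_injOn ?_
    intro a ha a' ha' h
    simp only [hA, Finset.coe_filter, Finset.mem_range, Set.mem_ofPred_eq] at ha ha'
    exact I.inner_blossom_inj hu hlu ha.1 ha.2.2 ha'.1 ha'.2.2 h
  -- The inner vertices of `S` reach pairwise different blossoms of `S`, and there is one blossom
  -- more. The single blossom `c₀` left over contains the only vertex that `N u` may match outside
  -- `S`, namely its port.
  obtain ⟨c₀, hc₀⟩ : ∃ c₀, Cl \ A.image (fun a => b (N u a)) = {c₀} := by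
    rw [← Finset.card_eq_one, Finset.card_sdiff_of_subset hsub, hcard, hcardA]
    omega
  have hc₀' : c₀ ∈ Cl ∧ c₀ ∉ A.image (fun a => b (N u a)) := by
    rw [← Finset.mem_sdiff, hc₀]; simp
  have hother : ∀ x < V, S x → lab x = 2 → b x ≠ c₀ → ∃ a < V, S a ∧ lab a = 1 ∧ b (N u a) = b x := by
    intro x hx hSx hlx hne
    have h₁ : b x ∈ Cl := Finset.mem_image_of_mem b (by simp [hx, hSx, hlx])
    have h₂ : b x ∉ Cl \ A.image (fun a => b (N u a)) := by
      rw [hc₀]; simpa using hne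
    simp only [Finset.mem_sdiff, not_and, not_not] at h₂
    obtain ⟨a, ha, h⟩ := Finset.mem_image.mp (h₂ h₁)
    simp only [hA, Finset.mem_filter, Finset.mem_range] at ha
    exact ⟨a, ha.1, ha.2.1, ha.2.2, h⟩
  obtain ⟨x₀, hx₀, rfl⟩ := Finset.mem_image.mp hc₀'.1
  simp only [Finset.mem_filter, Finset.mem_range] at hx₀
  obtain ⟨y, hy, hly, hby, hport, hrest⟩ := I.port u hu hlu x₀ hx₀.1 hx₀.2.2
  have hSy := hclass x₀ hx₀.1 y hy hx₀.2.2 hly hby.symm hx₀.2.1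
  have hy_ne : y = u ∨ (lab (N u y) = 1 ∧ ¬ S (N u y)) := by
    rcases hport with h | h
    · exact .inl h
    · refine .inr ⟨h, fun hS => hc₀'.2 (Finset.mem_image.mpr ⟨N u y, ?_, ?_⟩)⟩
      · simp only [hA, Finset.mem_filter, Finset.mem_range]
        exact ⟨m.lt y hy, hS, h⟩
      · simp only [m.invol y hy, hby]
  refine ⟨y, hy, hSy, hly, hy_ne, fun z hz hSz hzy => ?_⟩
  have hlz := (hSV z hSz).2
  have := I.lab_le z hz
  rcases (show lab z = 1 ∨ lab z = 2 by omega) with h | h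
  · refine ⟨?_, hin z hz hSz h⟩
    rintro rfl
    omega
  · by_cases hbz : b z = b x₀
    · have := hrest z hz h hbz hzy
      exact ⟨this.1, hclass z hz _ (m.lt z hz) h this.2.1 (by rw [hbz, this.2.2]) hSz⟩
    · obtain ⟨a, ha, hSa, hla, hba⟩ := hother z hz hSz h hbz
      have hzu : z ≠ u := by
        rintro rfl
        exact I.inner_blossom_ne hu hlu ha hla hba
      refine ⟨hzu, ?_⟩
      have hNa := I.inner u hu hlu a ha hla
      -- In every other blossom of `S` the port is matched to the inner vertex `a` of `S`, and the
      -- remaining vertices are matched within the blossom.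
      by_cases hza : z = N u a
      · rw [hza, m.invol a ha]; exact hSa
      · obtain ⟨y', hy', hly', hby', hport', hrest'⟩ := I.port u hu hlu z hz h
        have : N u a = y' := I.port_unique hu hlu (m.lt a ha) hNa hy' hly' (by rw [hba, hby'])
          (.inr (by rw [m.invol a ha]; exact hla)) hport'
        have := hrest' z hz h rfl (by rw [← this]; exact hza)
        exact hclass z hz _ (m.lt z hz) h this.2.1 this.2.2.symm hSz

/-- Merging the blossoms and inner vertices of a suitable set `S` into one blossom. -/
theorem shrink (I : SearchState V adj M r lab b N)
    {S : ℕ → Prop} [DecidablePred S] {v w : ℕ} {lab' b' : ℕ → ℕ} {N' : ℕ → ℕ → ℕ}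
    (hv : v < V) (hlv : lab v = 2) (hw : w < V) (hlw : lab w = 2) (hSv : S v) (hSw : S w)
    (hSV : ∀ x, S x → x < V ∧ lab x ≠ 0)
    (hclass : ∀ x < V, ∀ y < V, lab x = 2 → lab y = 2 → b x = b y → S x → S y)
    (hmapv : ∀ x < V, S x → S (N v x)) (hmapw : ∀ x < V, S x → S (N w x))
    (htwo : ∀ a < V, S a → lab a = 1 → b (N v a) ≠ b (N w a))
    (hlab' : ∀ x < V, lab' x = if S x then 2 else lab x)
    (hb' : ∀ x < V, b' x = if S x then b v else b x)
    (hold : ∀ u < V, lab u = 2 → ∀ x < V, N' u x = N u x)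
    (hnew : ∀ a < V, S a → lab a = 1 → IsMatching V adj (N' a) ∧ N' a a = a ∧
      (∀ x < V, N' a x = x → x = a ∨ (lab x = 0 ∧ M x = x)) ∧
      (∀ x < V, S x → S (N' a x)) ∧ ∀ x < V, ¬ S x → N' a x = N w x) :
    SearchState V adj M r lab' b' N' := by
  have hcard := I.card_blossoms hv hlv hSv hclass hmapv
  have mv := I.matching v hv hlv
  have mw := I.matching w hw hlw
  -- The partners of `a` in `N v` and `N w` lie in two different blossoms, both inside `S`. By `two`
  -- there is no third one, so every row matches `a` inside `S`.
  have hin : ∀ u < V, lab u = 2 → ∀ a < V, S a → lab a = 1 → S (N u a) := by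
    intro u hu hlu a ha hSa hla
    have hua := (I.matching u hu hlu).lt a ha
    have hlua := I.inner u hu hlu a ha hla
    rcases I.two a ha hla v hv hlv w hw hlw u hu hlu with h | h | h
    · exact absurd h (htwo a ha hSa hla)
    · exact hclass _ (mv.lt a ha) _ hua (I.inner v hv hlv a ha hla) hlua h (hmapv a ha hSa)
    · exact hclass _ (mw.lt a ha) _ hua (I.inner w hw hlw a ha hla) hlua h (hmapw a ha hSa)
  have hlab'2 : ∀ x < V, lab' x = 2 → lab x = 2 ∨ (S x ∧ lab x = 1) := by
    intro x hx h
    rw [hlab' x hx] at h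
    split_ifs at h with hS
    · have := (hSV x hS).2
      have := I.lab_le x hx
      rcases (show lab x = 1 ∨ lab x = 2 by omega) with h | h
      exacts [.inr ⟨hS, h⟩, .inl h]
    · exact .inl h
  have hlabS : ∀ x < V, S x → lab' x = 2 := fun x hx h => by rw [hlab' x hx, if_pos h]
  have hlabnS : ∀ x < V, ¬ S x → lab' x = lab x := fun x hx h => by rw [hlab' x hx, if_neg h]
  have hlab20 : ∀ x < V, lab x = 2 → lab' x = 2 := by
    intro x hx h
    rw [hlab' x hx]; split_ifs <;> omega
  have hlab'0 : ∀ x < V, lab' x = 0 → lab x = 0 ∧ ¬ S x := by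
    intro x hx h
    rw [hlab' x hx] at h
    split_ifs at h with hS
    exact ⟨h, hS⟩
  have hlab0 : ∀ x < V, lab x = 0 → lab' x = 0 := by
    intro x hx h
    rw [hlab' x hx, if_neg, h]
    exact fun hS => (hSV x hS).2 h
  have hlab'1 : ∀ x < V, lab' x = 1 → lab x = 1 ∧ ¬ S x := by
    intro x hx h
    rw [hlab' x hx] at h
    split_ifs at h with hS
    · omega
    · exact ⟨h, hS⟩
  have hbS : ∀ x < V, S x → b' x = b v := fun x hx h => by rw [hb' x hx, if_pos h]
  have hbnS : ∀ x < V, ¬ S x → b' x = b x := fun x hx h => by rw [hb' x hx, if_neg h]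
  have hbeq : ∀ x < V, ∀ y < V, lab x = 2 → lab y = 2 → b x = b y → b' x = b' y := by
    intro x hx y hy hlx hly h
    by_cases hS : S x
    · rw [hbS x hx hS, hbS y hy (hclass x hx y hy hlx hly h hS)]
    · rw [hbnS x hx hS, hbnS y hy fun h' => hS (hclass y hy x hx hly hlx h.symm h'), h]
  -- every new row agrees outside `S` with an old row whose exposed vertex and whose image of `S`
  -- are in `S`
  have hrow : ∀ u < V, lab' u = 2 → ∃ u₀ < V, lab u₀ = 2 ∧ (S u ↔ S u₀) ∧ (¬ S u → u₀ = u) ∧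
      (∀ x < V, ¬ S x → N' u x = N u₀ x) ∧ (∀ a < V, S a → lab a = 1 → S (N u₀ a)) := by
    intro u hu h
    rcases hlab'2 u hu h with h | ⟨hS, h⟩
    · exact ⟨u, hu, h, Iff.rfl, fun _ => rfl, fun x hx _ => hold u hu h x hx, hin u hu h⟩
    · exact ⟨w, hw, hlw, by simp [hS, hSw], fun h' => absurd hS h', (hnew u hu hS h).2.2.2.2,
        hin w hw hlw⟩
  have hmatch : ∀ u < V, lab' u = 2 → IsMatching V adj (N' u) := by
    intro u hu h
    rcases hlab'2 u hu h with h | ⟨hS, h⟩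
    · have m := I.matching u hu h
      refine ⟨fun x hx => by rw [hold u hu h x hx]; exact m.lt x hx, fun x hx => ?_,
        fun x hx => ?_⟩
      · rw [hold u hu h x hx, hold u hu h _ (m.lt x hx), m.invol x hx]
      · rw [hold u hu h x hx]; exact m.adj x hx
    · exact (hnew u hu hS h).1
  refine ⟨I.root_lt, hlab20 r I.root_lt I.root, ?_, hmatch, ?_, ?_, ?_, ?_, ?_, ?_, ?_⟩
  · intro x hx
    rw [hlab' x hx]
    split_ifs
    exacts [le_rfl, I.lab_le x hx]
  · intro u hu h
    rcases hlab'2 u hu h with h | ⟨hS, h⟩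
    · rw [hold u hu h u hu, I.self u hu h]
    · exact (hnew u hu hS h).2.1
  · intro u hu h x hx hfix
    have : x = u ∨ (lab x = 0 ∧ M x = x) := by
      rcases hlab'2 u hu h with h | ⟨hS, h⟩
      · rw [hold u hu h x hx] at hfix
        exact I.exposed u hu h x hx hfix
      · exact (hnew u hu hS h).2.2.1 x hx hfix
    exact this.imp id fun h => ⟨hlab0 x hx h.1, h.2⟩
  · intro u hu h x hx hlx
    obtain ⟨u₀, hu₀, hlu₀, -, -, hout, -⟩ := hrow u hu h
    obtain ⟨hx0, hSx⟩ := hlab'0 x hx hlx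
    rw [hout x hx hSx]
    have := I.unseen u₀ hu₀ hlu₀ x hx hx0
    exact ⟨this.1, hlab0 _ ((I.matching u₀ hu₀ hlu₀).lt x hx) this.2⟩
  · intro u hu h a ha hla
    obtain ⟨u₀, hu₀, hlu₀, -, -, hout, -⟩ := hrow u hu h
    obtain ⟨ha1, hSa⟩ := hlab'1 a ha hla
    rw [hout a ha hSa]
    exact hlab20 _ ((I.matching u₀ hu₀ hlu₀).lt a ha) (I.inner u₀ hu₀ hlu₀ a ha ha1)
  · intro c hc h
    by_cases hS : S c
    · rw [hbS c hc hS]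
      have := I.name v hv hlv
      exact ⟨this.1, hlab20 _ this.1 this.2⟩
    · rw [hbnS c hc hS]
      have := I.name c hc (by rw [← hlabnS c hc hS, h])
      exact ⟨this.1, hlab20 _ this.1 this.2⟩
  · intro u hu h c hc hlc
    by_cases hSc : S c
    · have hfin : ∃ y < V, S y ∧ (y = u ∨ lab' (N' u y) = 1) ∧
          ∀ z < V, S z → z ≠ y → z ≠ u ∧ S (N' u z) := by
        rcases hlab'2 u hu h with h | ⟨hS, h⟩
        · obtain ⟨y, hy, hSy, hly, hyu, hrest⟩ :=
            I.port_union hSV hclass hcard hu h (hin u hu h)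
          refine ⟨y, hy, hSy, hyu.imp id fun h' => ?_, fun z hz hSz hzy => ?_⟩
          · rw [hold u hu h y hy, hlabnS _ ((I.matching u hu h).lt y hy) h'.2]
            exact h'.1
          · rw [hold u hu h z hz]
            exact hrest z hz hSz hzy
        · exact ⟨u, hu, hS, .inl rfl, fun z hz hSz hzy =>
            ⟨hzy, (hnew u hu hS h).2.2.2.1 z hz hSz⟩⟩
      obtain ⟨y, hy, hSy, hyu, hrest⟩ := hfin
      refine ⟨y, hy, hlabS y hy hSy, by rw [hbS y hy hSy, hbS c hc hSc], hyu, ?_⟩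
      intro z hz hlz hbz hzy
      have hSz : S z := by
        by_contra hSz
        rw [hbS c hc hSc, hbnS z hz hSz] at hbz
        exact hSz (hclass v hv z hz hlv (by rw [← hlabnS z hz hSz, hlz]) hbz.symm hSv)
      have := hrest z hz hSz hzy
      have hlt := (hmatch u hu h).lt z hz
      exact ⟨this.1, hlabS _ hlt this.2, by rw [hbS _ hlt this.2, hbS c hc hSc]⟩
    · have hlc2 : lab c = 2 := by rw [← hlabnS c hc hSc, hlc]
      obtain ⟨u₀, hu₀, hlu₀, hSu, hequ, hout, hin₀⟩ := hrow u hu h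
      have m := I.matching u₀ hu₀ hlu₀
      have hnc : ∀ z < V, lab z = 2 → b z = b c → ¬ S z := fun z hz hlz hbz hSz =>
        hSc (hclass z hz c hc hlz hlc2 hbz hSz)
      obtain ⟨y, hy, hly, hby, hport, hrest⟩ := I.port u₀ hu₀ hlu₀ c hc hlc2
      have hSy := hnc y hy hly hby
      refine ⟨y, hy, hlab20 y hy hly, by rw [hbnS y hy hSy, hbnS c hc hSc, hby], ?_, ?_⟩
      · rcases hport with rfl | hport
        · exact .inl (hequ fun h' => hSy (hSu.mp h'))
        · right
          rw [hout y hy hSy, hlabnS _ (m.lt y hy), hport]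
          intro hS
          have := hin₀ _ (m.lt y hy) hS hport
          rw [m.invol y hy] at this
          exact hSy this
      · intro z hz hlz hbz hzy
        have hSz : ¬ S z := by
          intro hSz
          rw [hbS z hz hSz, hbnS c hc hSc] at hbz
          exact hSc (hclass v hv c hc hlv hlc2 hbz hSv)
        have hlz2 : lab z = 2 := by rw [← hlabnS z hz hSz, hlz]
        rw [hbnS z hz hSz, hbnS c hc hSc] at hbz
        have := hrest z hz hlz2 hbz hzy
        rw [hout z hz hSz]
        have hS' := hnc _ (m.lt z hz) this.2.1 this.2.2
        refine ⟨?_, hlab20 _ (m.lt z hz) this.2.1, by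
          rw [hbnS _ (m.lt z hz) hS', hbnS c hc hSc, this.2.2]⟩
        rintro rfl
        exact this.1 (hequ hSz).symm
  -- Outside `S` each new row agrees with an old one, and merging can only identify blossoms, so an
  -- inner vertex gains no further blossom.
  · intro a ha hla u₁ hu₁ hl₁ u₂ hu₂ hl₂ u₃ hu₃ hl₃
    obtain ⟨ha1, hSa⟩ := hlab'1 a ha hla
    obtain ⟨w₁, hw₁, hlw₁, -, -, ho₁, -⟩ := hrow u₁ hu₁ hl₁
    obtain ⟨w₂, hw₂, hlw₂, -, -, ho₂, -⟩ := hrow u₂ hu₂ hl₂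
    obtain ⟨w₃, hw₃, hlw₃, -, -, ho₃, -⟩ := hrow u₃ hu₃ hl₃
    rw [ho₁ a ha hSa, ho₂ a ha hSa, ho₃ a ha hSa]
    have l : ∀ u < V, lab u = 2 → N u a < V := fun u hu h => (I.matching u hu h).lt a ha
    have i : ∀ u < V, lab u = 2 → lab (N u a) = 2 := fun u hu h => I.inner u hu h a ha ha1
    rcases I.two a ha ha1 w₁ hw₁ hlw₁ w₂ hw₂ hlw₂ w₃ hw₃ hlw₃ with h | h | h
    · exact .inl (hbeq _ (l _ hw₁ hlw₁) _ (l _ hw₂ hlw₂) (i _ hw₁ hlw₁) (i _ hw₂ hlw₂) h)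
    · exact .inr (.inl (hbeq _ (l _ hw₁ hlw₁) _ (l _ hw₃ hlw₃) (i _ hw₁ hlw₁) (i _ hw₃ hlw₃) h))
    · exact .inr (.inr (hbeq _ (l _ hw₂ hlw₂) _ (l _ hw₃ hlw₃) (i _ hw₂ hlw₂) (i _ hw₃ hlw₃) h))

/-- The matched pair `w`, `N v w` of unseen vertices is appended to the outer vertex `v`. -/
theorem grow (I : SearchState V adj M r lab b N) (hsymm : ∀ x y, adj x y → adj y x)
    {v w x : ℕ} {lab' b' : ℕ → ℕ} {N' : ℕ → ℕ → ℕ} (hv : v < V)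
    (hlv : lab v = 2) (hw : w < V) (hlw : lab w = 0) (hadj : adj v w) (hx : x = N v w)
    (hxw : x ≠ w) (hlab' : ∀ y < V, lab' y = if y = w then 1 else if y = x then 2 else lab y)
    (hb' : ∀ y < V, b' y = if y = x then x else b y)
    (hold : ∀ u < V, lab u = 2 → ∀ y < V, N' u y = N u y)
    (hnew : ∀ y < V, N' x y = if y = x then x else if y = v then w else if y = w then v
      else N v y) :
    SearchState V adj M r lab' b' N' := by
  have m := I.matching v hv hlv
  have hxV : x < V := hx ▸ m.lt w hw
  have hlx : lab x = 0 := hx ▸ (I.unseen v hv hlv w hw hlw).2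
  have hNx : N v x = w := by rw [hx, m.invol w hw]
  have hNw : N v w = x := hx.symm
  have hNv : N v v = v := I.self v hv hlv
  have hvw : v ≠ w := by rintro rfl; omega
  have hvx : v ≠ x := by rintro rfl; omega
  -- The row `N v` exposes `v` and contains the pair `w`, `x`. The other vertices are mapped among
  -- themselves, so replacing that pair by `v`, `w` and exposing `x` gives a matching again.
  have hNne : ∀ y < V, y ≠ x → y ≠ v → y ≠ w → N v y ≠ x ∧ N v y ≠ v ∧ N v y ≠ w := by
    intro y hy h₁ h₂ h₃
    have := m.invol y hy
    refine ⟨fun h => ?_, fun h => ?_, fun h => ?_⟩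
    · rw [h, hNx] at this; exact h₃ this.symm
    · rw [h, hNv] at this; exact h₂ this.symm
    · rw [h, hNw] at this; exact h₁ this.symm
  have hlab2 : ∀ u < V, lab u = 2 → lab' u = 2 := by
    intro u hu h
    rw [hlab' u hu, if_neg (by rintro rfl; omega)]
    split_ifs <;> omega
  have hlab'2 : ∀ u < V, lab' u = 2 → lab u = 2 ∨ u = x := by
    intro u hu h
    rw [hlab' u hu] at h
    split_ifs at h with h₁ h₂
    · omega
    · exact .inr h₂
    · exact .inl h
  have hlab'1 : ∀ u < V, lab' u = 1 → lab u = 1 ∨ u = w := by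
    intro u hu h
    rw [hlab' u hu] at h
    split_ifs at h with h₁ h₂
    · exact .inr h₁
    · omega
    · exact .inl h
  have hlab1 : ∀ u < V, lab u = 1 → lab' u = 1 := by
    intro u hu h
    rw [hlab' u hu, if_neg (by rintro rfl; omega), if_neg (by rintro rfl; omega), h]
  have hlab'0 : ∀ u < V, lab' u = 0 → lab u = 0 ∧ u ≠ w ∧ u ≠ x := by
    intro u hu h
    rw [hlab' u hu] at h
    split_ifs at h with h₁ h₂
    · exact ⟨h, h₁, h₂⟩
  have hlabx : lab' x = 2 := by rw [hlab' x hxV, if_neg hxw, if_pos rfl]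
  have hlabw : lab' w = 1 := by rw [hlab' w hw, if_pos rfl]
  have hb2 : ∀ u < V, lab u = 2 → b' u = b u := by
    intro u hu h
    rw [hb' u hu, if_neg (by rintro rfl; omega)]
  have hbx : b' x = x := by rw [hb' x hxV, if_pos rfl]
  have hbne : ∀ u < V, lab u = 2 → b u ≠ x := by
    intro u hu h h'
    have := (I.name u hu h).2
    rw [h'] at this; omega
  have hmx : IsMatching V adj (N' x) := by
    refine ⟨fun y hy => ?_, fun y hy => ?_, fun y hy => ?_⟩
    · rw [hnew y hy]; split_ifs
      exacts [hxV, hw, hv, m.lt y hy]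
    · rw [hnew y hy]
      split_ifs with h₁ h₂ h₃
      · rw [hnew x hxV, if_pos rfl, h₁]
      · rw [hnew w hw, if_neg hxw.symm, if_neg hvw.symm, if_pos rfl, h₂]
      · rw [hnew v hv, if_neg hvx, if_pos rfl, h₃]
      · obtain ⟨k₁, k₂, k₃⟩ := hNne y hy h₁ h₂ h₃
        rw [hnew _ (m.lt y hy), if_neg k₁, if_neg k₂, if_neg k₃, m.invol y hy]
    · rw [hnew y hy]
      split_ifs with h₁ h₂ h₃
      · exact fun h => absurd h₁.symm h
      · subst h₂; exact fun _ => hadj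
      · subst h₃; exact fun _ => hsymm _ _ hadj
      · exact m.adj y hy
  have hmatch : ∀ u < V, lab' u = 2 → IsMatching V adj (N' u) := by
    intro u hu h
    rcases hlab'2 u hu h with h | rfl
    · have m := I.matching u hu h
      refine ⟨fun x hx => by rw [hold u hu h x hx]; exact m.lt x hx, fun x hx => ?_,
        fun x hx => ?_⟩
      · rw [hold u hu h x hx, hold u hu h _ (m.lt x hx), m.invol x hx]
      · rw [hold u hu h x hx]; exact m.adj x hx
    · exact hmx
  have hMx : M w = x ∧ M x = w := by
    refine ⟨(I.unseen v hv hlv w hw hlw).1 ▸ hx.symm, ?_⟩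
    rw [← (I.unseen v hv hlv x hxV hlx).1, hNx]
  have hNold : ∀ u < V, lab u = 2 → N u w = x ∧ N u x = w := fun u hu h =>
    ⟨by rw [(I.unseen u hu h w hw hlw).1, hMx.1], by rw [(I.unseen u hu h x hxV hlx).1, hMx.2]⟩
  refine ⟨I.root_lt, hlab2 r I.root_lt I.root, ?_, hmatch, ?_, ?_, ?_, ?_, ?_, ?_, ?_⟩
  · intro y hy
    rw [hlab' y hy]
    split_ifs
    · omega
    · omega
    · exact I.lab_le y hy
  · intro u hu h
    rcases hlab'2 u hu h with h | rfl
    · rw [hold u hu h u hu, I.self u hu h]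
    · rw [hnew u hu, if_pos rfl]
  · intro u hu h y hy hfix
    rcases hlab'2 u hu h with h | rfl
    · rw [hold u hu h y hy] at hfix
      rcases I.exposed u hu h y hy hfix with h' | ⟨h', h''⟩
      · exact .inl h'
      · refine .inr ⟨?_, h''⟩
        rw [hlab' y hy, if_neg, if_neg, h']
        · rintro rfl; exact hxw (hMx.2.symm.trans h'').symm
        · rintro rfl; exact hxw (hMx.1.symm.trans h'')
    · rw [hnew y hy] at hfix
      split_ifs at hfix with h₁ h₂ h₃
      · exact .inl h₁
      · exact absurd (h₂.symm.trans hfix.symm) hvw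
      · exact absurd (hfix.trans h₃) hvw
      · right
        rcases I.exposed v hv hlv y hy hfix with h' | ⟨h', h''⟩
        · exact absurd h' h₂
        · exact ⟨by rw [hlab' y hy, if_neg h₃, if_neg h₁, h'], h''⟩
  · intro u hu h y hy hly
    obtain ⟨h₀, hyw, hyx⟩ := hlab'0 y hy hly
    have hgen : ∀ u < V, lab u = 2 → N u y = M y ∧ lab' (N u y) = 0 := by
      intro u hu h
      have h₁ := I.unseen u hu h y hy h₀
      have m := I.matching u hu h
      refine ⟨h₁.1, ?_⟩
      rw [hlab' _ (m.lt y hy), if_neg, if_neg, h₁.2]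
      · intro h'
        have := m.invol y hy
        rw [h', (hNold u hu h).2] at this
        exact hyw this.symm
      · intro h'
        have := m.invol y hy
        rw [h', (hNold u hu h).1] at this
        exact hyx this.symm
    rcases hlab'2 u hu h with h | rfl
    · rw [hold u hu h y hy]
      exact hgen u hu h
    · rw [hnew y hy, if_neg hyx, if_neg (by rintro rfl; omega), if_neg hyw]
      exact hgen v hv hlv
  · intro u hu h a ha hla
    rcases hlab'2 u hu h with h | rfl
    · rw [hold u hu h a ha]
      rcases hlab'1 a ha hla with h' | rfl
      · exact hlab2 _ ((I.matching u hu h).lt a ha) (I.inner u hu h a ha h')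
      · rw [(hNold u hu h).1]; exact hlabx
    · rcases hlab'1 a ha hla with h' | rfl
      · rw [hnew a ha, if_neg (by rintro rfl; omega), if_neg (by rintro rfl; omega),
          if_neg (by rintro rfl; omega)]
        exact hlab2 _ (m.lt a ha) (I.inner v hv hlv a ha h')
      · rw [hnew a ha, if_neg hxw.symm, if_neg hvw.symm, if_pos rfl]
        exact hlab2 v hv hlv
  · intro c hc h
    rcases hlab'2 c hc h with h | rfl
    · rw [hb2 c hc h]
      have := I.name c hc h
      exact ⟨this.1, hlab2 _ this.1 this.2⟩
    · rw [hbx]; exact ⟨hc, h⟩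
  · intro u hu h c hc hlc
    rcases hlab'2 c hc hlc with hc2 | rfl
    · -- an old blossom
      have hcls : ∀ z < V, lab' z = 2 → b' z = b' c → lab z = 2 ∧ b z = b c := by
        intro z hz hlz hbz
        rw [hb2 c hc hc2] at hbz
        rcases hlab'2 z hz hlz with h' | rfl
        · rw [hb2 z hz h'] at hbz; exact ⟨h', hbz⟩
        · rw [hbx] at hbz; exact absurd hbz.symm (hbne c hc hc2)
      rcases hlab'2 u hu h with h | rfl
      · obtain ⟨y, hy, hly, hby, hport, hrest⟩ := I.port u hu h c hc hc2
        refine ⟨y, hy, hlab2 y hy hly, by rw [hb2 y hy hly, hb2 c hc hc2, hby], ?_, ?_⟩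
        · rw [hold u hu h y hy]
          exact hport.imp id fun h' => hlab1 _ ((I.matching u hu h).lt y hy) h'
        · intro z hz hlz hbz hzy
          obtain ⟨k₁, k₂⟩ := hcls z hz hlz hbz
          have := hrest z hz k₁ k₂ hzy
          rw [hold u hu h z hz, hb2 c hc hc2,
            hb2 _ ((I.matching u hu h).lt z hz) this.2.1]
          exact ⟨this.1, hlab2 _ ((I.matching u hu h).lt z hz) this.2.1, this.2.2⟩
      · obtain ⟨y, hy, hly, hby, hport, hrest⟩ := I.port v hv hlv c hc hc2
        refine ⟨y, hy, hlab2 y hy hly, by rw [hb2 y hy hly, hb2 c hc hc2, hby], .inr ?_, ?_⟩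
        · rw [hnew y hy, if_neg (by rintro rfl; omega)]
          split_ifs with h₁ h₂
          · exact hlabw
          · subst h₂; omega
          · exact hlab1 _ (m.lt y hy) (hport.resolve_left h₁)
        · intro z hz hlz hbz hzy
          obtain ⟨k₁, k₂⟩ := hcls z hz hlz hbz
          have := hrest z hz k₁ k₂ hzy
          rw [hnew z hz, if_neg (by rintro rfl; omega), if_neg this.1,
            if_neg (by rintro rfl; omega), hb2 c hc hc2, hb2 _ (m.lt z hz) this.2.1]
          exact ⟨by rintro rfl; omega, hlab2 _ (m.lt z hz) this.2.1, this.2.2⟩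
    · -- the new blossom
      refine ⟨c, hc, hlc, rfl, ?_, ?_⟩
      · rcases hlab'2 u hu h with h | rfl
        · right
          rw [hold u hu h c hc, (hNold u hu h).2, hlabw]
        · exact .inl rfl
      · intro z hz hlz hbz hzc
        rcases hlab'2 z hz hlz with h' | h'
        · rw [hb2 z hz h', hbx] at hbz
          exact absurd hbz (hbne z hz h')
        · exact absurd h' hzc
  · intro a ha hla
    rcases hlab'1 a ha hla with h' | rfl
    · have hrow : ∀ u < V, lab' u = 2 → ∃ u₀ < V, lab u₀ = 2 ∧ b' (N' u a) = b (N u₀ a) := by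
        intro u hu h
        rcases hlab'2 u hu h with h | rfl
        · refine ⟨u, hu, h, ?_⟩
          rw [hold u hu h a ha, hb2 _ ((I.matching u hu h).lt a ha) (I.inner u hu h a ha h')]
        · refine ⟨v, hv, hlv, ?_⟩
          rw [hnew a ha, if_neg (by rintro rfl; omega), if_neg (by rintro rfl; omega),
            if_neg (by rintro rfl; omega), hb2 _ (m.lt a ha) (I.inner v hv hlv a ha h')]
      intro u₁ hu₁ hl₁ u₂ hu₂ hl₂ u₃ hu₃ hl₃
      obtain ⟨w₁, hw₁, hlw₁, e₁⟩ := hrow u₁ hu₁ hl₁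
      obtain ⟨w₂, hw₂, hlw₂, e₂⟩ := hrow u₂ hu₂ hl₂
      obtain ⟨w₃, hw₃, hlw₃, e₃⟩ := hrow u₃ hu₃ hl₃
      rw [e₁, e₂, e₃]
      exact I.two a ha h' w₁ hw₁ hlw₁ w₂ hw₂ hlw₂ w₃ hw₃ hlw₃
    -- The new inner vertex is matched to `x` in every old row and to `v` in the new one; this gives
    -- the two blossoms of `two`.
    · have hrow : ∀ u < V, lab' u = 2 → N' u a = x ∨ N' u a = v := by
        intro u hu h
        rcases hlab'2 u hu h with h | rfl
        · left; rw [hold u hu h a ha, (hNold u hu h).1]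
        · right; rw [hnew a ha, if_neg hxw.symm, if_neg hvw.symm, if_pos rfl]
      intro u₁ hu₁ hl₁ u₂ hu₂ hl₂ u₃ hu₃ hl₃
      rcases hrow u₁ hu₁ hl₁ with e₁ | e₁ <;> rcases hrow u₂ hu₂ hl₂ with e₂ | e₂ <;>
        rcases hrow u₃ hu₃ hl₃ with e₃ | e₃ <;> rw [e₁, e₂, e₃] <;> simp

/-- An edge from an outer vertex `v` to an unseen exposed vertex `w` yields a larger matching. -/
theorem augment (I : SearchState V adj M r lab b N) (hsymm : ∀ x y, adj x y → adj y x)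
    {v w : ℕ} {M' : ℕ → ℕ} (hv : v < V) (hlv : lab v = 2) (hw : w < V) (hlw : lab w = 0)
    (hadj : adj v w) (hwx : N v w = w)
    (hM' : ∀ x < V, M' x = if x = v then w else if x = w then v else N v x) :
    IsMatching V adj M' ∧ M' r ≠ r ∧ ∀ x < V, M x ≠ x → M' x ≠ x := by
  have m := I.matching v hv hlv
  have hNv := I.self v hv hlv
  have hvw : v ≠ w := by rintro rfl; omega
  -- Among the seen vertices only `v` is exposed by `N v`, and `M'` matches it. What stays exposed
  -- is unseen and was exposed by `M` already.
  have hfix : ∀ x < V, M' x = x → lab x = 0 ∧ M x = x := by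
    intro x hx h
    rw [hM' x hx] at h
    split_ifs at h with h₁ h₂
    · exact absurd (h₁.symm.trans h.symm) hvw
    · exact absurd (h.trans h₂) hvw
    · exact (I.exposed v hv hlv x hx h).resolve_left h₁
  refine ⟨⟨fun x hx => ?_, fun x hx => ?_, fun x hx => ?_⟩, fun h => ?_, fun x hx h h' => ?_⟩
  · rw [hM' x hx]; split_ifs
    exacts [hw, hv, m.lt x hx]
  · rw [hM' x hx]
    split_ifs with h₁ h₂
    · rw [hM' w hw, if_neg hvw.symm, if_pos rfl, h₁]
    · rw [hM' v hv, if_pos rfl, h₂]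
    · have := m.invol x hx
      rw [hM' _ (m.lt x hx), if_neg, if_neg, this]
      · intro h; rw [h, hwx] at this; exact h₂ this.symm
      · intro h; rw [h, hNv] at this; exact h₁ this.symm
  · rw [hM' x hx]
    split_ifs with h₁ h₂
    · subst h₁; exact fun _ => hadj
    · subst h₂; exact fun _ => hsymm _ _ hadj
    · exact m.adj x hx
  · have := (hfix r I.root_lt h).1
    have := I.root
    omega
  · exact h (hfix x hx h').2

/-! ### Parity and the absence of perfect matchings. -/

theorem even_card_of_involution {T : Finset ℕ} {f : ℕ → ℕ} (hf : ∀ x ∈ T, f x ∈ T)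
    (hinv : ∀ x ∈ T, f (f x) = x) (hne : ∀ x ∈ T, f x ≠ x) : Even T.card := by
  have : ((T.card : ℕ) : ZMod 2) = 0 := by
    have := Finset.sum_involution (s := T) (f := fun _ => (1 : ZMod 2)) (fun x _ => f x)
      (fun x hx => by decide) (fun x hx _ => hne x hx) hf hinv
    simpa using this
  exact (ZMod.natCast_eq_zero_iff_even).mp this

/-- If no edge leads from an outer vertex to an unseen vertex or to another blossom, then the graph
has no perfect matching. -/
theorem not_perfect (I : SearchState V adj M r lab b N)
    (hclosed : ∀ v < V, lab v = 2 → ∀ w < V, adj v w → lab w = 1 ∨ (lab w = 2 ∧ b w = b v))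
    {M' : ℕ → ℕ} (hM' : IsMatching V adj M') (hne : ∀ x < V, M' x ≠ x) : False := by
  classical
  have mr := I.matching r I.root_lt I.root
  -- For the set of all seen vertices: one more blossom than inner vertices.
  have hcard := I.card_blossoms (S := fun x => lab x ≠ 0) I.root_lt I.root
    (by have := I.root; simp only [ne_eq]; omega) (fun x _ y _ _ h _ _ => by omega) (by
      intro x hx h h'
      have := (I.unseen r I.root_lt I.root _ (mr.lt x hx) h').2
      rw [mr.invol x hx] at this
      exact h this)
  -- A blossom has odd size, since for `u` in it the row `N u` pairs off all its other vertices
  -- inside it. As no edge leads to an unseen vertex or another blossom, `M'` has to match some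
  -- vertex of the blossom to an inner vertex.
  have hex : ∀ c ∈ ((Finset.range V).filter fun x => lab x ≠ 0 ∧ lab x = 2).image b,
      ∃ y < V, lab y = 2 ∧ b y = c ∧ lab (M' y) = 1 := by
    intro c hc
    obtain ⟨u, hu, rfl⟩ := Finset.mem_image.mp hc
    simp only [Finset.mem_filter, Finset.mem_range] at hu
    obtain ⟨hu, -, hlu⟩ := hu
    by_contra hcon
    push Not at hcon
    set T := (Finset.range V).filter fun x => lab x = 2 ∧ b x = b u with hT
    have hmT : ∀ x, x ∈ T ↔ x < V ∧ lab x = 2 ∧ b x = b u := by simp [hT]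
    have huT : u ∈ T := by simp [hmT, hu, hlu]
    have h₁ : Even T.card := by
      refine even_card_of_involution (f := M') (fun x hx => ?_)
        (fun x hx => hM'.invol x ((hmT x).mp hx).1) (fun x hx => hne x ((hmT x).mp hx).1)
      obtain ⟨hxV, hlx, hbx⟩ := (hmT x).mp hx
      have h₂ := hclosed x hxV hlx _ (hM'.lt x hxV) (hM'.adj x hxV (hne x hxV))
      have h₃ := h₂.resolve_left (hcon x hxV hlx hbx)
      exact (hmT _).mpr ⟨hM'.lt x hxV, h₃.1, h₃.2.trans hbx⟩
    have m := I.matching u hu hlu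
    have hport : ∀ x ∈ T.erase u, N u x ∈ T.erase u := by
      intro x hx
      obtain ⟨hxu, hx⟩ := Finset.mem_erase.mp hx
      obtain ⟨hxV, hlx, hbx⟩ := (hmT x).mp hx
      obtain ⟨y, hy, hly, hby, hyu, hrest⟩ := I.port u hu hlu u hu hlu
      have hyu' : u = y := I.port_unique hu hlu hu hlu hy hly hby.symm (.inl rfl) hyu
      have := hrest x hxV hlx hbx (hyu' ▸ hxu)
      refine Finset.mem_erase.mpr ⟨fun h => hxu ?_, (hmT _).mpr ⟨m.lt x hxV, this.2⟩⟩
      rw [← m.invol x hxV, h, I.self u hu hlu]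
    have h₂ : Even (T.erase u).card := by
      refine even_card_of_involution (f := N u) hport (fun x hx => ?_) (fun x hx h => ?_)
      · exact m.invol x ((hmT x).mp (Finset.mem_of_mem_erase hx)).1
      · obtain ⟨hxu, hx⟩ := Finset.mem_erase.mp hx
        obtain ⟨hxV, hlx, hbx⟩ := (hmT x).mp hx
        rcases I.exposed u hu hlu x hxV h with h | h
        · exact hxu h
        · omega
    rw [← Finset.card_erase_add_one huT] at h₁
    exact (Nat.even_add_one.mp h₁) h₂
  choose! y hy hly hby hlMy using hex
  -- Different blossoms use different inner vertices in `M'`, of which there are too few.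
  have := Finset.card_le_card_of_injOn (s := ((Finset.range V).filter
      fun x => lab x ≠ 0 ∧ lab x = 2).image b)
    (t := (Finset.range V).filter fun x => lab x ≠ 0 ∧ lab x = 1) (fun c => M' (y c))
    (fun c hc => by
      have h₁ := hlMy c hc
      have h₂ := hM'.lt _ (hy c hc)
      simp only [Finset.coe_filter, Finset.mem_range, Set.mem_ofPred_eq]
      omega)
    (fun c hc c' hc' h => by
      simp only at h
      have : y c = y c' := by
        rw [← hM'.invol _ (hy c hc), h, hM'.invol _ (hy c' hc')]
      rw [← hby c hc, this, hby c' hc'])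
  omega

/-! #### Finding a blossom -/

/-- An intermediate state of the walk from the blossom of `v` to the blossom of `w`: `S` consists of
the blossoms and inner vertices passed so far. -/
structure Walk (V : ℕ) (adj : ℕ → ℕ → Prop) (M : ℕ → ℕ) (lab b : ℕ → ℕ) (N : ℕ → ℕ → ℕ) (v w : ℕ)
    (S : ℕ → Prop) (N' : ℕ → ℕ → ℕ) : Prop where
  start : S v
  seen : ∀ x, S x → x < V ∧ lab x ≠ 0
  blossom : ∀ x < V, ∀ y < V, lab x = 2 → lab y = 2 → b x = b y → S x → S y
  map : ∀ x < V, S x → S (N v x)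
  two : ∀ a < V, S a → lab a = 1 → b (N v a) ≠ b (N w a)
  old : ∀ u < V, lab u = 2 → ∀ x < V, N' u x = N u x
  new : ∀ a < V, S a → lab a = 1 → IsMatching V adj (N' a) ∧ N' a a = a ∧
    (∀ x < V, N' a x = x → x = a ∨ (lab x = 0 ∧ M x = x)) ∧ N' a v = w ∧ N' a w = v ∧
    ∀ x < V, (S x ∧ N' a x = N v x) ∨ N' a x = N w x ∨ x = v ∨ x = w ∨ x = a

/-- The walk is to be continued from the blossom `c`. -/
def WalkOpen (V : ℕ) (lab b : ℕ → ℕ) (N : ℕ → ℕ → ℕ) (w : ℕ) (S : ℕ → Prop) (c : ℕ) : Prop :=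
  ¬ S w ∧ ∃ y < V, S y ∧ lab y = 2 ∧ b y = c ∧ lab (N w y) = 1 ∧ ¬ S (N w y) ∧
    ∀ x < V, S x → x ≠ y → S (N w x)

/-- The walk has arrived. -/
def WalkDone (V : ℕ) (N : ℕ → ℕ → ℕ) (w : ℕ) (S : ℕ → Prop) : Prop :=
  S w ∧ ∀ x < V, S x → S (N w x)

/-- The walk begins with the blossom of `v` alone. `N v` maps it to itself, and under `N w` only its
port leaves it, towards an inner vertex, because `w` lies elsewhere. -/
theorem walk_start (I : SearchState V adj M r lab b N) {v w : ℕ} (hv : v < V)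
    (hlv : lab v = 2) (hw : w < V) (hlw : lab w = 2) (hvw : b v ≠ b w)
    {S : ℕ → Prop} {N' : ℕ → ℕ → ℕ}
    (hS : ∀ x, S x ↔ x < V ∧ lab x = 2 ∧ b x = b v)
    (hN' : ∀ u < V, lab u = 2 → ∀ x < V, N' u x = N u x) :
    Walk V adj M lab b N v w S N' ∧ WalkOpen V lab b N w S (b v) := by
  have m := I.matching v hv hlv
  refine ⟨⟨(hS v).mpr ⟨hv, hlv, rfl⟩, fun x hx => ?_, fun x hx y hy hlx hly hb h => ?_,
    fun x hx h => ?_, fun a ha h hl => ?_, hN', fun a ha h hl => ?_⟩, fun h => ?_, ?_⟩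
  · have := (hS x).mp hx
    exact ⟨this.1, by omega⟩
  · rw [hS] at h ⊢
    exact ⟨hy, hly, by rw [← hb, h.2.2]⟩
  · obtain ⟨-, hlx, hbx⟩ := (hS x).mp h
    by_cases hxv : x = v
    · rw [hxv, I.self v hv hlv, ← hxv]; exact h
    · obtain ⟨y, hy, hly, hby, hyu, hrest⟩ := I.port v hv hlv v hv hlv
      have hyu' : v = y := I.port_unique hv hlv hv hlv hy hly hby.symm (.inl rfl) hyu
      exact (hS _).mpr ⟨m.lt x hx, (hrest x hx hlx hbx (hyu' ▸ hxv)).2⟩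
  · have := (hS a).mp h; omega
  · have := (hS a).mp h; omega
  · exact hvw ((hS w).mp h).2.2.symm
  · obtain ⟨y, hy, hly, hby, hyu, hrest⟩ := I.port w hw hlw v hv hlv
    have hl1 : lab (N w y) = 1 := hyu.resolve_left (by rintro rfl; exact hvw hby.symm)
    refine ⟨y, hy, (hS y).mpr ⟨hy, hly, hby⟩, hly, hby, hl1, fun h => ?_, fun x hx h hxy => ?_⟩
    · have := (hS _).mp h; omega
    · obtain ⟨-, hlx, hbx⟩ := (hS x).mp h
      exact (hS _).mpr ⟨(I.matching w hw hlw).lt x hx, (hrest x hx hlx hbx hxy).2⟩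

/-- The walk follows the symmetric difference of `N v` and `N w` from blossom to blossom: it leaves
the current one through its port `y` under `N w`, passes the inner vertex `a`, and enters the
blossom of `N v a`. The new row exposes `a`, contains the edge from `v` to `w`, and otherwise copies
`N v` on the part `S` passed so far and `N w` elsewhere. The pieces fit, since `N v` maps `S` to
itself and `a`, `y` is the only pair of `N w` that crosses the boundary of `S`. -/
theorem walk_step (I : SearchState V adj M r lab b N) {v w : ℕ} (hv : v < V)
    (hlv : lab v = 2) (hw : w < V) (hlw : lab w = 2) (hvw : b v ≠ b w)
    (hsymm : ∀ x y, adj x y → adj y x) (hadj : adj v w) {S S' : ℕ → Prop}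
    [DecidablePred S] {N' N'' : ℕ → ℕ → ℕ} {c y a : ℕ}
    (W : Walk V adj M lab b N v w S N') (O : WalkOpen V lab b N w S c) (hy : y < V)
    (hly : lab y = 2) (hby : b y = c) (hNy : lab (N w y) = 1) (hya : a = N w y)
    (hS' : ∀ x, S' x ↔ S x ∨ x = a ∨ (x < V ∧ lab x = 2 ∧ b x = b (N v a)))
    (hN₁ : ∀ u < V, u ≠ a → ∀ x < V, N'' u x = N' u x)
    (hN₂ : ∀ x < V, N'' a x = if x = a then a else if x = v then w else if x = w then v
      else if S x then N v x else N w x) :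
    Walk V adj M lab b N v w S' N'' ∧ ((b (N v a) ≠ b w ∧ WalkOpen V lab b N w S' (b (N v a))) ∨
      (b (N v a) = b w ∧ WalkDone V N w S')) := by
  obtain ⟨hSw, y', hy', hSy', hly', hby', hNy', hSNy', hmapw⟩ := O
  obtain rfl : y = y' := I.port_unique hw hlw hy hly hy' hly' (by rw [hby, hby']) (.inr hNy)
    (.inr hNy')
  have mv := I.matching v hv hlv
  have mw := I.matching w hw hlw
  have ha : a < V := hya ▸ mw.lt y hy
  have hla : lab a = 1 := hya ▸ hNy
  have hSa : ¬ S a := hya ▸ hSNy'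
  have hNwa : N w a = y := by rw [hya, mw.invol y hy]
  have hNww := I.self w hw hlw
  have hNvv := I.self v hv hlv
  have hav : a ≠ v := by rintro rfl; omega
  have haw : a ≠ w := by rintro rfl; omega
  have hwv : w ≠ v := by rintro rfl; exact hSw W.start
  have hNva : N v a < V := mv.lt a ha
  have hlNva : lab (N v a) = 2 := I.inner v hv hlv a ha hla
  have hSNva : ¬ S (N v a) := by
    intro h
    have := W.map _ hNva h
    rw [mv.invol a ha] at this
    exact hSa this
  have hnotS : ∀ x < V, ¬ S x → x ≠ a → ¬ S (N w x) := by
    intro x hx hSx hxa h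
    by_cases hxy : N w x = y
    · apply hxa
      rw [hya, ← hxy, mw.invol x hx]
    · have := hmapw _ (mw.lt x hx) h hxy
      rw [mw.invol x hx] at this
      exact hSx this
  have hclsS : ∀ x < V, lab x = 2 → b x = b (N v a) → ¬ S x := fun x hx hlx hbx hSx =>
    hSNva (W.blossom x hx _ hNva hlx hlNva hbx hSx)
  have hsub : ∀ x, S x → S' x := fun x h => (hS' x).mpr (.inl h)
  have hS'a : S' a := (hS' a).mpr (.inr (.inl rfl))
  -- The two blossoms adjacent to `a` differ because only that of `y` lies in `S`; after the merge
  -- this allows `two` to be used as in `shrink`.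
  have hbya : b (N v a) ≠ b y := fun h => hclsS y hy hly h.symm hSy'
  have hmapv : ∀ x < V, S' x → S' (N v x) := by
    intro x hx h
    rcases (hS' x).mp h with h | rfl | ⟨-, hlx, hbx⟩
    · exact hsub _ (W.map x hx h)
    · exact (hS' _).mpr (.inr (.inr ⟨hNva, hlNva, rfl⟩))
    · by_cases hxa : x = N v a
      · rw [hxa, mv.invol a ha]; exact hS'a
      · obtain ⟨z, hz, hlz, hbz, hport, hrest⟩ := I.port v hv hlv x hx hlx
        have hz' : N v a = z := I.port_unique hv hlv hNva hlNva hz hlz (by rw [hbz, hbx])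
          (.inr (by rw [mv.invol a ha]; exact hla)) hport
        have := hrest x hx hlx rfl (hz' ▸ hxa)
        exact (hS' _).mpr (.inr (.inr ⟨mv.lt x hx, this.2.1, by rw [this.2.2, hbx]⟩))
  refine ⟨⟨hsub v W.start, ?_, ?_, hmapv, ?_, ?_, ?_⟩, ?_⟩
  · intro x h
    rcases (hS' x).mp h with h | rfl | ⟨hx, hlx, hbx⟩
    · exact W.seen x h
    · exact ⟨ha, by omega⟩
    · exact ⟨hx, by omega⟩
  · intro x hx z hz hlx hlz hb h
    rcases (hS' x).mp h with h | rfl | ⟨-, -, hbx⟩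
    · exact hsub z (W.blossom x hx z hz hlx hlz hb h)
    · omega
    · exact (hS' z).mpr (.inr (.inr ⟨hz, hlz, hb ▸ hbx⟩))
  · intro x hx h hlx
    rcases (hS' x).mp h with h | rfl | ⟨-, hlx', -⟩
    · exact W.two x hx h hlx
    · rw [hNwa]; exact hbya
    · omega
  · intro u hu hlu x hx
    rw [hN₁ u hu (by rintro rfl; omega) x hx, W.old u hu hlu x hx]
  · intro x hx h hlx
    by_cases hxa : x = a
    · subst hxa
      have hcase : ∀ z < V, z ≠ x → z ≠ v → z ≠ w → S z →
          N v z ≠ x ∧ N v z ≠ v ∧ N v z ≠ w ∧ S (N v z) := by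
        intro z hz h₁ h₂ h₃ hSz
        have hSN := W.map z hz hSz
        refine ⟨fun h => hSa (h ▸ hSN), fun h => h₂ ?_, fun h => hSw (h ▸ hSN), hSN⟩
        rw [← mv.invol z hz, h, hNvv]
      have hcase' : ∀ z < V, z ≠ x → z ≠ v → z ≠ w → ¬ S z →
          N w z ≠ x ∧ N w z ≠ v ∧ N w z ≠ w ∧ ¬ S (N w z) := by
        intro z hz h₁ h₂ h₃ hSz
        have hSN := hnotS z hz hSz h₁
        refine ⟨fun h => hSz ?_, fun h => hSN (h ▸ W.start), fun h => h₃ ?_, hSN⟩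
        · rw [← mw.invol z hz, h, hNwa]; exact hSy'
        · rw [← mw.invol z hz, h, hNww]
      refine ⟨⟨fun z hz => ?_, fun z hz => ?_, fun z hz => ?_⟩, by rw [hN₂ x hx, if_pos rfl],
        fun z hz hfix => ?_, by rw [hN₂ v hv, if_neg hav.symm, if_pos rfl],
        by rw [hN₂ w hw, if_neg haw.symm, if_neg hwv, if_pos rfl], fun z hz => ?_⟩
      · rw [hN₂ z hz]; split_ifs
        exacts [ha, hw, hv, mv.lt z hz, mw.lt z hz]
      · rw [hN₂ z hz]
        split_ifs with h₁ h₂ h₃ h₄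
        · rw [hN₂ x hx, if_pos rfl, h₁]
        · rw [hN₂ w hw, if_neg haw.symm, if_neg hwv, if_pos rfl, h₂]
        · rw [hN₂ v hv, if_neg hav.symm, if_pos rfl, h₃]
        · obtain ⟨k₁, k₂, k₃, k₄⟩ := hcase z hz h₁ h₂ h₃ h₄
          rw [hN₂ _ (mv.lt z hz), if_neg k₁, if_neg k₂, if_neg k₃, if_pos k₄, mv.invol z hz]
        · obtain ⟨k₁, k₂, k₃, k₄⟩ := hcase' z hz h₁ h₂ h₃ h₄
          rw [hN₂ _ (mw.lt z hz), if_neg k₁, if_neg k₂, if_neg k₃, if_neg k₄, mw.invol z hz]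
      · rw [hN₂ z hz]
        split_ifs with h₁ h₂ h₃ h₄
        · exact fun h => absurd h₁.symm h
        · subst h₂; exact fun _ => hadj
        · subst h₃; exact fun _ => hsymm _ _ hadj
        · exact mv.adj z hz
        · exact mw.adj z hz
      · rw [hN₂ z hz] at hfix
        split_ifs at hfix with h₁ h₂ h₃ h₄
        · exact .inl h₁
        · exact absurd (hfix.trans h₂) hwv
        · exact absurd (h₃.symm.trans hfix.symm) hwv
        · rcases I.exposed v hv hlv z hz hfix with h | h
          · exact absurd h h₂
          · exact absurd h.1 (W.seen z h₄).2
        · exact .inr ((I.exposed w hw hlw z hz hfix).resolve_left h₃)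
      · rw [hN₂ z hz]
        split_ifs with h₁ h₂ h₃ h₄
        · simp [h₁]
        · simp [h₂]
        · simp [h₃]
        · exact .inl ⟨hsub z h₄, rfl⟩
        · exact .inr (.inl rfl)
    · have hSx : S x := by
        rcases (hS' x).mp h with h | h | ⟨-, hlx', -⟩
        · exact h
        · exact absurd h hxa
        · omega
      obtain ⟨k₁, k₂, k₃, k₄, k₅, k₆⟩ := W.new x hx hSx hlx
      have e := hN₁ x hx hxa
      refine ⟨⟨fun z hz => by rw [e z hz]; exact k₁.lt z hz, fun z hz => ?_,
        fun z hz => by rw [e z hz]; exact k₁.adj z hz⟩, by rw [e x hx, k₂],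
        fun z hz => by rw [e z hz]; exact k₃ z hz, by rw [e v hv, k₄], by rw [e w hw, k₅],
        fun z hz => ?_⟩
      · rw [e z hz, e _ (k₁.lt z hz), k₁.invol z hz]
      · rw [e z hz]
        exact (k₆ z hz).imp (fun h => ⟨hsub z h.1, h.2⟩) id
  -- The port `z` of the blossom just entered, with respect to `N w`, decides how to proceed: in the
  -- blossom of `w` it is `w` itself and nothing leaves the set; otherwise it leads to an inner
  -- vertex not yet passed.
  · obtain ⟨z, hz, hlz, hbz, hport, hrest⟩ := I.port w hw hlw _ hNva hlNva
    have hmap' : ∀ x < V, S' x → x ≠ z → S' (N w x) := by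
      intro x hx h hxz
      rcases (hS' x).mp h with h | rfl | ⟨-, hlx, hbx⟩
      · by_cases hxy : x = y
        · rw [hxy, ← hya]; exact hS'a
        · exact hsub _ (hmapw x hx h hxy)
      · rw [hNwa]; exact hsub y hSy'
      · exact (hS' _).mpr (.inr (.inr ⟨mw.lt x hx, (hrest x hx hlx hbx hxz).2⟩))
    by_cases hbw : b (N v a) = b w
    · refine .inr ⟨hbw, (hS' w).mpr (.inr (.inr ⟨hw, hlw, hbw.symm⟩)), fun x hx h => ?_⟩
      have hzw : w = z := I.port_unique hw hlw hw hlw hz hlz (by rw [hbz, hbw]) (.inl rfl) hport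
      by_cases hxz : x = z
      · rw [hxz, ← hzw, hNww, hzw, ← hxz]; exact h
      · exact hmap' x hx h hxz
    · have hNz : lab (N w z) = 1 := hport.resolve_left (by rintro rfl; exact hbw hbz.symm)
      have hSz : ¬ S z := hclsS z hz hlz hbz
      refine .inl ⟨hbw, fun h => ?_, z, hz, (hS' z).mpr (.inr (.inr ⟨hz, hlz, hbz⟩)), hlz, hbz,
        hNz, fun h => ?_, hmap'⟩
      · rcases (hS' w).mp h with h | h | h
        · exact hSw h
        · exact haw h.symm
        · exact hbw h.2.2.symm
      · rcases (hS' _).mp h with h | h | h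
        · exact hnotS z hz hSz (by rintro rfl; omega) h
        · apply hSz
          rw [← mw.invol z hz, h, hNwa]; exact hSy'
        · omega

/-- At the end `S` is closed under both `N v` and `N w`, hence under the rows pieced together from
them. The second claim provides progress: the partner in `N v` of the port of the blossom of `w` is
an inner vertex that the merge makes outer. -/
theorem walk_shrink (I : SearchState V adj M r lab b N) {v w : ℕ} (hv : v < V)
    (hlv : lab v = 2) (hw : w < V) (hlw : lab w = 2) (hvw : b v ≠ b w)
    {S : ℕ → Prop} [DecidablePred S] {N' : ℕ → ℕ → ℕ} {lab' b' : ℕ → ℕ}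
    (W : Walk V adj M lab b N v w S N') (hdone : WalkDone V N w S)
    (hlab' : ∀ x < V, lab' x = if S x then 2 else lab x)
    (hb' : ∀ x < V, b' x = if S x then b v else b x) :
    SearchState V adj M r lab' b' N' ∧ ∃ a < V, lab a = 1 ∧ lab' a = 2 := by
  constructor
  · refine I.shrink hv hlv hw hlw W.start hdone.1 W.seen W.blossom W.map hdone.2 W.two hlab' hb'
      W.old fun a ha hSa hla => ?_
    obtain ⟨k₁, k₂, k₃, k₄, k₅, k₆⟩ := W.new a ha hSa hla
    refine ⟨k₁, k₂, k₃, fun x hx hSx => ?_, fun x hx hSx => ?_⟩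
    · rcases k₆ x hx with h | h | rfl | rfl | rfl
      · rw [h.2]; exact W.map x hx hSx
      · rw [h]; exact hdone.2 x hx hSx
      · rw [k₄]; exact hdone.1
      · rw [k₅]; exact W.start
      · rw [k₂]; exact hSx
    · rcases k₆ x hx with h | h | rfl | rfl | rfl
      · exact absurd h.1 hSx
      · exact h
      · exact absurd W.start hSx
      · exact absurd hdone.1 hSx
      · exact absurd hSa hSx
  · obtain ⟨y, hy, hly, hby, hport, -⟩ := I.port v hv hlv w hw hlw
    have hNy : lab (N v y) = 1 := hport.resolve_left (by rintro rfl; exact hvw hby)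
    have hSy : S y := W.blossom w hw y hy hlw hly hby.symm hdone.1
    have hlt := (I.matching v hv hlv).lt y hy
    exact ⟨N v y, hlt, hNy, by rw [hlab' _ hlt, if_pos (W.map y hy hSy)]⟩

end SearchState

/-! ### The matching program -/

-- Indices of natural-number arrays. They unfold to literals, so that `decide` can check which
-- arrays a program leaves alone. Arrays `0` and `1` hold the input parameters and the output.
notation "rV" => (2 : ℕ)
notation "rCnt" => (3 : ℕ)
notation "rSel" => (4 : ℕ)
notation "rRem" => (5 : ℕ)
notation "rBest" => (6 : ℕ)
notation "rCov" => (7 : ℕ)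
notation "rAdj" => (8 : ℕ)
notation "rMate" => (9 : ℕ)
notation "rFail" => (10 : ℕ)
notation "rRow" => (11 : ℕ)
notation "rLab" => (12 : ℕ)
notation "rName" => (13 : ℕ)
notation "rLeft" => (14 : ℕ)
notation "rFst" => (15 : ℕ)
notation "rSnd" => (16 : ℕ)
notation "rFound" => (17 : ℕ)
notation "rCont" => (18 : ℕ)
notation "rNew" => (19 : ℕ)
notation "rCur" => (20 : ℕ)
notation "rOld" => (21 : ℕ)
notation "rRoot" => (22 : ℕ)
notation "rI" => (23 : ℕ)
notation "rJ" => (24 : ℕ)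
notation "rHit" => (25 : ℕ)
notation "rCand" => (26 : ℕ)
notation "rT" => (27 : ℕ)
notation "rU" => (28 : ℕ)

open Program NatExp

/-- The address of the entry `(u, x)` of a matrix with `V` columns. -/
def NatExp.entry (u x : NatExp) : NatExp := .add (.mul u (.var rV)) x

/-- Cell `x` of the row of the vertex stored in `a`. -/
def NatExp.rowGet (a : ℕ) (x : NatExp) : NatExp := .get rRow (.entry (.var a) x)

/-- Store the vertex in `e` as the partner of `x` in the row of the vertex stored in `a`. -/
def Program.rowSet (a : ℕ) (x e : NatExp) : Program := .setNat rRow (.entry (.var a) x) e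

/-- Look for an edge from an outer vertex to an unseen vertex or to another blossom. -/
def findEdge : Program :=
  .seq (.setVar rFound (.const 0)) <|
  .forLoop rI (.var rV) <| .forLoop rJ (.var rV) <|
    .ite (.and (.natEq (.get rLab (.var rI)) (.const 2))
        (.and (.natLe (.const 1) (.get rAdj (.entry (.var rI) (.var rJ))))
          (.or (.natEq (.get rLab (.var rJ)) (.const 0))
            (.and (.natEq (.get rLab (.var rJ)) (.const 2))
              (.not (.natEq (.get rName (.var rI)) (.get rName (.var rJ))))))))
      (.seq (.setVar rFound (.const 1))
        (.seq (.setVar rFst (.var rI)) (.setVar rSnd (.var rJ))))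
      .skip

def growStep : Program :=
  .seq (.setNat rLab (.var rSnd) (.const 1)) <|
  .seq (.setNat rLab (.var rNew) (.const 2)) <|
  .seq (.setNat rName (.var rNew) (.var rNew)) <|
  .seq (.forLoop rJ (.var rV) (.rowSet rNew (.var rJ) (.rowGet rFst (.var rJ)))) <|
  .seq (.rowSet rNew (.var rSnd) (.var rFst)) <|
  .seq (.rowSet rNew (.var rFst) (.var rSnd))
    (.rowSet rNew (.var rNew) (.var rNew))

def augmentStep : Program :=
  .seq (.forLoop rJ (.var rV) (.setNat rMate (.var rJ) (.rowGet rFst (.var rJ)))) <|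
  .seq (.setNat rMate (.var rSnd) (.var rFst))
    (.setNat rMate (.var rFst) (.var rSnd))

/-- One step of the walk from blossom to blossom. -/
def walkStep : Program :=
  .seq (.forLoop rJ (.var rV)
    (.ite (.and (.natEq (.get rLab (.var rJ)) (.const 2))
        (.and (.natEq (.get rName (.var rJ)) (.var rCur))
          (.natEq (.get rLab (.rowGet rSnd (.var rJ))) (.const 1))))
      (.setVar rNew (.rowGet rSnd (.var rJ))) .skip)) <|
  .seq (.forLoop rJ (.var rV)
    (.ite (.natEq (.get rLeft (.var rJ)) (.const 1))
      (.rowSet rNew (.var rJ) (.rowGet rFst (.var rJ)))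
      (.rowSet rNew (.var rJ) (.rowGet rSnd (.var rJ))))) <|
  .seq (.rowSet rNew (.var rSnd) (.var rFst)) <|
  .seq (.rowSet rNew (.var rFst) (.var rSnd)) <|
  .seq (.rowSet rNew (.var rNew) (.var rNew)) <|
  .seq (.setNat rLeft (.var rNew) (.const 1)) <|
  .seq (.setVar rCur (.get rName (.rowGet rFst (.var rNew))))
    (.forLoop rJ (.var rV)
      (.ite (.and (.natEq (.get rLab (.var rJ)) (.const 2))
          (.natEq (.get rName (.var rJ)) (.var rCur)))
        (.setNat rLeft (.var rJ) (.const 1)) .skip))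

/-- `rLeft` marks the set `S` of the walk, `rCur` names the blossom reached, and `rOld` keeps the
name of the starting blossom for the merged one. -/
def shrinkStep : Program :=
  .seq (.forLoop rJ (.var rV)
    (.ite (.and (.natEq (.get rLab (.var rJ)) (.const 2))
        (.natEq (.get rName (.var rJ)) (.get rName (.var rFst))))
      (.setNat rLeft (.var rJ) (.const 1)) (.setNat rLeft (.var rJ) (.const 0)))) <|
  .seq (.setVar rOld (.get rName (.var rFst))) <|
  .seq (.setVar rCur (.var rOld)) <|
  .seq (.while (.not (.natEq (.var rCur) (.get rName (.var rSnd)))) walkStep)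
    (.forLoop rJ (.var rV)
      (.ite (.natEq (.get rLeft (.var rJ)) (.const 1))
        (.seq (.setNat rLab (.var rJ) (.const 2)) (.setNat rName (.var rJ) (.var rOld))) .skip))

def searchStep : Program :=
  .seq findEdge <|
  .ite (.natEq (.var rFound) (.const 0))
    (.seq (.setVar rFail (.const 1)) (.setVar rCont (.const 0))) <|
  .ite (.natEq (.get rLab (.var rSnd)) (.const 0))
    (.seq (.setVar rNew (.rowGet rFst (.var rSnd)))
      (.ite (.natEq (.var rNew) (.var rSnd))
        (.seq augmentStep (.setVar rCont (.const 0)))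
        growStep))
    shrinkStep

/-- Only the labels and the row and name of the root are initialised. Other rows and names may hold
remains of earlier searches, since `SearchState` constrains those of outer vertices only. -/
def search : Program :=
  .seq (.forLoop rJ (.var rV)
    (.seq (.setNat rLab (.var rJ) (.const 0))
      (.rowSet rRoot (.var rJ) (.get rMate (.var rJ))))) <|
  .seq (.setNat rLab (.var rRoot) (.const 2)) <|
  .seq (.setNat rName (.var rRoot) (.var rRoot)) <|
  .seq (.setVar rCont (.const 1))
    (.while (.natEq (.var rCont) (.const 1)) searchStep)

/-- Compute a perfect matching, or set the flag `rFail`. -/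
def perfectMatching : Program :=
  .seq (.setVar rFail (.const 0)) <|
  .seq (.forLoop rJ (.var rV) (.setNat rMate (.var rJ) (.var rJ)))
    (.forLoop rRoot (.var rV)
      (.ite (.and (.natEq (.var rFail) (.const 0))
          (.natEq (.get rMate (.var rRoot)) (.var rRoot)))
        search .skip))

/-! ### Verification of the matching program. -/

section

variable {K : Type} [Ring K] [LE K] {L : ℕ}

@[simp] theorem NatExp.eval_entry (s : Memory K) (u x : NatExp) :
    (NatExp.entry u x).eval s = u.eval s * s.nat rV 0 + x.eval s := rfl

@[simp] theorem NatExp.eval_rowGet (s : Memory K) (a : ℕ) (x : NatExp) :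
    (NatExp.rowGet a x).eval s = s.nat rRow (s.nat a 0 * s.nat rV 0 + x.eval s) := rfl

@[simp] theorem wp_rowSet {s : Memory K} {Q : Memory K → Prop} {a : ℕ} {x e : NatExp} :
    wp L (.rowSet a x e) Q s ↔
      Q (s.setNat rRow (s.nat a 0 * s.nat rV 0 + x.eval s) (e.eval s)) := wp_setNat

/-- The edge from `v` to `w` leads from an outer vertex to an unseen vertex or to another blossom. -/
def Usable (V : ℕ) (A lab b : ℕ → ℕ) (v w : ℕ) : Prop :=
  lab v = 2 ∧ A (v * V + w) ≠ 0 ∧ (lab w = 0 ∨ (lab w = 2 ∧ b v ≠ b w))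

theorem wp_findEdge {s : Memory K} {V : ℕ} (hV : s.nat rV 0 = V) (hL : V ≤ L) :
    wp L findEdge (fun s' =>
      (s'.nat rFound 0 = 0 ∧ ∀ v < V, ∀ w < V,
        ¬ Usable V (s.nat rAdj) (s.nat rLab) (s.nat rName) v w) ∨
      (s'.nat rFound 0 = 1 ∧ s'.nat rFst 0 < V ∧ s'.nat rSnd 0 < V ∧
        Usable V (s.nat rAdj) (s.nat rLab) (s.nat rName) (s'.nat rFst 0) (s'.nat rSnd 0))) s := by
  set U := Usable V (s.nat rAdj) (s.nat rLab) (s.nat rName) with hU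
  -- `G` is stable: once an edge is found, a later usable edge merely replaces it.
  set G : Memory K → Prop := fun s' => s'.nat rFound 0 = 1 ∧ s'.nat rFst 0 < V ∧
    s'.nat rSnd 0 < V ∧ U (s'.nat rFst 0) (s'.nat rSnd 0) with hG
  rw [findEdge, wp_seq, wp_setVar]
  refine wp_forLoop V (fun i s' => (s'.nat rFound 0 = 0 ∧ ∀ v < i, ∀ w < V, ¬ U v w) ∨ G s')
    hL (by decide) (fun s' hf => by simp [hf.nat rV (by decide), hV]) (by simp) ?_ ?_
  · intro i s₁ hi hf₁ hsi h₁
    refine wp_forLoop V (fun j s' => (s'.nat rFound 0 = 0 ∧ (∀ v < i, ∀ w < V, ¬ U v w) ∧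
      ∀ w < j, ¬ U i w) ∨ G s')
      hL (by decide)
      (fun s' hf => by simp [hf.nat rV (by decide), hf₁.nat rV (by decide), hV]) ?_ ?_ ?_
    · rcases h₁ with h₁ | h₁
      · left; simpa using h₁
      · right; simpa [hG] using h₁
    · intro j s₂ hj hf₂ hsj h₂
      have e₁ : s₂.nat rLab = s.nat rLab := by
        rw [hf₂.nat rLab (by decide), hf₁.nat rLab (by decide)]; simp
      have e₂ : s₂.nat rAdj = s.nat rAdj := by
        rw [hf₂.nat rAdj (by decide), hf₁.nat rAdj (by decide)]; simp
      have e₃ : s₂.nat rName = s.nat rName := by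
        rw [hf₂.nat rName (by decide), hf₁.nat rName (by decide)]; simp
      have e₄ : s₂.nat rI 0 = i := by rw [hf₂.nat rI (by decide), hsi]
      have e₅ : s₂.nat rV 0 = V := by
        rw [hf₂.nat rV (by decide), hf₁.nat rV (by decide)]; simpa using hV
      have htest : (Test.and (.natEq (.get rLab (.var rI)) (.const 2))
        (.and (.natLe (.const 1) (.get rAdj (.entry (.var rI) (.var rJ))))
          (.or (.natEq (.get rLab (.var rJ)) (.const 0))
            (.and (.natEq (.get rLab (.var rJ)) (.const 2))
              (.not (.natEq (.get rName (.var rI)) (.get rName (.var rJ)))))))).Holds s₂ ↔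
          U i j := by
        simp [hU, Usable, e₁, e₂, e₃, e₄, e₅, hsj, Nat.one_le_iff_ne_zero]
      refine wp_ite (fun hb => ?_) (fun hb => ?_)
      · rw [htest] at hb
        simp only [wp_seq, wp_setVar]
        right
        simp [hG, e₄, hsj, hi, hj, hb]
      · rw [htest] at hb
        rw [wp_skip]
        rcases h₂ with ⟨h₂, h₃, h₄⟩ | h₂
        · left
          refine ⟨by simpa using h₂, h₃, fun w hw => ?_⟩
          rcases Nat.lt_succ_iff_lt_or_eq.mp hw with h | rfl
          exacts [h₄ w h, hb]
        · right; simpa [hG] using h₂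
    · intro s₂ hf₂ h₂
      rcases h₂ with ⟨h₂, h₃, h₄⟩ | h₂
      · left
        refine ⟨by simpa using h₂, fun v hv => ?_⟩
        rcases Nat.lt_succ_iff_lt_or_eq.mp hv with h | rfl
        exacts [h₃ v h, h₄]
      · right; simpa [hG] using h₂
  · intro s₁ hf₁ h₁
    exact h₁

end

section

variable {K : Type} [Ring K] [LE K] {L : ℕ}

/-- Because `v ≠ x`, the row of `v` stays intact while it is copied into the row of `x`. -/
theorem wp_growStep {s : Memory K} {V v w x : ℕ} (hV : s.nat rV 0 = V) (hL : V ≤ L)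
    (hv : s.nat rFst 0 = v) (hw : s.nat rSnd 0 = w) (hx : s.nat rNew 0 = x) (hvV : v < V)
    (hwV : w < V) (hxV : x < V) (hvx : v ≠ x) (hwx : w ≠ x) :
    wp L growStep (fun s' =>
      (∀ y, s'.nat rLab y = if y = w then 1 else if y = x then 2 else s.nat rLab y) ∧
      (∀ y, s'.nat rName y = if y = x then x else s.nat rName y) ∧
      (∀ u, u ≠ x → ∀ y < V, s'.nat rRow (u * V + y) = s.nat rRow (u * V + y)) ∧
      (∀ y < V, s'.nat rRow (x * V + y) = if y = x then x else if y = v then w else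
        if y = w then v else s.nat rRow (v * V + y))) s := by
  simp only [growStep, wp_seq, wp_setNat, NatExp.eval, NatExp.eval_var]
  set s₀ := ((s.setNat rLab (s.nat rSnd 0) 1).setNat rLab
    ((s.setNat rLab (s.nat rSnd 0) 1).nat rNew 0) 2) with hs₀
  set s₁ := s₀.setNat rName (s₀.nat rNew 0) (s₀.nat rNew 0) with hs₁
  refine wp_forLoop V (fun j s' =>
    (∀ u, u ≠ x → ∀ y < V, s'.nat rRow (u * V + y) = s.nat rRow (u * V + y)) ∧
    (∀ y < j, s'.nat rRow (x * V + y) = s.nat rRow (v * V + y))) hL (by decide)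
    (fun s' hf => by simp [hf.nat rV (by decide), hs₁, hs₀, hV]) (by simp [hs₁, hs₀]) ?_ ?_
  · intro j s' hj hf hsj h
    have e₁ : s'.nat rV 0 = V := by simp [hf.nat rV (by decide), hs₁, hs₀, hV]
    have e₂ : s'.nat rNew 0 = x := by simp [hf.nat rNew (by decide), hs₁, hs₀, hx]
    have e₃ : s'.nat rFst 0 = v := by simp [hf.nat rFst (by decide), hs₁, hs₀, hv]
    simp only [wp_rowSet, NatExp.eval_rowGet, NatExp.eval_var, e₁, e₂, e₃, hsj]
    refine ⟨fun u hu y hy => ?_, fun y hy => ?_⟩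
    · simp [mul_add_inj hy hj, hu, h.1 u hu y hy]
    · have hyV : y < V := by omega
      rw [Memory.setNat_nat_of_ne _ _ _ (by decide), Memory.setNat_nat]
      simp only [mul_add_inj hyV hj, true_and]
      split_ifs with h'
      · rw [h.1 v hvx j hj, h']
      · exact h.2 y (by omega)
  · intro s' hf h
    have e₁ : s'.nat rV 0 = V := by simp [hf.nat rV (by decide), hs₁, hs₀, hV]
    have e₂ : s'.nat rNew 0 = x := by simp [hf.nat rNew (by decide), hs₁, hs₀, hx]
    have e₃ : s'.nat rFst 0 = v := by simp [hf.nat rFst (by decide), hs₁, hs₀, hv]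
    have e₄ : s'.nat rSnd 0 = w := by simp [hf.nat rSnd (by decide), hs₁, hs₀, hw]
    have e₅ : s'.nat rLab = s₁.nat rLab := hf.nat rLab (by decide)
    have e₆ : s'.nat rName = s₁.nat rName := hf.nat rName (by decide)
    simp only [wp_seq, wp_rowSet, NatExp.eval_var]
    refine ⟨fun y => ?_, fun y => ?_, fun u hu y hy => ?_, fun y hy => ?_⟩
    · simp [e₅, hs₁, hs₀, hx, hw]
      split_ifs <;> simp_all
    · simp [e₆, hs₁, hs₀, hx]
    · simp [e₁, e₂, e₃, e₄, mul_add_inj hy hxV, mul_add_inj hy hvV, mul_add_inj hy hwV, hu,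
        h.1 u hu y hy]
    · simp [e₁, e₂, e₃, e₄, h.2 y hy]

theorem wp_augmentStep {s : Memory K} {V v w : ℕ} (hV : s.nat rV 0 = V) (hL : V ≤ L)
    (hv : s.nat rFst 0 = v) (hw : s.nat rSnd 0 = w) :
    wp L augmentStep (fun s' => ∀ x < V, s'.nat rMate x =
      if x = v then w else if x = w then v else s.nat rRow (v * V + x)) s := by
  simp only [augmentStep, wp_seq]
  refine wp_forLoop V (fun j s' => ∀ x < j, s'.nat rMate x = s.nat rRow (v * V + x)) hL
    (by decide) (fun s' hf => by simp [hf.nat rV (by decide), hV]) (by simp) ?_ ?_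
  · intro j s' hj hf hsj h
    rw [wp_setNat]
    intro x hx
    rw [Memory.setNat_nat_of_ne _ _ _ (by decide)]
    simp only [Memory.setNat_nat, NatExp.eval_var, hsj, NatExp.eval_rowGet,
      hf.nat rV (by decide), hf.nat rFst (by decide), hf.nat rRow (by decide), hV, hv]
    by_cases hxj : x = j
    · simp [hxj]
    · simp [hxj, h x (by omega)]
  · intro s' hf h
    simp only [wp_seq, wp_setNat, NatExp.eval_var]
    intro x hx
    simp [hf.nat rFst (by decide), hf.nat rSnd (by decide), hv, hw, h x hx]

theorem wp_walkStep {s : Memory K} {V v w y : ℕ} (hV : s.nat rV 0 = V) (hL : V ≤ L)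
    (hv : s.nat rFst 0 = v) (hw : s.nat rSnd 0 = w) (hvV : v < V) (hwV : w < V)
    (hlv : s.nat rLab v = 2) (hlw : s.nat rLab w = 2) (hy : y < V)
    (hly : s.nat rLab y = 2) (hby : s.nat rName y = s.nat rCur 0)
    (hNy : s.nat rLab (s.nat rRow (w * V + y)) = 1) (haV : s.nat rRow (w * V + y) < V)
    (huniq : ∀ z < V, s.nat rLab z = 2 → s.nat rName z = s.nat rCur 0 →
      s.nat rLab (s.nat rRow (w * V + z)) = 1 → z = y) :
    wp L walkStep (fun s' =>
      s'.nat rCur 0 = s.nat rName (s.nat rRow (v * V + s.nat rRow (w * V + y))) ∧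
      (∀ x < V, s'.nat rLeft x = 1 ↔ s.nat rLeft x = 1 ∨ x = s.nat rRow (w * V + y) ∨
        (s.nat rLab x = 2 ∧
          s.nat rName x = s.nat rName (s.nat rRow (v * V + s.nat rRow (w * V + y))))) ∧
      (∀ u, u ≠ s.nat rRow (w * V + y) → ∀ x < V,
        s'.nat rRow (u * V + x) = s.nat rRow (u * V + x)) ∧
      (∀ x < V, s'.nat rRow (s.nat rRow (w * V + y) * V + x) =
        if x = s.nat rRow (w * V + y) then s.nat rRow (w * V + y) else if x = v then w else
          if x = w then v else
          if s.nat rLeft x = 1 then s.nat rRow (v * V + x) else s.nat rRow (w * V + x))) s := by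
  set a := s.nat rRow (w * V + y) with ha
  -- `v` and `w` are outer and `a` is inner, so the row that is written differs from both rows that
  -- are read.
  have hva : v ≠ a := by rintro h; rw [← h] at hNy; omega
  have hwa : w ≠ a := by rintro h; rw [← h] at hNy; omega
  simp only [walkStep, wp_seq]
  -- the inner vertex at which the walk leaves the current blossom
  refine wp_forLoop V (fun j s' => y < j → s'.nat rNew 0 = a) hL
    (by decide) (fun s' hf => by simp [hf.nat rV (by decide), hV]) (by simp) ?_ ?_
  · intro j s' hj hf hsj h
    have htest : (Test.and (.natEq (.get rLab (.var rJ)) (.const 2))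
        (.and (.natEq (.get rName (.var rJ)) (.var rCur))
          (.natEq (.get rLab (.rowGet rSnd (.var rJ))) (.const 1)))).Holds s' ↔ j = y := by
      simp only [Test.Holds, Test.holds_natEq, NatExp.eval, NatExp.eval_var, NatExp.eval_rowGet,
        hsj, hf.nat rV (by decide), hf.nat rSnd (by decide), hf.nat rRow (by decide),
        hf.nat rLab (by decide), hf.nat rName (by decide), hf.nat rCur (by decide), hV, hw]
      constructor
      · rintro ⟨h₁, h₂, h₃⟩; exact huniq j hj h₁ h₂ h₃
      · rintro rfl; exact ⟨hly, hby, hNy⟩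
    refine wp_ite (fun hb => ?_) (fun hb => ?_)
    · rw [htest] at hb
      subst hb
      simp [hsj, hf.nat rV (by decide), hf.nat rSnd (by decide), hf.nat rRow (by decide), hV, hw,
        ha]
    · rw [htest] at hb
      simp only [wp_skip]
      intro hyj
      simpa using h (by omega)
  intro s₁ hf₁ h₁
  have hnew₁ : s₁.nat rNew 0 = a := h₁ hy
  clear h₁
  have a₁ : ∀ c, c ∉ [rJ, rNew] → s₁.nat c = s.nat c := by
    intro c hc
    refine hf₁.nat c fun h => hc ?_
    revert h
    simp [Program.natWrites, Program.setVar]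
    tauto
  clear hf₁
  -- the new row
  rw [wp_seq]
  refine wp_forLoop V (fun j s' =>
    (∀ u, u ≠ a → ∀ x < V, s'.nat rRow (u * V + x) = s.nat rRow (u * V + x)) ∧
    (∀ x < j, s'.nat rRow (a * V + x) =
      if s.nat rLeft x = 1 then s.nat rRow (v * V + x) else s.nat rRow (w * V + x))) hL
    (by decide) (fun s' hf => by simp [hf.nat rV (by decide), a₁ rV (by decide), hV])
    (by simp [a₁ rRow (by decide)]) ?_ ?_
  · intro j s' hj hf hsj h
    have e₁ : s'.nat rV 0 = V := by simp [hf.nat rV (by decide), a₁ rV (by decide), hV]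
    have e₂ : s'.nat rNew 0 = a := by simp [hf.nat rNew (by decide), hnew₁]
    have e₃ : s'.nat rFst 0 = v := by simp [hf.nat rFst (by decide), a₁ rFst (by decide), hv]
    have e₄ : s'.nat rSnd 0 = w := by simp [hf.nat rSnd (by decide), a₁ rSnd (by decide), hw]
    have e₅ : s'.nat rLeft = s.nat rLeft := by
      rw [hf.nat rLeft (by decide), a₁ rLeft (by decide)]
    refine wp_ite (fun hb => ?_) (fun hb => ?_)
    all_goals
      simp only [Test.holds_natEq, NatExp.eval, NatExp.eval_var, hsj, e₅] at hb
      simp only [wp_rowSet, NatExp.eval_rowGet, NatExp.eval_var, e₁, e₂, e₃, e₄, hsj]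
      refine ⟨fun u hu x hx => ?_, fun x hx => ?_⟩
      · simp [mul_add_inj hx hj, hu, h.1 u hu x hx]
      · have hxV : x < V := by omega
        rw [Memory.setNat_nat_of_ne _ _ _ (by decide), Memory.setNat_nat]
        simp only [mul_add_inj hxV hj, true_and]
        by_cases hxj : x = j
        · subst hxj
          simp [hb, h.1 v hva x hj, h.1 w hwa x hj]
        · rw [if_neg hxj]
          exact h.2 x (by omega)
  intro s₂ hf₂ h₂
  have hnew₂ : s₂.nat rNew 0 = a := by rw [hf₂.nat rNew (by decide), hnew₁]
  have a₂ : ∀ c, c ∉ [rJ, rNew, rRow] → s₂.nat c = s.nat c := by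
    intro c hc
    rw [hf₂.nat c, a₁ c]
    · simp at hc ⊢; tauto
    · intro h
      refine hc ?_
      revert h
      simp [Program.natWrites, Program.rowSet]
      tauto
  clear hf₂ a₁ hnew₁
  have e₁ : s₂.nat rV 0 = V := by rw [a₂ rV (by decide), hV]
  have e₃ : s₂.nat rFst 0 = v := by rw [a₂ rFst (by decide), hv]
  have e₄ : s₂.nat rSnd 0 = w := by rw [a₂ rSnd (by decide), hw]
  simp only [wp_seq, wp_rowSet, wp_setNat, wp_setVar, NatExp.eval, NatExp.eval_var, NatExp.eval_rowGet]
  set s₃ := (s₂.setNat rRow (s₂.nat rNew 0 * s₂.nat rV 0 + s₂.nat rSnd 0) (s₂.nat rFst 0)) with hs₃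
  set s₄ := (s₃.setNat rRow (s₃.nat rNew 0 * s₃.nat rV 0 + s₃.nat rFst 0) (s₃.nat rSnd 0)) with hs₄
  set s₅ := (s₄.setNat rRow (s₄.nat rNew 0 * s₄.nat rV 0 + s₄.nat rNew 0) (s₄.nat rNew 0)) with hs₅
  set s₆ := s₅.setNat rLeft (s₅.nat rNew 0) 1 with hs₆
  have a₆ : ∀ c, c ∉ [rRow, rLeft] → s₆.nat c = s₂.nat c := by
    intro c hc
    simp only [List.mem_cons, List.not_mem_nil, or_false, not_or] at hc
    rw [hs₆, Memory.setNat_nat_of_ne _ _ _ hc.2, hs₅, Memory.setNat_nat_of_ne _ _ _ hc.1, hs₄,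
      Memory.setNat_nat_of_ne _ _ _ hc.1, hs₃, Memory.setNat_nat_of_ne _ _ _ hc.1]
  have hrow₁ : ∀ u, u ≠ a → ∀ x < V, s₆.nat rRow (u * V + x) = s.nat rRow (u * V + x) := by
    intro u hu x hx
    simp [hs₆, hs₅, hs₄, hs₃, e₁, e₃, e₄, hnew₂, mul_add_inj hx haV, mul_add_inj hx hvV,
      mul_add_inj hx hwV, hu, h₂.1 u hu x hx]
  have hrow₂ : ∀ x < V, s₆.nat rRow (a * V + x) =
        if x = a then a else if x = v then w else if x = w then v else
          if s.nat rLeft x = 1 then s.nat rRow (v * V + x) else s.nat rRow (w * V + x) := by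
    intro x hx
    simp [hs₆, hs₅, hs₄, hs₃, e₁, e₃, e₄, hnew₂, h₂.2 x hx]
  have hleft : ∀ x, s₆.nat rLeft x = 1 ↔ s.nat rLeft x = 1 ∨ x = a := by
    intro x
    have e : s₅.nat rLeft = s.nat rLeft := by simp [hs₅, hs₄, hs₃, a₂ rLeft (by decide)]
    have e' : s₅.nat rNew 0 = a := by simp [hs₅, hs₄, hs₃, hnew₂]
    simp only [hs₆, Memory.setNat_nat, true_and, e, e']
    split_ifs with h <;> simp [h]
  set c := s.nat rName (s.nat rRow (v * V + a)) with hc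
  have hcur : s₆.nat rName (s₆.nat rRow (s₆.nat rFst 0 * s₆.nat rV 0 + s₆.nat rNew 0)) = c := by
    rw [a₆ rFst (by decide), a₆ rV (by decide), a₆ rNew (by decide), a₆ rName (by decide), e₁, e₃,
      hnew₂, hrow₁ v hva a haV, a₂ rName (by decide)]
  rw [hcur]
  -- the next blossom joins the set
  refine wp_forLoop V (fun j s' => s'.nat rCur 0 = c ∧ ∀ x < V, s'.nat rLeft x = 1 ↔
    (s.nat rLeft x = 1 ∨ x = a) ∨ (x < j ∧ s.nat rLab x = 2 ∧ s.nat rName x = c)) hL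
    (by decide)
    (fun s' hf => by simp [hf.nat rV (by decide), a₆ rV (by decide), a₂ rV (by decide), hV])
    (by simp [hleft]) ?_ ?_
  · intro j s' hj hf hsj h
    have e₅ : s'.nat rLab = s.nat rLab := by
      simp [hf.nat rLab (by decide), a₆ rLab (by decide), a₂ rLab (by decide)]
    have e₆ : s'.nat rName = s.nat rName := by
      simp [hf.nat rName (by decide), a₆ rName (by decide), a₂ rName (by decide)]
    refine wp_ite (fun hb => ?_) (fun hb => ?_)
    · simp only [Test.Holds, Test.holds_natEq, NatExp.eval, NatExp.eval_var, hsj, e₅, e₆,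
        h.1] at hb
      simp only [wp_setNat, NatExp.eval, NatExp.eval_var, hsj]
      refine ⟨by simpa using h.1, fun x hx => ?_⟩
      by_cases hxj : x = j
      · subst hxj; simp [hb]
      · have : x < j + 1 ↔ x < j := by omega
        simp [hxj, h.2 x hx, this]
    · simp only [Test.Holds, Test.holds_natEq, NatExp.eval, NatExp.eval_var, hsj, e₅, e₆,
        h.1] at hb
      simp only [wp_skip]
      refine ⟨by simpa using h.1, fun x hx => ?_⟩
      by_cases hxj : x = j
      · subst hxj
        rw [Memory.setNat_nat_of_ne _ _ _ (by decide), h.2 x hx]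
        tauto
      · have : x < j + 1 ↔ x < j := by omega
        simp [h.2 x hx, this]
  · intro s' hf h
    have e₇ : s'.nat rRow = s₆.nat rRow := by simp [hf.nat rRow (by decide)]
    refine ⟨h.1, fun x hx => ?_, fun u hu x hx => by rw [e₇, hrow₁ u hu x hx],
      fun x hx => by rw [e₇, hrow₂ x hx]⟩
    rw [h.2 x hx]
    tauto

end

open Program NatExp SearchState

/-- The matrix with `V` columns that is stored in the array `f`. -/
def matrix (V : ℕ) (f : ℕ → ℕ) (u x : ℕ) : ℕ := f (u * V + x)

section

variable {K : Type} [Ring K] [LE K] {L : ℕ}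

theorem wp_shrinkStep {s : Memory K} {V r v w : ℕ} {adj : ℕ → ℕ → Prop} {M : ℕ → ℕ}
    (hV : s.nat rV 0 = V) (hL : V ≤ L) (hsymm : ∀ x y, adj x y → adj y x)
    (I : SearchState V adj M r (s.nat rLab) (s.nat rName) (matrix V (s.nat rRow)))
    (hv : s.nat rFst 0 = v) (hw : s.nat rSnd 0 = w) (hvV : v < V) (hwV : w < V)
    (hlv : s.nat rLab v = 2) (hlw : s.nat rLab w = 2) (hvw : s.nat rName v ≠ s.nat rName w)
    (hadj : adj v w) :
    wp L shrinkStep (fun s' =>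
      SearchState V adj M r (s'.nat rLab) (s'.nat rName) (matrix V (s'.nat rRow)) ∧
      (∀ x < V, s.nat rLab x ≤ s'.nat rLab x) ∧
      ∃ a < V, s.nat rLab a < s'.nat rLab a ∧ s'.nat rLab a = 2) s := by
  set lab := s.nat rLab with hlab
  set b := s.nat rName with hb
  set N := matrix V (s.nat rRow) with hN
  rw [shrinkStep, wp_seq]
  refine wp_forLoop V (fun j s' => ∀ x < j, s'.nat rLeft x = 1 ↔ lab x = 2 ∧ b x = b v) hL
    (by decide) (fun s' hf => by simp [hf.nat rV (by decide), hV]) (by simp) ?_ ?_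
  · intro j s' hj hf hsj h
    have htest : (Test.and (.natEq (.get rLab (.var rJ)) (.const 2))
        (.natEq (.get rName (.var rJ)) (.get rName (.var rFst)))).Holds s' ↔
        lab j = 2 ∧ b j = b v := by
      simp [hsj, hf.nat rLab (by decide), hf.nat rName (by decide), hf.nat rFst (by decide), hv,
        hlab, hb]
    refine wp_ite (fun ht => ?_) (fun ht => ?_)
    all_goals
      rw [htest] at ht
      rw [wp_setNat]
      intro x hx
      rw [Memory.setNat_nat_of_ne _ _ _ (by decide), Memory.setNat_nat]
      simp only [NatExp.eval_var, hsj, NatExp.eval, true_and]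
      by_cases hxj : x = j
      · subst hxj; simp [ht]
      · rw [if_neg hxj]; exact h x (by omega)
  intro s₁ hf₁ h₁
  simp only [wp_seq, wp_setVar, NatExp.eval_var, NatExp.eval]
  have e₁ : ∀ c, c ∉ [rJ, rLeft] → s₁.nat c = s.nat c := fun c hc => hf₁.nat c fun h => hc (by
    revert h
    simp [Program.natWrites]
    tauto)
  set s₂ := s₁.setNat rOld 0 (s₁.nat rName (s₁.nat rFst 0)) with hs₂
  set s₃ := s₂.setNat rCur 0 (s₂.nat rOld 0) with hs₃
  have e₃ : ∀ c, c ∉ [rJ, rLeft, rOld, rCur] → s₃.nat c = s.nat c := by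
    intro c hc
    simp only [List.mem_cons, List.not_mem_nil, or_false, not_or] at hc
    rw [hs₃, Memory.setNat_nat_of_ne _ _ _ hc.2.2.2, hs₂, Memory.setNat_nat_of_ne _ _ _ hc.2.2.1,
      e₁ c (by simp; tauto)]
  have hold₃ : s₃.nat rOld 0 = b v := by
    simp [hs₃, hs₂, e₁ rName (by decide), e₁ rFst (by decide), hv, hb]
  have hcur₃ : s₃.nat rCur 0 = b v := by
    simp [hs₃, hs₂, e₁ rName (by decide), e₁ rFst (by decide), hv, hb]
  have hleft₃ : s₃.nat rLeft = s₁.nat rLeft := by simp [hs₃, hs₂]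
  set S : Memory K → ℕ → Prop := fun s' x => x < V ∧ s'.nat rLeft x = 1 with hS
  -- Every round marks a new inner vertex, so the number of unmarked vertices is a measure; it is at
  -- most `V`.
  refine wp_while (fun s' => Walk V adj M lab b N v w (S s') (matrix V (s'.nat rRow)) ∧
      ((s'.nat rCur 0 ≠ b w ∧ WalkOpen V lab b N w (S s') (s'.nat rCur 0)) ∨
       (s'.nat rCur 0 = b w ∧ WalkDone V N w (S s'))))
    (fun s' => ((Finset.range V).filter fun x => s'.nat rLeft x ≠ 1).card) ?_ ?_ ?_ ?_
  · have := I.walk_start (S := S s₃) (N' := matrix V (s₃.nat rRow)) hvV hlv hwV hlw hvw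
      (fun x => by
        simp only [hS, hleft₃]
        constructor
        · rintro ⟨h, h'⟩; exact ⟨h, (h₁ x h).mp h'⟩
        · rintro ⟨h, h'⟩; exact ⟨h, (h₁ x h).mpr h'⟩)
      (fun u _ _ x _ => by rw [e₃ rRow (by decide)])
    rw [hcur₃]
    exact ⟨this.1, .inl ⟨hvw, this.2⟩⟩
  · exact ((Finset.card_filter_le _ _).trans (by simp)).trans hL
  · intro s₄ hf₄ hI₄ ht
    have e₄ : ∀ c, c ∉ [rJ, rLeft, rOld, rCur, rNew, rRow] → s₄.nat c = s.nat c := by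
      intro c hc
      simp only [List.mem_cons, List.not_mem_nil, or_false, not_or] at hc
      rw [hf₄.nat c, e₃ c (by simp; tauto)]
      simp [walkStep, Program.natWrites, Program.setVar, Program.rowSet]
      tauto
    simp only [Test.Holds, Test.holds_natEq, NatExp.eval, NatExp.eval_var, e₄ rName (by decide),
      e₄ rSnd (by decide), hw] at ht
    obtain ⟨W, O | O⟩ := hI₄
    swap
    · exact absurd O.1 ht
    replace O := O.2
    obtain ⟨hSw, y, hy, hSy, hly, hby, hNy, hSNy, hmap⟩ := id O
    have hlt := (I.matching w hwV hlw).lt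
    have hrw : ∀ z < V, s₄.nat rRow (w * V + z) = N w z := fun z hz => W.old w hwV hlw z hz
    have hrv : ∀ z < V, s₄.nat rRow (v * V + z) = N v z := fun z hz => W.old v hvV hlv z hz
    refine wp_mono (wp_walkStep (y := y) (by rw [e₄ rV (by decide), hV]) hL
      (by rw [e₄ rFst (by decide), hv]) (by rw [e₄ rSnd (by decide), hw]) hvV hwV
      (by rw [e₄ rLab (by decide)]; exact hlv) (by rw [e₄ rLab (by decide)]; exact hlw) hy
      (by rw [e₄ rLab (by decide)]; exact hly) (by rw [e₄ rName (by decide)]; exact hby)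
      (by rw [e₄ rLab (by decide), hrw y hy]; exact hNy) (by rw [hrw y hy]; exact hlt y hy) ?_) ?_
    · intro z hz h₁ h₂ h₃
      rw [e₄ rLab (by decide)] at h₁ h₃
      rw [e₄ rName (by decide)] at h₂
      rw [hrw z hz] at h₃
      exact I.port_unique hwV hlw hz h₁ hy hly (h₂.trans hby.symm) (.inr h₃) (.inr hNy)
    · intro s₅ hf₅ h₅
      rw [hrw y hy, hrv _ (hlt y hy), e₄ rName (by decide), e₄ rLab (by decide)] at h₅
      obtain ⟨h₅, h₆, h₇, h₈⟩ := h₅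
      classical
      have hstep := I.walk_step hvV hlv hwV hlw hvw hsymm hadj (S := S s₄) (S' := S s₅)
        (N'' := matrix V (s₅.nat rRow)) W O hy hly hby hNy rfl (by
          intro x
          simp only [hS]
          constructor
          · rintro ⟨hx, h⟩
            rcases (h₆ x hx).mp h with h | h | h
            · exact .inl ⟨hx, h⟩
            · exact .inr (.inl h)
            · exact .inr (.inr ⟨hx, h⟩)
          · rintro (⟨hx, h⟩ | h | ⟨hx, h⟩)
            · exact ⟨hx, (h₆ x hx).mpr (.inl h)⟩
            · have hx : x < V := h ▸ hlt y hy
              exact ⟨hx, (h₆ x hx).mpr (.inr (.inl h))⟩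
            · exact ⟨hx, (h₆ x hx).mpr (.inr (.inr h))⟩)
        (fun u _ hu x hx => h₇ u hu x hx) (by
          intro x hx
          rw [matrix, h₈ x hx, hrv x hx, hrw x hx]
          simp only [hS, hx, true_and])
      rw [h₅]
      refine ⟨hstep, Finset.card_lt_card ?_⟩
      rw [Finset.ssubset_iff_of_subset]
      · refine ⟨N w y, ?_, ?_⟩
        · simp only [Finset.mem_filter, Finset.mem_range]
          exact ⟨hlt y hy, fun h => hSNy ⟨hlt y hy, h⟩⟩
        · simp only [Finset.mem_filter, not_and, not_not]
          exact fun _ => (h₆ _ (hlt y hy)).mpr (.inr (.inl rfl))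
      · intro x
        simp only [Finset.mem_filter, Finset.mem_range]
        rintro ⟨hx, h⟩
        exact ⟨hx, fun h' => h ((h₆ x hx).mpr (.inl h'))⟩
  · intro s₄ hf₄ hI₄ ht
    have e₄ : ∀ c, c ∉ [rJ, rLeft, rOld, rCur, rNew, rRow] → s₄.nat c = s.nat c := by
      intro c hc
      simp only [List.mem_cons, List.not_mem_nil, or_false, not_or] at hc
      rw [hf₄.nat c, e₃ c (by simp; tauto)]
      simp [walkStep, Program.natWrites, Program.setVar, Program.rowSet]
      tauto
    have hold₄ : s₄.nat rOld 0 = b v := by rw [hf₄.nat rOld (by decide), hold₃]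
    simp only [Test.Holds, Test.holds_natEq, NatExp.eval, NatExp.eval_var, e₄ rName (by decide),
      e₄ rSnd (by decide), hw, not_not] at ht
    obtain ⟨W, O | O⟩ := hI₄
    · exact absurd ht O.1
    classical
    refine wp_forLoop V (fun j s' =>
      (∀ x < V, s'.nat rLab x = if x < j ∧ S s₄ x then 2 else lab x) ∧
      (∀ x < V, s'.nat rName x = if x < j ∧ S s₄ x then b v else b x)) hL
      (by decide) (fun s' hf => by simp [hf.nat rV (by decide), e₄ rV (by decide), hV])
      (by simp [e₄ rLab (by decide), e₄ rName (by decide), hlab, hb]) ?_ ?_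
    · intro j s₅ hj hf₅ hsj h
      have htest : (Test.natEq (.get rLeft (.var rJ)) (.const 1)).Holds s₅ ↔ S s₄ j := by
        simp [hsj, hf₅.nat rLeft (by decide), hS, hj]
      have hlt : ∀ x, x ≠ j → (x < j + 1 ↔ x < j) := fun x hx => by omega
      refine wp_ite (fun ht => ?_) (fun ht => ?_)
      · rw [htest] at ht
        simp only [wp_seq, wp_setNat, NatExp.eval, NatExp.eval_var]
        refine ⟨fun x hx => ?_, fun x hx => ?_⟩
        · by_cases hxj : x = j
          · subst hxj; simp [hsj, ht]
          · simp [hsj, hxj, h.1 x hx, hlt x hxj]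
        · by_cases hxj : x = j
          · subst hxj; simp [hsj, ht, hf₅.nat rOld (by decide), hold₄]
          · simp [hsj, hxj, h.2 x hx, hlt x hxj]
      · rw [htest] at ht
        rw [wp_skip]
        refine ⟨fun x hx => ?_, fun x hx => ?_⟩
        · by_cases hxj : x = j
          · subst hxj; simp [ht, h.1 x hx]
          · simp [h.1 x hx, hlt x hxj]
        · by_cases hxj : x = j
          · subst hxj; simp [ht, h.2 x hx]
          · simp [h.2 x hx, hlt x hxj]
    · intro s₅ hf₅ h
      have hl : ∀ x < V, s₅.nat rLab x = if S s₄ x then 2 else lab x := fun x hx => by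
        rw [h.1 x hx]; simp only [hx, true_and]
      have hn : ∀ x < V, s₅.nat rName x = if S s₄ x then b v else b x := fun x hx => by
        rw [h.2 x hx]; simp only [hx, true_and]
      have hfin := I.walk_shrink hvV hlv hwV hlw hvw W O.2 hl hn
      rw [hf₅.nat rRow (by decide)]
      obtain ⟨h₁, a, ha, h₂, h₃⟩ := hfin
      refine ⟨h₁, fun x hx => ?_, a, ha, by rw [h₂, h₃]; omega, h₃⟩
      rw [hl x hx]
      split_ifs
      exacts [I.lab_le x hx, le_rfl]

/-- The search either enlarges the matching so that it covers `r`, or proves that the graph has no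
perfect matching. -/
def SearchResult (V : ℕ) (adj : ℕ → ℕ → Prop) (M : ℕ → ℕ) (r fail : ℕ) (M' : ℕ → ℕ) : Prop :=
  (fail = 0 ∧ IsMatching V adj M' ∧ M' r ≠ r ∧ ∀ x < V, M x ≠ x → M' x ≠ x) ∨
  (fail = 1 ∧ ∀ M'', IsMatching V adj M'' → ∃ x < V, M'' x = x)

/-- A round either ends the search or raises a label and lowers none. As labels are at most `2`,
this bounds the number of rounds. -/
theorem wp_searchStep {s : Memory K} {V r : ℕ} {adj : ℕ → ℕ → Prop} {M : ℕ → ℕ}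
    (hV : s.nat rV 0 = V) (hL : V ≤ L) (hA : ∀ x < V, ∀ y < V, adj x y ↔ s.nat rAdj (x * V + y) ≠ 0)
    (hsymm : ∀ x y, adj x y → adj y x) (hfail : s.nat rFail 0 = 0) (hcont : s.nat rCont 0 = 1)
    (I : SearchState V adj M r (s.nat rLab) (s.nat rName) (matrix V (s.nat rRow))) :
    wp L searchStep (fun s' =>
      (s'.nat rCont 0 = 0 ∧ s'.nat rLab = s.nat rLab ∧
        SearchResult V adj M r (s'.nat rFail 0) (s'.nat rMate)) ∨
      (s'.nat rCont 0 = 1 ∧ s'.nat rFail 0 = 0 ∧ s'.nat rMate = s.nat rMate ∧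
        SearchState V adj M r (s'.nat rLab) (s'.nat rName) (matrix V (s'.nat rRow)) ∧
        (∀ x < V, s.nat rLab x ≤ s'.nat rLab x) ∧
        ∃ a < V, s.nat rLab a < s'.nat rLab a ∧ s'.nat rLab a ≤ 2)) s := by
  rw [searchStep, wp_seq]
  refine wp_mono (wp_findEdge hV hL) fun s₁ hf₁ h₁ => ?_
  have e₁ : ∀ c, c ∉ [rI, rJ, rFound, rFst, rSnd] → s₁.nat c = s.nat c := by
    intro c hc
    simp only [List.mem_cons, List.not_mem_nil, or_false, not_or] at hc
    refine hf₁.nat c ?_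
    simp [findEdge, Program.natWrites, Program.setVar]
    tauto
  have eV : s₁.nat rV 0 = V := by rw [e₁ rV (by decide), hV]
  have eI : SearchState V adj M r (s₁.nat rLab) (s₁.nat rName) (matrix V (s₁.nat rRow)) := by
    rw [e₁ rLab (by decide), e₁ rName (by decide), e₁ rRow (by decide)]; exact I
  have eL := e₁ rLab (by decide)
  have eN := e₁ rName (by decide)
  have eF : s₁.nat rFail 0 = 0 := by rw [e₁ rFail (by decide), hfail]
  have eC : s₁.nat rCont 0 = 1 := by rw [e₁ rCont (by decide), hcont]
  have eM := e₁ rMate (by decide)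
  rw [← eL, ← eN] at h₁
  refine wp_ite (fun ht => ?_) (fun ht => ?_)
  · simp only [Test.holds_natEq, NatExp.eval_var, NatExp.eval] at ht
    have h₁ := h₁.resolve_right (by rintro ⟨h, -⟩; omega)
    simp only [wp_seq, wp_setVar, NatExp.eval]
    refine .inl ⟨by simp, by simp [eL], .inr ⟨by simp, fun M'' hM'' => ?_⟩⟩
    by_contra hcon
    push Not at hcon
    refine eI.not_perfect (fun v hv hlv w hw hvw => ?_) hM'' hcon
    have := h₁.2 v hv w hw
    have h₂ := (hA v hv w hw).mp hvw
    have h₃ := eI.lab_le w hw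
    simp only [Usable, not_and, not_or, ne_eq, not_not] at this
    have h₄ := this hlv h₂
    by_cases h₅ : s₁.nat rLab w = 2
    · exact .inr ⟨h₅, (h₄.2 h₅).symm⟩
    · left; omega
  · simp only [Test.holds_natEq, NatExp.eval_var, NatExp.eval] at ht
    obtain ⟨-, hvV, hwV, hlv, hvw, husable⟩ := h₁.resolve_left (by rintro ⟨h, -⟩; exact ht h)
    set v := s₁.nat rFst 0 with hv
    set w := s₁.nat rSnd 0 with hw
    have hadj : adj v w := (hA v hvV w hwV).mpr hvw
    refine wp_ite (fun ht => ?_) (fun ht => ?_)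
    · simp only [Test.holds_natEq, NatExp.eval_var, NatExp.eval, ← hw] at ht
      simp only [wp_seq, wp_setVar, NatExp.eval_rowGet, NatExp.eval_var, ← hv, ← hw, eV]
      set x := s₁.nat rRow (v * V + w) with hx
      set s₂ := s₁.setNat rNew 0 x with hs₂
      have hnew : s₂.nat rNew 0 = x := by simp [hs₂]
      have e₂ : ∀ c, c ≠ rNew → s₂.nat c = s₁.nat c := fun c hc =>
        Memory.setNat_nat_of_ne _ _ _ hc
      refine wp_ite (fun ht' => ?_) (fun ht' => ?_)
      · simp only [Test.holds_natEq, NatExp.eval_var, hnew, e₂ rSnd (by decide), ← hw] at ht'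
        rw [wp_seq]
        refine wp_mono (wp_augmentStep (v := v) (w := w) (by rw [e₂ rV (by decide), eV]) hL
          (by rw [e₂ rFst (by decide)]) (by rw [e₂ rSnd (by decide)])) fun s₃ hf₃ h₃ => ?_
        rw [wp_setVar]
        rw [e₂ rRow (by decide)] at h₃
        have := eI.augment hsymm hvV hlv hwV ht hadj (show matrix V (s₁.nat rRow) v w = w from ht')
          h₃
        refine .inl ⟨by simp, ?_, .inl ⟨?_, ?_⟩⟩
        · rw [Memory.setNat_nat_of_ne _ _ _ (by decide), hf₃.nat rLab (by decide),
            e₂ rLab (by decide), eL]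
        · rw [Memory.setNat_nat_of_ne _ _ _ (by decide), hf₃.nat rFail (by decide),
            e₂ rFail (by decide), eF]
        · rw [Memory.setNat_nat_of_ne _ _ _ (by decide)]
          exact this
      · simp only [Test.holds_natEq, NatExp.eval_var, hnew, e₂ rSnd (by decide), ← hw] at ht'
        have hunseen := eI.unseen v hvV hlv w hwV ht
        have hlx : s₁.nat rLab x = 0 := hunseen.2
        have hxV : x < V := (eI.matching v hvV hlv).lt w hwV
        refine wp_mono (wp_growStep (v := v) (w := w) (x := x) (by rw [e₂ rV (by decide), eV]) hL
          (by rw [e₂ rFst (by decide)]) (by rw [e₂ rSnd (by decide)]) hnew hvV hwV hxV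
          (by rintro h; rw [← h] at hlx; omega) (fun h => ht' h.symm)) fun s₃ hf₃ h₃ => ?_
        rw [e₂ rLab (by decide), e₂ rName (by decide), e₂ rRow (by decide)] at h₃
        have hg := eI.grow hsymm hvV hlv hwV ht hadj (x := x) rfl ht' (fun y _ => h₃.1 y)
          (fun y _ => h₃.2.1 y) (N' := matrix V (s₃.nat rRow))
          (fun u _ hlu y hy => h₃.2.2.1 u (by rintro rfl; omega) y hy) h₃.2.2.2
        refine .inr ⟨?_, ?_, ?_, hg, fun y hy => ?_, w, hwV, ?_, ?_⟩
        · rw [hf₃.nat rCont (by decide), e₂ rCont (by decide), eC]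
        · rw [hf₃.nat rFail (by decide), e₂ rFail (by decide), eF]
        · rw [hf₃.nat rMate (by decide), e₂ rMate (by decide), eM]
        · rw [h₃.1 y, ← eL]
          split_ifs with h h'
          · rw [h, ht]; omega
          · rw [h', hlx]; omega
          · exact le_rfl
        · rw [h₃.1 w, if_pos rfl, ← eL, ht]; omega
        · rw [h₃.1 w, if_pos rfl]; omega
    · simp only [Test.holds_natEq, NatExp.eval_var, NatExp.eval, ← hw] at ht
      obtain ⟨hlw, hbb⟩ := husable.resolve_left ht
      refine wp_mono (wp_shrinkStep eV hL hsymm eI rfl rfl hvV hwV hlv hlw hbb hadj)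
        fun s₃ hf₃ h₃ => ?_
      rw [eL] at h₃
      obtain ⟨h₃, h₄, a, ha, h₅, h₆⟩ := h₃
      refine .inr ⟨?_, ?_, ?_, h₃, h₄, a, ha, h₅, h₆.le⟩
      · rw [hf₃.nat rCont (by decide), eC]
      · rw [hf₃.nat rFail (by decide), eF]
      · rw [hf₃.nat rMate (by decide), eM]

theorem wp_search {s : Memory K} {V r : ℕ} {adj : ℕ → ℕ → Prop}
    (hV : s.nat rV 0 = V) (hL : 2 * V + 1 ≤ L)
    (hA : ∀ x < V, ∀ y < V, adj x y ↔ s.nat rAdj (x * V + y) ≠ 0)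
    (hsymm : ∀ x y, adj x y → adj y x) (hfail : s.nat rFail 0 = 0) (hr : s.nat rRoot 0 = r)
    (hrV : r < V) (hM : IsMatching V adj (s.nat rMate)) (hMr : s.nat rMate r = r) :
    wp L search (fun s' =>
      SearchResult V adj (s.nat rMate) r (s'.nat rFail 0) (s'.nat rMate)) s := by
  set M := s.nat rMate with hMdef
  rw [search, wp_seq]
  refine wp_forLoop V (fun j s' => (∀ x < j, s'.nat rLab x = 0) ∧
      ∀ x < j, s'.nat rRow (r * V + x) = M x) (by omega)
    (by decide) (fun s' hf => by simp [hf.nat rV (by decide), hV]) (by simp) ?_ ?_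
  · intro j s' hj hf hsj h
    simp only [wp_seq, wp_setNat, wp_rowSet, NatExp.eval, NatExp.eval_var]
    refine ⟨fun x hx => ?_, fun x hx => ?_⟩
    · by_cases hxj : x = j
      · simp [hxj, hsj]
      · simp [hxj, hsj, h.1 x (by omega)]
    · by_cases hxj : x = j
      · simp [hxj, hsj, hf.nat rRoot (by decide), hf.nat rV (by decide), hV, hr,
          hf.nat rMate (by decide), hMdef]
      · simp [hxj, hsj, hf.nat rRoot (by decide), hf.nat rV (by decide), hV, hr,
          h.2 x (by omega)]
  intro s₁ hf₁ h₁
  simp only [wp_seq, wp_setNat, wp_setVar, NatExp.eval, NatExp.eval_var]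
  have hr₁ : s₁.nat rRoot 0 = r := by rw [hf₁.nat rRoot (by decide), hr]
  have hr₁' : (s₁.setNat rLab r 2).nat rRoot 0 = r := by simp [hr₁]
  rw [hr₁, hr₁']
  set s₂ := ((s₁.setNat rLab r 2).setNat rName r r).setNat rCont 0 1 with hs₂
  have e₂ : ∀ c, c ∉ [rJ, rLab, rRow, rName, rCont] → s₂.nat c = s.nat c := by
    intro c hc
    simp only [List.mem_cons, List.not_mem_nil, or_false, not_or] at hc
    rw [hs₂, Memory.setNat_nat_of_ne _ _ _ hc.2.2.2.2, Memory.setNat_nat_of_ne _ _ _ hc.2.2.2.1,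
      Memory.setNat_nat_of_ne _ _ _ hc.2.1, hf₁.nat c]
    simp [Program.natWrites, Program.rowSet]
    tauto
  -- The sum of `2 - lab x` drops in every continuing round; the summand `rCont` pays for the last
  -- round, which leaves the labels unchanged. This is the source of `2 * V + 1`.
  refine wp_while (fun s' => s'.nat rLab r = 2 ∧ ((s'.nat rCont 0 = 0 ∧
        SearchResult V adj M r (s'.nat rFail 0) (s'.nat rMate)) ∨
      (s'.nat rCont 0 = 1 ∧ s'.nat rFail 0 = 0 ∧ s'.nat rMate = M ∧
        SearchState V adj M r (s'.nat rLab) (s'.nat rName) (matrix V (s'.nat rRow)))))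
    (fun s' => s'.nat rCont 0 + ∑ x ∈ Finset.range V, (2 - s'.nat rLab x)) ?_ ?_ ?_ ?_
  · refine ⟨by simp [hs₂], .inr ⟨by simp [hs₂], by rw [e₂ rFail (by decide), hfail],
      by rw [e₂ rMate (by decide)], ?_⟩⟩
    refine SearchState.start hM hrV hMr (fun x hx hxr => ?_) (by simp [hs₂]) (by simp [hs₂])
      (fun x hx => ?_)
    · simp [hs₂, hxr, h₁.1 x hx]
    · simp [matrix, hs₂, h₁.2 x hx]
  · have : ∑ x ∈ Finset.range V, (2 - s₂.nat rLab x) ≤ ∑ x ∈ Finset.range V, 2 :=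
      Finset.sum_le_sum fun x _ => Nat.sub_le _ _
    simp only [Finset.sum_const, Finset.card_range, smul_eq_mul] at this
    have h' : s₂.nat rCont 0 = 1 := by simp [hs₂]
    simp only [h']
    omega
  · intro s' hf hI ht
    simp only [Test.holds_natEq, NatExp.eval, NatExp.eval_var] at ht
    obtain ⟨-, hI | hI⟩ := hI
    · omega
    obtain ⟨hc, hfl, hm, hI⟩ := hI
    refine wp_mono (wp_searchStep (by rw [hf.nat rV (by decide), e₂ rV (by decide), hV])
      (by omega) (by rw [hf.nat rAdj (by decide), e₂ rAdj (by decide)]; exact hA) hsymm hfl hc hI)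
      fun s'' hf' h => ?_
    rcases h with ⟨h₁, h₂, h₃⟩ | ⟨h₁, h₂, h₃, h₄, h₅, a, ha, h₆, h₇⟩
    · refine ⟨⟨by rw [h₂]; exact hI.root, .inl ⟨h₁, h₃⟩⟩, ?_⟩
      rw [h₁, h₂, hc]; omega
    · refine ⟨⟨h₄.root, .inr ⟨h₁, h₂, by rw [h₃, hm], h₄⟩⟩, ?_⟩
      rw [h₁, hc, add_lt_add_iff_left]
      refine Finset.sum_lt_sum (fun x hx => ?_) ⟨a, by simpa using ha, by omega⟩
      have := h₅ x (by simpa using hx)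
      omega
  · intro s' hf hI ht
    simp only [Test.holds_natEq, NatExp.eval, NatExp.eval_var] at ht
    obtain ⟨-, hI | hI⟩ := hI
    · exact hI.2
    · omega

/-- One search per root is enough: augmenting never exposes a matched vertex, so treated roots stay
matched, and a failing search rules out perfect matchings altogether. -/
theorem wp_perfectMatching {s : Memory K} {V : ℕ} {adj : ℕ → ℕ → Prop}
    (hV : s.nat rV 0 = V) (hL : 2 * V + 1 ≤ L)
    (hA : ∀ x < V, ∀ y < V, adj x y ↔ s.nat rAdj (x * V + y) ≠ 0)
    (hsymm : ∀ x y, adj x y → adj y x) :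
    wp L perfectMatching (fun s' =>
      (s'.nat rFail 0 = 0 ∧ IsMatching V adj (s'.nat rMate) ∧ ∀ x < V, s'.nat rMate x ≠ x) ∨
      (s'.nat rFail 0 = 1 ∧ ∀ M, IsMatching V adj M → ∃ x < V, M x = x)) s := by
  simp only [perfectMatching, wp_seq, wp_setVar]
  refine wp_forLoop V (fun j s' => ∀ x < j, s'.nat rMate x = x) (by omega)
    (by decide) (fun s' hf => by simp [hf.nat rV (by decide), hV]) (by simp) ?_ ?_
  · intro j s' hj hf hsj h
    simp only [wp_setNat, NatExp.eval_var]
    intro x hx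
    by_cases hxj : x = j
    · simp [hxj, hsj]
    · simp [hxj, hsj, h x (by omega)]
  intro s₁ hf₁ h₁
  have hV₁ : s₁.nat rV 0 = V := by rw [hf₁.nat rV (by decide)]; simpa using hV
  refine wp_forLoop V (fun j s' =>
      (s'.nat rFail 0 = 0 ∧ IsMatching V adj (s'.nat rMate) ∧ ∀ x < j, s'.nat rMate x ≠ x) ∨
      (s'.nat rFail 0 = 1 ∧ ∀ M, IsMatching V adj M → ∃ x < V, M x = x)) (by omega)
    (by decide) (fun s' hf => by simp [hf.nat rV (by decide), hV₁]) ?_ ?_ (fun s' _ h => h)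
  · refine .inl ⟨by simp [hf₁.nat rFail (by decide)], ?_, by simp⟩
    rw [Memory.setNat_nat_of_ne _ _ _ (by decide)]
    refine ⟨fun x hx => by rw [h₁ x hx]; exact hx, fun x hx => ?_, fun x hx h => ?_⟩
    · rw [h₁ x hx, h₁ x hx]
    · exact absurd (h₁ x hx) h
  · intro j s' hj hf hsj h
    refine wp_ite (fun ht => ?_) (fun ht => ?_)
    · simp only [Test.Holds, Test.holds_natEq, NatExp.eval, NatExp.eval_var, hsj] at ht
      obtain ⟨-, hm, hlt⟩ := h.resolve_right (by rintro ⟨h, -⟩; omega)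
      refine wp_mono (wp_search (by rw [hf.nat rV (by decide), hV₁]) hL
        (by rw [hf.nat rAdj (by decide), hf₁.nat rAdj (by decide)]; simpa using hA) hsymm ht.1 hsj hj
        hm ht.2) fun s'' hf'' h'' => ?_
      rcases h'' with ⟨k₁, k₂, k₃, k₄⟩ | ⟨k₁, k₂⟩
      · refine .inl ⟨by simpa using k₁, by simpa using k₂, fun x hx => ?_⟩
        rw [Memory.setNat_nat_of_ne _ _ _ (by decide)]
        rcases Nat.lt_succ_iff_lt_or_eq.mp hx with h | rfl
        · exact k₄ x (by omega) (hlt x h)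
        · exact k₃
      · exact .inr ⟨by simpa using k₁, k₂⟩
    · simp only [Test.Holds, Test.holds_natEq, NatExp.eval, NatExp.eval_var, hsj] at ht
      rw [wp_skip]
      rcases h with ⟨k₁, k₂, k₃⟩ | ⟨k₁, k₂⟩
      · refine .inl ⟨by simpa using k₁, by simpa using k₂, fun x hx => ?_⟩
        rw [Memory.setNat_nat_of_ne _ _ _ (by decide)]
        rcases Nat.lt_succ_iff_lt_or_eq.mp hx with h | rfl
        · exact k₃ x h
        · exact fun h => ht ⟨k₁, h⟩
      · exact .inr ⟨by simpa using k₁, k₂⟩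

end

/-! ### The approximation algorithm -/

-- Numerical arrays beyond the input: `nPW` and `nPE` hold squared weighted distances from clients
-- to suppliers and to clients, `nR` the current threshold, `nBest` the least accepted one.
notation "nPW" => (3 : ℕ)
notation "nPE" => (4 : ℕ)
notation "nR" => (5 : ℕ)
notation "nBest" => (6 : ℕ)

abbrev NatExp.numSuppliers : NatExp := .get 0 (.const 0)
abbrev NatExp.numClients : NatExp := .get 0 (.const 1)
abbrev NatExp.budget : NatExp := .get 0 (.const 2)
abbrev NatExp.dimension : NatExp := .get 0 (.const 3)

/-- The scalar variable stored in cell `0` of the numerical array `a`. -/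
def NumExp.var (a : ℕ) : NumExp := .get a (.const 0)

/-- The address of the entry `(u, x)` of a matrix with `c` columns. -/
def NatExp.address (c u x : NatExp) : NatExp := .add (.mul u c) x

/-- The difference of coordinate `rI` of client `rT` and of point `rU` in the array `src`. -/
def coordDiff (src : ℕ) : NumExp :=
  .sub (.get 1 (.address .dimension (.var rT) (.var rI)))
    (.get src (.address .dimension (.var rU) (.var rI)))

/-- For every client `v` and each of the `c` points `u` of the array `src`, add the square of the
distance of `v` and `u`, multiplied by the square of the priority of `v`, to the entry `(v, u)` of
the array `dst`. -/
def distances (src dst : ℕ) (c : NatExp) : Program :=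
  .forLoop rT .numClients <| .forLoop rU c <| .forLoop rI .dimension <|
    .setNum dst (.address c (.var rT) (.var rU))
      (.add (.get dst (.address c (.var rT) (.var rU)))
        (.mul (.mul (.get 2 (.var rT)) (.get 2 (.var rT)))
          (.mul (coordDiff src) (coordDiff src))))

/-- Find a client of largest priority among the remaining ones. -/
def pickBest : Program :=
  .seq (.setVar rBest .numClients)
    (.forLoop rJ .numClients
      (.ite (.and (.natEq (.get rRem (.var rJ)) (.const 0))
          (.or (.natEq (.var rBest) .numClients)
            (.numLe (.get 2 (.var rBest)) (.get 2 (.var rJ)))))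
        (.setVar rBest (.var rJ)) .skip))

/-- Select the client found, and remove all clients close to it. -/
def selectBest : Program :=
  .seq (.setNat rSel (.var rCnt) (.var rBest)) <|
  .seq (.setVar rCnt (.add (.var rCnt) (.const 1)))
    (.forLoop rJ .numClients
      (.ite (.numLe (.get nPE (.address .numClients (.var rJ) (.var rBest)))
          (.add (.add (.var nR) (.var nR)) (.var nR)))
        (.setNat rRem (.var rJ) (.const 1)) .skip))

def greedy : Program :=
  .seq (.forLoop rJ .numClients (.setNat rRem (.var rJ) (.const 0))) <|
  .seq (.setVar rCnt (.const 0))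
    (.forLoop rT .numClients
      (.seq pickBest (.ite (.natLt (.var rBest) .numClients) selectBest .skip)))

def coverTable : Program :=
  .forLoop rI (.var rV) <| .forLoop rJ .numSuppliers <|
    .ite (.and (.natLt (.var rI) (.var rCnt))
        (.not (.numLe (.get nPW (.address .numSuppliers (.get rSel (.var rI)) (.var rJ)))
          (.var nR))))
      (.setNat rCov (.address .numSuppliers (.var rI) (.var rJ)) (.const 0))
      (.setNat rCov (.address .numSuppliers (.var rI) (.var rJ)) (.const 1))

/-- A nonzero entry is the index of a common supplier plus one, so the table records adjacency
together with a witness; `writeOutput` undoes the shift. Later suppliers overwrite earlier ones, as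
in `lastHit`. -/
def adjTable : Program :=
  .forLoop rI (.var rV) <| .forLoop rJ (.var rV) <|
    .seq (.setNat rAdj (.entry (.var rI) (.var rJ)) (.const 0))
      (.ite (.natEq (.var rI) (.var rJ)) .skip
        (.forLoop rU .numSuppliers
          (.ite (.and
              (.natEq (.get rCov (.address .numSuppliers (.var rI) (.var rU))) (.const 1))
              (.natEq (.get rCov (.address .numSuppliers (.var rJ) (.var rU))) (.const 1)))
            (.setNat rAdj (.entry (.var rI) (.var rJ)) (.add (.var rU) (.const 1))) .skip)))

def writeOutput : Program :=
  .seq (.forLoop rJ .numSuppliers (.setNat 1 (.var rJ) (.const 0)))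
    (.forLoop rI (.var rV)
      (.setNat 1 (.sub (.get rAdj (.entry (.var rI) (.get rMate (.var rI)))) (.const 1))
        (.const 1)))

def tryThreshold : Program :=
  .seq greedy <|
  .ite (.natLe (.var rCnt) (.var rV))
    (.seq coverTable <| .seq adjTable <| .seq perfectMatching <|
      .ite (.natEq (.var rFail) (.const 0))
        (.seq writeOutput <| .seq (.setNum nBest (.const 0) (.var nR))
          (.setVar rHit (.const 1)))
        .skip)
    .skip

/-- The approximation algorithm. -/
def algorithm : Program :=
  .seq (.ite (.natLe .budget .numClients) (.setVar rV (.add .budget .budget))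
    (.setVar rV (.add .numClients .numClients))) <|
  .seq (distances 0 nPW .numSuppliers) <|
  .seq (distances 1 nPE .numClients)
    (.forLoop rCand (.mul .numClients .numSuppliers)
      (.seq (.setNum nR (.const 0) (.get nPW (.var rCand)))
        (.ite (.or (.natEq (.var rHit) (.const 0)) (.not (.numLe (.var nBest) (.var nR))))
          tryThreshold .skip)))

theorem algorithm_tame : algorithm.Tame = true := by decide

/-! ### Verification of the distance tables and of the greedy selection. -/

section

variable {K : Type} [Ring K] [LinearOrder K] {L : ℕ}

@[simp] theorem NumExp.eval_var (s : Memory K) (a : ℕ) : (NumExp.var a).eval s = s.num a 0 := rfl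

@[simp] theorem NatExp.eval_address (s : Memory K) (c u x : NatExp) :
    (NatExp.address c u x).eval s = u.eval s * c.eval s + x.eval s := rfl

/-- The sums are accumulated in the table itself, which must therefore start at zero. In each
assignment the old entry is the only operand outside the input, as tameness demands. -/
theorem wp_distances {s : Memory K} {src dst cell n c d : ℕ} (hsrc : src < 3) (hdst : 3 ≤ dst)
    (hn : s.nat 0 1 = n) (hc : s.nat 0 cell = c) (hd : s.nat 0 3 = d) (hnL : n ≤ L) (hcL : c ≤ L)
    (hdL : d ≤ L) (h₀ : ∀ j, s.num dst j = 0) :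
    wp L (distances src dst (.get 0 (.const cell))) (fun s' => ∀ v < n, ∀ u < c,
      s'.num dst (v * c + u) = ∑ i ∈ Finset.range d, (s.num 2 v * s.num 2 v) *
        ((s.num 1 (v * d + i) - s.num src (u * d + i)) *
          (s.num 1 (v * d + i) - s.num src (u * d + i)))) s := by
  set part : ℕ → ℕ → ℕ → K := fun i v u => ∑ i ∈ Finset.range i, (s.num 2 v * s.num 2 v) *
        ((s.num 1 (v * d + i) - s.num src (u * d + i)) *
          (s.num 1 (v * d + i) - s.num src (u * d + i))) with hpart
  rw [distances]
  refine wp_forLoop n (fun v s' => ∀ v', ∀ u' < c, s'.num dst (v' * c + u') =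
    if v' < v then part d v' u' else 0) hnL (by simp [Program.natWrites])
    (fun s' hf => by simp [hf.nat 0 (by simp [Program.natWrites]), hn]) (by simp [h₀]) ?_ ?_
  · intro v s₁ hv hf₁ hsv h₁
    have a₁ : ∀ a, a < 3 → s₁.num a = s.num a := fun a ha => hf₁.num a (by
      simp [Program.numWrites]; omega)
    have b₁ : s₁.nat 0 = s.nat 0 := hf₁.nat 0 (by simp [Program.natWrites])
    refine wp_forLoop c (fun u s' => ∀ v', ∀ u' < c, s'.num dst (v' * c + u') =
      if v' < v ∨ (v' = v ∧ u' < u) then part d v' u' else 0) hcL (by simp [Program.natWrites])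
      (fun s' hf => by simp [hf.nat 0 (by simp [Program.natWrites]), b₁, hc]) (by simpa using h₁) ?_ ?_
    · intro u s₂ hu hf₂ hsu h₂
      have a₂ : ∀ a, a < 3 → s₂.num a = s.num a := fun a ha => by
        rw [hf₂.num a (by simp [Program.numWrites]; omega), a₁ a ha]
      have b₂ : s₂.nat 0 = s.nat 0 := by rw [hf₂.nat 0 (by simp [Program.natWrites]), b₁]
      have c₂ : s₂.nat rT 0 = v := by rw [hf₂.nat rT (by simp [Program.natWrites]), hsv]
      refine wp_forLoop d (fun i s' => ∀ v', ∀ u' < c, s'.num dst (v' * c + u') =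
        if v' < v ∨ (v' = v ∧ u' < u) then part d v' u' else
          if v' = v ∧ u' = u then part i v' u' else 0) hdL (by simp [Program.natWrites])
        (fun s' hf => by simp [hf.nat 0 (by simp [Program.natWrites]), b₂, hd]) ?_ ?_ ?_
      · intro v' u' hu'
        simp only [Memory.setNat_num, h₂ v' u' hu', hpart, Finset.range_zero, Finset.sum_empty,
          ite_self]
      · intro i s₃ hi hf₃ hsi h₃
        have a₃ : ∀ a, a < 3 → s₃.num a = s.num a := fun a ha => by
          rw [hf₃.num a (by simp [Program.numWrites]; omega), a₂ a ha]
        have b₃ : s₃.nat 0 = s.nat 0 := by rw [hf₃.nat 0 (by simp [Program.natWrites]), b₂]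
        have c₃ : s₃.nat rT 0 = v := by rw [hf₃.nat rT (by simp [Program.natWrites]), c₂]
        have d₃ : s₃.nat rU 0 = u := by rw [hf₃.nat rU (by simp [Program.natWrites]), hsu]
        rw [wp_setNum]
        intro v' u' hu'
        simp only [Memory.setNat_num, Memory.setNum_num, NatExp.eval_address, NatExp.eval_var, c₃,
          d₃, NatExp.eval, b₃, hc, mul_add_inj hu' hu, true_and, NumExp.eval, coordDiff, hsi, hd,
          a₃ 1 (by omega), a₃ 2 (by omega), a₃ src hsrc]
        by_cases h : v' = v ∧ u' = u
        · obtain ⟨rfl, rfl⟩ := h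
          rw [h₃ v' u' hu']
          simp [hpart, Finset.sum_range_succ]
        · simp only [h₃ v' u' hu', h, if_false]
      · intro s₃ hf₃ h₃ v' u' hu'
        simp only [Memory.setNat_num, h₃ v' u' hu']
        by_cases h : v' = v ∧ u' = u
        · obtain ⟨rfl, rfl⟩ := h
          simp
        · have : (v' < v ∨ v' = v ∧ u' < u + 1) ↔ (v' < v ∨ v' = v ∧ u' < u) := by omega
          simp only [h, if_false, this]
    · intro s₂ hf₂ h₂ v' u' hu'
      simp only [Memory.setNat_num, h₂ v' u' hu']
      have : (v' < v ∨ v' = v ∧ u' < c) ↔ v' < v + 1 := by omega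
      simp only [this]
  · intro s₁ hf₁ h₁ v hv u hu
    rw [h₁ v u hu, if_pos hv]

/-- The clients `sel 0`, …, `sel (cnt - 1)`, listed by decreasing priority, are far from each other,
and every client is close to a selected client whose priority is not smaller. -/
structure IsGreedy (n : ℕ) (p : ℕ → K) (PE : ℕ → ℕ → K) (R : K) (cnt : ℕ) (sel : ℕ → ℕ) : Prop where
  lt : ∀ i < cnt, sel i < n
  mono : ∀ j < cnt, ∀ i < j, p (sel j) ≤ p (sel i)
  far : ∀ j < cnt, ∀ i < j, R < PE (sel j) (sel i)
  close : ∀ w < n, ∃ i < cnt, p w ≤ p (sel i) ∧ PE w (sel i) ≤ R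

/-- The value `n`, which is no client, signals that nobody remains. -/
theorem wp_pickBest {s : Memory K} {n : ℕ} (hn : s.nat 0 1 = n) (hL : n ≤ L) :
    wp L pickBest (fun s' =>
      (s'.nat rBest 0 = n ∧ ∀ v < n, s.nat rRem v ≠ 0) ∨
      (s'.nat rBest 0 < n ∧ s.nat rRem (s'.nat rBest 0) = 0 ∧
        ∀ v < n, s.nat rRem v = 0 → s.num 2 v ≤ s.num 2 (s'.nat rBest 0))) s := by
  simp only [pickBest, wp_seq, wp_setVar, NatExp.eval, hn]
  refine wp_forLoop n (fun j s' =>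
      (s'.nat rBest 0 = n ∧ ∀ v < j, s.nat rRem v ≠ 0) ∨
      (s'.nat rBest 0 < n ∧ s.nat rRem (s'.nat rBest 0) = 0 ∧
        ∀ v < j, s.nat rRem v = 0 → s.num 2 v ≤ s.num 2 (s'.nat rBest 0))) hL (by decide)
    (fun s' hf => by simp [hf.nat 0 (by decide), hn]) (by simp) ?_ (fun s' _ h => h)
  intro j s' hj hf hsj h
  have e₁ : s'.nat rRem = s.nat rRem := by simp [hf.nat rRem (by decide)]
  have e₂ : s'.num 2 = s.num 2 := by simp [hf.num 2 (by decide)]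
  have e₃ : s'.nat 0 1 = n := by simp [hf.nat 0 (by decide), hn]
  refine wp_ite (fun ht => ?_) (fun ht => ?_)
  · simp only [Test.Holds, Test.holds_natEq, Test.holds_or, NatExp.eval, NatExp.eval_var,
      NumExp.eval, hsj, e₁, e₂, e₃] at ht
    simp only [wp_setVar, NatExp.eval_var, hsj]
    refine .inr ⟨by simpa using hj, by simpa using ht.1, fun v hv hrem => ?_⟩
    rw [Memory.setNat_nat_of_ne _ _ _ (by decide), Memory.setNat_nat, if_pos ⟨rfl, rfl⟩]
    rcases Nat.lt_succ_iff_lt_or_eq.mp hv with hv | rfl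
    · rcases h with ⟨k₁, k₂⟩ | ⟨k₁, k₂, k₃⟩
      · exact absurd hrem (k₂ v hv)
      · exact (k₃ v hv hrem).trans (ht.2.resolve_left (by omega))
    · exact le_rfl
  · simp only [Test.Holds, Test.holds_natEq, Test.holds_or, NatExp.eval, NatExp.eval_var,
      NumExp.eval, hsj, e₁, e₂, e₃, not_and, not_or, not_le] at ht
    rw [wp_skip]
    rw [Memory.setNat_nat_of_ne _ _ _ (by decide)]
    rcases h with ⟨k₁, k₂⟩ | ⟨k₁, k₂, k₃⟩
    · refine .inl ⟨k₁, fun v hv => ?_⟩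
      rcases Nat.lt_succ_iff_lt_or_eq.mp hv with hv | rfl
      · exact k₂ v hv
      · exact fun h => (ht h).1 k₁
    · refine .inr ⟨k₁, k₂, fun v hv hrem => ?_⟩
      rcases Nat.lt_succ_iff_lt_or_eq.mp hv with hv | rfl
      · exact k₃ v hv hrem
      · exact (ht hrem).2.le

theorem wp_selectBest {s : Memory K} {n v : ℕ} (hn : s.nat 0 1 = n) (hL : n ≤ L)
    (hv : s.nat rBest 0 = v) :
    wp L selectBest (fun s' =>
      s'.nat rCnt 0 = s.nat rCnt 0 + 1 ∧
      (∀ i, s'.nat rSel i = if i = s.nat rCnt 0 then v else s.nat rSel i) ∧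
      (∀ w < n, s'.nat rRem w = if s.num nPE (w * n + v) ≤ s.num nR 0 + s.num nR 0 + s.num nR 0
        then 1 else s.nat rRem w)) s := by
  simp only [selectBest, wp_seq, wp_setNat, wp_setVar, NatExp.eval, NatExp.eval_var, hv]
  set s₁ := s.setNat rSel (s.nat rCnt 0) v with hs₁
  set s₂ := s₁.setNat rCnt 0 (s₁.nat rCnt 0 + 1) with hs₂
  refine wp_forLoop n (fun j s' => ∀ w < n, s'.nat rRem w =
    if w < j ∧ s.num nPE (w * n + v) ≤ s.num nR 0 + s.num nR 0 + s.num nR 0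
        then 1 else s.nat rRem w) hL (by decide)
    (fun s' hf => by simp [hf.nat 0 (by decide), hs₂, hs₁, hn]) (by simp [hs₁, hs₂]) ?_ ?_
  · intro j s' hj hf hsj h
    have e₁ : s'.num nPE = s.num nPE := hf.num nPE (by decide)
    have e₂ : s'.num nR = s.num nR := hf.num nR (by decide)
    have e₃ : s'.nat 0 1 = n := by simp [hf.nat 0 (by decide), hs₂, hs₁, hn]
    have e₄ : s'.nat rBest 0 = v := by simp [hf.nat rBest (by decide), hs₂, hs₁, hv]
    have hlt : ∀ x, x ≠ j → (x < j + 1 ↔ x < j) := fun x hx => by omega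
    refine wp_ite (fun ht => ?_) (fun ht => ?_)
    · simp only [Test.Holds, NatExp.eval, NatExp.eval_var, NatExp.eval_address, NumExp.eval,
        NumExp.eval_var, hsj, e₁, e₂, e₃, e₄] at ht
      rw [wp_setNat]
      intro w hw
      by_cases hwj : w = j
      · simp [hwj, hsj, ht]
      · simp [hwj, hsj, hlt w hwj, h w hw]
    · simp only [Test.Holds, NatExp.eval, NatExp.eval_var, NatExp.eval_address, NumExp.eval,
        NumExp.eval_var, hsj, e₁, e₂, e₃, e₄] at ht
      rw [wp_skip]
      intro w hw
      by_cases hwj : w = j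
      · subst hwj; simp [h w hw, ht]
      · simp [hlt w hwj, h w hw]
  · intro s' hf h
    refine ⟨?_, fun i => ?_, fun w hw => ?_⟩
    · simp [hf.nat rCnt (by decide), hs₂, hs₁]
    · simp [hf.nat rSel (by decide), hs₂, hs₁]
    · rw [h w hw]; simp only [hw, true_and]

/-- By `hdiag` a selected client removes itself, so `n` rounds exhaust the clients. This is a
hypothesis because the order of `K` is not assumed to be compatible with its ring structure. -/
theorem wp_greedy {s : Memory K} {n : ℕ} (hn : s.nat 0 1 = n) (hL : n ≤ L)
    (hdiag : ∀ v < n, s.num nPE (v * n + v) ≤ s.num nR 0 + s.num nR 0 + s.num nR 0) :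
    wp L greedy (fun s' => IsGreedy n (s.num 2) (fun w v => s.num nPE (w * n + v))
      (s.num nR 0 + s.num nR 0 + s.num nR 0) (s'.nat rCnt 0) (s'.nat rSel)) s := by
  set p := s.num 2 with hp
  set PE : ℕ → ℕ → K := fun w v => s.num nPE (w * n + v) with hPE
  set R := s.num nR 0 + s.num nR 0 + s.num nR 0 with hR
  rw [greedy, wp_seq]
  refine wp_forLoop n (fun j s' => ∀ x < j, s'.nat rRem x = 0) hL (by decide)
    (fun s' hf => by simp [hf.nat 0 (by decide), hn]) (by simp) ?_ ?_
  · intro j s' hj hf hsj h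
    rw [wp_setNat]
    intro x hx
    by_cases hxj : x = j
    · simp [hxj, hsj]
    · simp [hxj, hsj, h x (by omega)]
  intro s₁ hf₁ h₁
  simp only [wp_seq, wp_setVar, NatExp.eval]
  -- The fourth clause, that remaining clients are far from all selected ones and have no larger
  -- priority, yields `mono` and `far` for the next selection. The last clause leaves nobody after
  -- `n` rounds.
  refine wp_forLoop n (fun t s' =>
    (∀ i < s'.nat rCnt 0, s'.nat rSel i < n) ∧
    (∀ j < s'.nat rCnt 0, ∀ i < j, p (s'.nat rSel j) ≤ p (s'.nat rSel i) ∧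
      R < PE (s'.nat rSel j) (s'.nat rSel i)) ∧
    (∀ w < n, s'.nat rRem w ≠ 0 → ∃ i < s'.nat rCnt 0, p w ≤ p (s'.nat rSel i) ∧
      PE w (s'.nat rSel i) ≤ R) ∧
    (∀ w < n, s'.nat rRem w = 0 → ∀ i < s'.nat rCnt 0, p w ≤ p (s'.nat rSel i) ∧
      R < PE w (s'.nat rSel i)) ∧
    ((Finset.range n).filter fun w => s'.nat rRem w = 0).card + t ≤ n) hL (by decide)
    (fun s' hf => by simp [hf.nat 0 (by decide), hf₁.nat 0 (by decide), hn]) ?_ ?_ ?_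
  · refine ⟨by simp, by simp, fun w hw h => absurd ?_ h, by simp, ?_⟩
    · simpa using h₁ w hw
    · simpa using Finset.card_filter_le (Finset.range n) _
  · intro t s₂ ht hf₂ hst h₂
    have g₂ : ∀ c, c ∉ [rJ, rRem, rCnt, rT, rBest, rSel] → s₂.nat c = s.nat c := by
      intro c hc
      simp only [List.mem_cons, List.not_mem_nil, or_false, not_or] at hc
      rw [hf₂.nat c, Memory.setNat_nat_of_ne _ _ _ hc.2.2.1, hf₁.nat c]
      · simp [Program.natWrites]; tauto
      · simp [Program.natWrites, pickBest, selectBest, Program.setVar]; tauto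
    have g₂' : ∀ c, s₂.num c = s.num c := by
      intro c
      rw [hf₂.num c, Memory.setNat_num, hf₁.num c]
      · simp [Program.numWrites]
      · simp [Program.numWrites, pickBest, selectBest, Program.setVar]
    obtain ⟨k₁, k₂, k₃, k₄, k₅⟩ := h₂
    have hn₂ : s₂.nat 0 1 = n := by rw [g₂ 0 (by decide), hn]
    rw [wp_seq]
    refine wp_mono (wp_pickBest hn₂ hL) fun s₃ hf₃ h₃ => ?_
    have e₁ : s₃.nat rRem = s₂.nat rRem := hf₃.nat rRem (by decide)
    have e₂ : s₃.nat rSel = s₂.nat rSel := hf₃.nat rSel (by decide)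
    have e₃ : s₃.nat rCnt = s₂.nat rCnt := hf₃.nat rCnt (by decide)
    have e₄ : s₃.nat 0 1 = n := by rw [hf₃.nat 0 (by decide), hn₂]
    rw [g₂' 2] at h₃
    refine wp_ite (fun ht => ?_) (fun ht => ?_)
    · simp only [Test.holds_natLt, NatExp.eval_var, NatExp.eval, e₄] at ht
      obtain ⟨-, hrem, hmax⟩ := h₃.resolve_left (by rintro ⟨h, -⟩; omega)
      set v := s₃.nat rBest 0 with hv
      refine wp_mono (wp_selectBest e₄ hL hv.symm) fun s₄ hf₄ h₄ => ?_
      rw [e₁, e₂, e₃, hf₃.num nPE (by decide), hf₃.num nR (by decide), g₂' nPE, g₂' nR, ← hR] at h₄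
      obtain ⟨l₁, l₂, l₃⟩ := h₄
      set cnt := s₂.nat rCnt 0 with hcnt
      have hsel : ∀ i < cnt, s₄.nat rSel i = s₂.nat rSel i := fun i hi => by
        rw [l₂ i, if_neg (by omega)]
      have hselc : s₄.nat rSel cnt = v := by rw [l₂, if_pos rfl]
      have hremv : s₄.nat rRem v = 1 := by rw [l₃ v ht, if_pos (hdiag v ht)]
      rw [Memory.setNat_nat_of_ne _ _ _ (by decide), Memory.setNat_nat_of_ne _ _ _ (by decide),
        Memory.setNat_nat_of_ne _ _ _ (by decide), l₁]
      refine ⟨fun i hi => ?_, fun j hj i hi => ?_, fun w hw h => ?_, fun w hw h i hi => ?_, ?_⟩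
      · rcases Nat.lt_succ_iff_lt_or_eq.mp hi with hi | rfl
        · rw [hsel i hi]; exact k₁ i hi
        · rw [hselc]; exact ht
      · rcases Nat.lt_succ_iff_lt_or_eq.mp hj with hj | rfl
        · rw [hsel j hj, hsel i (by omega)]; exact k₂ j hj i hi
        · rw [hselc, hsel i hi]; exact k₄ v ht hrem i hi
      · by_cases hw' : s₂.nat rRem w = 0
        · rw [l₃ w hw] at h
          split_ifs at h with h'
          · exact ⟨cnt, by omega, by rw [hselc]; exact hmax w hw hw', by rw [hselc]; exact h'⟩
          · exact absurd hw' h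
        · obtain ⟨i, hi, h'⟩ := k₃ w hw hw'
          exact ⟨i, by omega, by rw [hsel i hi]; exact h'⟩
      · rw [l₃ w hw] at h
        split_ifs at h with h'
        rcases Nat.lt_succ_iff_lt_or_eq.mp hi with hi | rfl
        · rw [hsel i hi]; exact k₄ w hw h i hi
        · rw [hselc]; exact ⟨hmax w hw h, not_le.mp h'⟩
      · have : ((Finset.range n).filter fun w => s₄.nat rRem w = 0).card <
            ((Finset.range n).filter fun w => s₂.nat rRem w = 0).card := by
          refine Finset.card_lt_card ?_
          rw [Finset.ssubset_iff_of_subset]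
          · exact ⟨v, by simp [ht, hrem], by simp [hremv]⟩
          · intro w
            simp only [Finset.mem_filter, Finset.mem_range]
            rintro ⟨hw, h⟩
            rw [l₃ w hw] at h
            split_ifs at h with h'
            exact ⟨hw, h⟩
        omega
    · simp only [Test.holds_natLt, NatExp.eval_var, NatExp.eval, e₄] at ht
      have h₃ := (h₃.resolve_right (by rintro ⟨h, -⟩; omega)).2
      rw [wp_skip, Memory.setNat_nat_of_ne _ _ _ (by decide),
        Memory.setNat_nat_of_ne _ _ _ (by decide), Memory.setNat_nat_of_ne _ _ _ (by decide),
        e₁, e₂, e₃]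
      refine ⟨k₁, k₂, k₃, k₄, ?_⟩
      have : ((Finset.range n).filter fun w => s₂.nat rRem w = 0) = ∅ := by
        rw [Finset.filter_eq_empty_iff]
        intro w hw
        exact h₃ w (by simpa using hw)
      rw [this, Finset.card_empty]
      omega
  · intro s₂ hf₂ h₂
    obtain ⟨k₁, k₂, k₃, k₄, k₅⟩ := h₂
    refine ⟨k₁, fun j hj i hi => (k₂ j hj i hi).1, fun j hj i hi => (k₂ j hj i hi).2,
      fun w hw => k₃ w hw fun h => ?_⟩
    have : ((Finset.range n).filter fun w => s₂.nat rRem w = 0) = ∅ :=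
      Finset.card_eq_zero.mp (by omega)
    rw [Finset.filter_eq_empty_iff] at this
    exact this (by simpa using hw) h

end

/-! ### Common suppliers of two vertices. -/

open Classical in
/-- The successor of the largest number below `m` with the property `P`, and `0` if there is none. -/
noncomputable def lastHit (P : ℕ → Prop) : ℕ → ℕ
  | 0 => 0
  | m + 1 => if P m then m + 1 else lastHit P m

theorem lastHit_spec {P : ℕ → Prop} {m u : ℕ} (h : lastHit P m = u + 1) : u < m ∧ P u := by
  induction m with
  | zero => simp [lastHit] at h
  | succ m ih =>
    rw [lastHit] at h
    split_ifs at h with hm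
    · obtain rfl : m = u := by omega
      exact ⟨by omega, hm⟩
    · exact ⟨by have := (ih h).1; omega, (ih h).2⟩

theorem lastHit_ne_zero {P : ℕ → Prop} {m : ℕ} : lastHit P m ≠ 0 ↔ ∃ u < m, P u := by
  constructor
  · intro h
    obtain ⟨u, hu⟩ := Nat.exists_eq_succ_of_ne_zero h
    exact ⟨u, lastHit_spec hu⟩
  · rintro ⟨u, hu, h⟩
    induction m with
    | zero => omega
    | succ m ih =>
      rw [lastHit]
      split_ifs with hm
      · omega
      · refine ih (lt_of_le_of_ne (by omega) ?_)
        rintro rfl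
        exact hm h

theorem lastHit_congr {P P' : ℕ → Prop} {m : ℕ} (h : ∀ u < m, P u ↔ P' u) :
    lastHit P m = lastHit P' m := by
  induction m with
  | zero => rfl
  | succ m ih =>
    rw [lastHit, lastHit, ih fun u hu => h u (by omega)]
    by_cases hP : P m
    · rw [if_pos hP, if_pos ((h m (by omega)).mp hP)]
    · rw [if_neg hP, if_neg (mt (h m (by omega)).mpr hP)]

/-- Two vertices are adjacent if some supplier covers both. -/
def CommonCover (m : ℕ) (C : ℕ → ℕ → Prop) (i j : ℕ) : Prop := i ≠ j ∧ ∃ u < m, C i u ∧ C j u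

theorem CommonCover.symm {m : ℕ} {C : ℕ → ℕ → Prop} {i j : ℕ} (h : CommonCover m C i j) :
    CommonCover m C j i :=
  ⟨h.1.symm, h.2.imp fun _ h => ⟨h.1, h.2.symm⟩⟩

/-! ### Verification of the graph construction and of the loop over thresholds. -/

section

variable {K : Type} [Ring K] [LinearOrder K] {L : ℕ}

/-- Supplier `u` covers vertex `i`: the vertices `i < cnt` are the selected clients, the others are
dummies that are covered by every supplier. -/
def Covers (PW : ℕ → ℕ → K) (R : K) (cnt : ℕ) (sel : ℕ → ℕ) (i u : ℕ) : Prop :=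
  cnt ≤ i ∨ PW (sel i) u ≤ R

theorem wp_coverTable {s : Memory K} {V m : ℕ} (hV : s.nat rV 0 = V) (hm : s.nat 0 0 = m)
    (hVL : V ≤ L) (hmL : m ≤ L) :
    wp L coverTable (fun s' => ∀ i < V, ∀ u < m, s'.nat rCov (i * m + u) = 1 ↔
      Covers (fun v u => s.num nPW (v * m + u)) (s.num nR 0) (s.nat rCnt 0) (s.nat rSel) i u) s := by
  set C := Covers (fun v u => s.num nPW (v * m + u)) (s.num nR 0) (s.nat rCnt 0) (s.nat rSel)
    with hC
  rw [coverTable]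
  refine wp_forLoop V (fun i s' => ∀ i' < i, ∀ u < m, s'.nat rCov (i' * m + u) = 1 ↔ C i' u)
    hVL (by decide) (fun s' hf => by simp [hf.nat rV (by decide), hV]) (by simp) ?_
    (fun s' _ h => h)
  intro i s₁ hi hf₁ hsi h₁
  refine wp_forLoop m (fun j s' => ∀ i' ≤ i, ∀ u < m, i' < i ∨ u < j →
      (s'.nat rCov (i' * m + u) = 1 ↔ C i' u))
    hmL (by decide) (fun s' hf => by simp [hf.nat 0 (by decide), hf₁.nat 0 (by decide), hm]) ?_ ?_ ?_
  · intro i' hi' u hu h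
    rw [Memory.setNat_nat_of_ne _ _ _ (by decide)]
    exact h₁ i' (by omega) u hu
  · intro j s₂ hj hf₂ hsj h₂
    have e₁ : s₂.nat rI 0 = i := by rw [hf₂.nat rI (by decide), hsi]
    have e₂ : s₂.nat 0 0 = m := by rw [hf₂.nat 0 (by decide), hf₁.nat 0 (by decide), hm]
    have htest : (Test.and (.natLt (.var rI) (.var rCnt))
        (.not (.numLe (.get nPW (.address .numSuppliers (.get rSel (.var rI)) (.var rJ)))
          (.var nR)))).Holds s₂ ↔ ¬ C i j := by
      simp [hC, Covers, e₁, e₂, hsj, hf₂.nat rCnt (by decide), hf₁.nat rCnt (by decide),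
        hf₂.nat rSel (by decide), hf₁.nat rSel (by decide), hf₂.num nPW (by decide),
        hf₁.num nPW (by decide), hf₂.num nR (by decide), hf₁.num nR (by decide)]
    refine wp_ite (fun ht => ?_) (fun ht => ?_)
    all_goals
      rw [htest] at ht
      rw [wp_setNat]
      intro i' hi' u hu h
      rw [Memory.setNat_nat_of_ne _ _ _ (by decide), Memory.setNat_nat]
      simp only [NatExp.eval_address, NatExp.eval_var, NatExp.eval, e₁, e₂, hsj,
        mul_add_inj hu hj, true_and]
      by_cases hc : i' = i ∧ u = j
      · obtain ⟨rfl, rfl⟩ := hc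
        simp only [and_self, if_true]
        simpa using ht
      · rw [if_neg hc]
        exact h₂ i' hi' u hu (by omega)
  · intro s₂ hf₂ h₂ i' hi' u hu
    rw [Memory.setNat_nat_of_ne _ _ _ (by decide)]
    exact h₂ i' (by omega) u hu (.inr hu)

theorem wp_adjTable {s : Memory K} {V m : ℕ} (hV : s.nat rV 0 = V) (hm : s.nat 0 0 = m)
    (hVL : V ≤ L) (hmL : m ≤ L) :
    wp L adjTable (fun s' => ∀ i < V, ∀ j < V, s'.nat rAdj (i * V + j) = if i = j then 0 else
      lastHit (fun u => s.nat rCov (i * m + u) = 1 ∧ s.nat rCov (j * m + u) = 1) m) s := by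
  set F : ℕ → ℕ → ℕ → ℕ := fun i j t =>
    lastHit (fun u => s.nat rCov (i * m + u) = 1 ∧ s.nat rCov (j * m + u) = 1) t with hF
  rw [adjTable]
  refine wp_forLoop V (fun i s' => ∀ i' < i, ∀ j < V, s'.nat rAdj (i' * V + j) =
    if i' = j then 0 else F i' j m)
    hVL (by decide) (fun s' hf => by simp [hf.nat rV (by decide), hV]) (by simp) ?_
    (fun s' _ h => h)
  intro i s₁ hi hf₁ hsi h₁
  refine wp_forLoop V (fun j s' => ∀ i' ≤ i, ∀ j' < V, i' < i ∨ j' < j →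
      s'.nat rAdj (i' * V + j') = if i' = j' then 0 else F i' j' m)
    hVL (by decide) (fun s' hf => by simp [hf.nat rV (by decide), hf₁.nat rV (by decide), hV])
    ?_ ?_ ?_
  · intro i' hi' u hu h
    rw [Memory.setNat_nat_of_ne _ _ _ (by decide)]
    exact h₁ i' (by omega) u hu
  · intro j s₂ hj hf₂ hsj h₂
    have e₁ : s₂.nat rI 0 = i := by rw [hf₂.nat rI (by decide), hsi]
    have e₂ : s₂.nat rV 0 = V := by rw [hf₂.nat rV (by decide), hf₁.nat rV (by decide), hV]
    have e₃ : s₂.nat 0 0 = m := by rw [hf₂.nat 0 (by decide), hf₁.nat 0 (by decide), hm]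
    have e₄ : s₂.nat rCov = s.nat rCov := by
      rw [hf₂.nat rCov (by decide), hf₁.nat rCov (by decide)]
    rw [wp_seq, wp_setNat]
    simp only [NatExp.eval_entry, NatExp.eval_var, NatExp.eval, e₁, e₂, hsj]
    set s₃ := s₂.setNat rAdj (i * V + j) 0 with hs₃
    have h₃ : ∀ i' ≤ i, ∀ j' < V, i' < i ∨ j' < j →
        s₃.nat rAdj (i' * V + j') = if i' = j' then 0 else F i' j' m := by
      intro i' hi' j' hj' h
      rw [hs₃, Memory.setNat_nat]
      simp only [mul_add_inj hj' hj, true_and]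
      rw [if_neg (by omega)]
      exact h₂ i' hi' j' hj' h
    have h₃' : s₃.nat rAdj (i * V + j) = 0 := by simp [hs₃]
    have f₁ : s₃.nat rI 0 = i := by simp [hs₃, e₁]
    have f₂ : s₃.nat rJ 0 = j := by simp [hs₃, hsj]
    have f₃ : s₃.nat rV 0 = V := by simp [hs₃, e₂]
    have f₄ : s₃.nat 0 0 = m := by simp [hs₃, e₃]
    have f₅ : s₃.nat rCov = s.nat rCov := by simp [hs₃, e₄]
    refine wp_ite (fun ht => ?_) (fun ht => ?_)
    · simp only [Test.holds_natEq, NatExp.eval_var, f₁, f₂] at ht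
      rw [wp_skip]
      intro i' hi' j' hj' h
      rw [Memory.setNat_nat_of_ne _ _ _ (by decide)]
      by_cases hc : i' < i ∨ j' < j
      · exact h₃ i' hi' j' hj' hc
      · obtain ⟨rfl, rfl⟩ : i' = i ∧ j' = j := by omega
        rw [h₃', if_pos ht]
    · simp only [Test.holds_natEq, NatExp.eval_var, f₁, f₂] at ht
      refine wp_forLoop m (fun t s' => s'.nat rAdj (i * V + j) = F i j t ∧
        ∀ i' ≤ i, ∀ j' < V, i' < i ∨ j' < j →
          s'.nat rAdj (i' * V + j') = if i' = j' then 0 else F i' j' m) hmL (by decide)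
        (fun s' hf => by simp [hf.nat 0 (by decide), f₄])
        (by simpa [h₃', hF, lastHit] using h₃) ?_ ?_
      · intro t s₄ ht' hf₄ hst h₄
        have g₁ : s₄.nat rI 0 = i := by rw [hf₄.nat rI (by decide), f₁]
        have g₂ : s₄.nat rJ 0 = j := by rw [hf₄.nat rJ (by decide), f₂]
        have g₃ : s₄.nat rV 0 = V := by rw [hf₄.nat rV (by decide), f₃]
        have htest : (Test.and
              (.natEq (.get rCov (.address .numSuppliers (.var rI) (.var rU))) (.const 1))
              (.natEq (.get rCov (.address .numSuppliers (.var rJ) (.var rU)))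
                (.const 1))).Holds s₄ ↔
            (s.nat rCov (i * m + t) = 1 ∧ s.nat rCov (j * m + t) = 1) := by
          simp [g₁, g₂, hst, hf₄.nat 0 (by decide), f₄, hf₄.nat rCov (by decide), f₅]
        refine wp_ite (fun hb => ?_) (fun hb => ?_)
        · rw [htest] at hb
          simp only [wp_setNat, NatExp.eval_entry, NatExp.eval_var, NatExp.eval, g₁, g₂, g₃, hst]
          rw [Memory.setNat_nat_of_ne _ _ _ (by decide)]
          refine ⟨by simp [hF, lastHit, hb], fun i' hi' j' hj' h => ?_⟩
          rw [Memory.setNat_nat]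
          simp only [mul_add_inj hj' hj, true_and]
          rw [if_neg (by omega)]
          exact h₄.2 i' hi' j' hj' h
        · rw [htest] at hb
          rw [wp_skip, Memory.setNat_nat_of_ne _ _ _ (by decide)]
          refine ⟨?_, h₄.2⟩
          rw [h₄.1, hF]
          simp only [lastHit, hb, if_false]
      · intro s₄ hf₄ h₄ i' hi' j' hj' h
        rw [Memory.setNat_nat_of_ne _ _ _ (by decide)]
        by_cases hc : i' < i ∨ j' < j
        · exact h₄.2 i' hi' j' hj' hc
        · obtain ⟨rfl, rfl⟩ : i' = i ∧ j' = j := by omega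
          rw [h₄.1, if_neg ht]
  · intro s₂ hf₂ h₂ i' hi' j hj
    rw [Memory.setNat_nat_of_ne _ _ _ (by decide)]
    exact h₂ i' (by omega) j hj (.inr hj)

theorem wp_writeOutput {s : Memory K} {V m : ℕ} (hV : s.nat rV 0 = V) (hm : s.nat 0 0 = m)
    (hVL : V ≤ L) (hmL : m ≤ L) :
    wp L writeOutput (fun s' => ∀ u < m, s'.nat 1 u ≠ 0 ↔
      ∃ i < V, s.nat rAdj (i * V + s.nat rMate i) - 1 = u) s := by
  rw [writeOutput, wp_seq]
  refine wp_forLoop m (fun j s' => ∀ x < j, s'.nat 1 x = 0) hmL (by decide)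
    (fun s' hf => by simp [hf.nat 0 (by decide), hm]) (by simp) ?_ ?_
  · intro j s' hj hf hsj h
    rw [wp_setNat]
    intro x hx
    by_cases hxj : x = j
    · simp [hxj, hsj]
    · simp [hxj, hsj, h x (by omega)]
  intro s₁ hf₁ h₁
  refine wp_forLoop V (fun j s' => ∀ u < m, s'.nat 1 u ≠ 0 ↔
      ∃ i < j, s.nat rAdj (i * V + s.nat rMate i) - 1 = u) hVL (by decide)
    (fun s' hf => by simp [hf.nat rV (by decide), hf₁.nat rV (by decide), hV]) ?_ ?_
    (fun s' _ h => h)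
  · intro u hu
    simp [h₁ u hu]
  · intro j s₂ hj hf₂ hsj h₂
    rw [wp_setNat]
    intro u hu
    have e : s₂.nat rAdj (s₂.nat rI 0 * s₂.nat rV 0 + s₂.nat rMate (s₂.nat rI 0)) - 1 =
        s.nat rAdj (j * V + s.nat rMate j) - 1 := by
      rw [hsj, hf₂.nat rAdj (by decide), hf₁.nat rAdj (by decide), hf₂.nat rV (by decide),
        hf₁.nat rV (by decide), hV, hf₂.nat rMate (by decide), hf₁.nat rMate (by decide)]
    rw [Memory.setNat_nat_of_ne _ _ _ (by decide), Memory.setNat_nat]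
    simp only [NatExp.eval, NatExp.eval_entry, NatExp.eval_var, e, true_and]
    split_ifs with h
    · simp only [ne_eq, one_ne_zero, not_false_eq_true, true_iff]
      exact ⟨j, by omega, h.symm⟩
    · rw [h₂ u hu]
      constructor
      · rintro ⟨i, hi, h'⟩; exact ⟨i, by omega, h'⟩
      · rintro ⟨i, hi, h'⟩
        refine ⟨i, lt_of_le_of_ne (by omega) ?_, h'⟩
        rintro rfl
        exact h h'.symm

/-- The threshold `R` admits the solution `out`, obtained from a perfect matching. -/
def Feasible (n m V : ℕ) (p : ℕ → K) (PE PW : ℕ → ℕ → K) (R : K) (out : ℕ → ℕ) : Prop :=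
  ∃ (cnt : ℕ) (sel M : ℕ → ℕ), IsGreedy n p PE (R + R + R) cnt sel ∧ cnt ≤ V ∧
    IsMatching V (CommonCover m (Covers PW R cnt sel)) M ∧ (∀ x < V, M x ≠ x) ∧
    ∀ u < m, out u ≠ 0 ↔ ∃ i < V,
      lastHit (fun u => Covers PW R cnt sel i u ∧ Covers PW R cnt sel (M i) u) m - 1 = u

/-- The graph for the threshold `R` has no perfect matching. -/
def Infeasible (n m V : ℕ) (p : ℕ → K) (PE PW : ℕ → ℕ → K) (R : K) : Prop :=
  ∃ (cnt : ℕ) (sel : ℕ → ℕ), IsGreedy n p PE (R + R + R) cnt sel ∧ (V < cnt ∨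
    ∀ M, IsMatching V (CommonCover m (Covers PW R cnt sel)) M → ∃ x < V, M x = x)

theorem wp_tryThreshold {s : Memory K} {V n m : ℕ} (hV : s.nat rV 0 = V) (hn : s.nat 0 1 = n)
    (hm : s.nat 0 0 = m) (hVL : 2 * V + 1 ≤ L) (hnL : n ≤ L) (hmL : m ≤ L)
    (hdiag : ∀ v < n, s.num nPE (v * n + v) ≤ s.num nR 0 + s.num nR 0 + s.num nR 0) :
    wp L tryThreshold (fun s' =>
      (s'.nat rHit 0 = 1 ∧ s'.num nBest 0 = s.num nR 0 ∧ Feasible n m V (s.num 2)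
        (fun w v => s.num nPE (w * n + v)) (fun v u => s.num nPW (v * m + u)) (s.num nR 0)
        (s'.nat 1)) ∨
      (s'.nat rHit 0 = s.nat rHit 0 ∧ s'.nat 1 = s.nat 1 ∧ s'.num nBest = s.num nBest ∧
        Infeasible n m V (s.num 2) (fun w v => s.num nPE (w * n + v))
          (fun v u => s.num nPW (v * m + u)) (s.num nR 0))) s := by
  rw [tryThreshold, wp_seq]
  refine wp_mono (wp_greedy hn hnL hdiag) fun s₁ hf₁ G => ?_
  have hV₁ : s₁.nat rV 0 = V := by rw [hf₁.nat rV (by decide), hV]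
  have hm₁ : s₁.nat 0 0 = m := by rw [hf₁.nat 0 (by decide), hm]
  have hhit₁ : s₁.nat rHit 0 = s.nat rHit 0 := by rw [hf₁.nat rHit (by decide)]
  have hout₁ : s₁.nat 1 = s.nat 1 := hf₁.nat 1 (by decide)
  have hnum₁ : ∀ c, s₁.num c = s.num c := fun c => hf₁.num c (by
    simp [greedy, Program.numWrites, pickBest, selectBest, Program.setVar])
  set cnt := s₁.nat rCnt 0 with hcnt
  set sel := s₁.nat rSel with hsel
  set C := Covers (fun v u => s.num nPW (v * m + u)) (s.num nR 0) cnt sel with hC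
  refine wp_ite (fun ht => ?_) (fun ht => ?_)
  · simp only [Test.Holds, NatExp.eval_var, hV₁, ← hcnt] at ht
    rw [wp_seq]
    refine wp_mono (wp_coverTable hV₁ hm₁ (by omega) hmL) fun s₂ hf₂ h₂ => ?_
    rw [hnum₁, hnum₁, ← hC] at h₂
    rw [wp_seq]
    refine wp_mono (wp_adjTable (by rw [hf₂.nat rV (by decide), hV₁])
      (by rw [hf₂.nat 0 (by decide), hm₁]) (by omega) hmL) fun s₃ hf₃ h₃ => ?_
    have hcongr : ∀ i < V, ∀ j < V,
        lastHit (fun u => s₂.nat rCov (i * m + u) = 1 ∧ s₂.nat rCov (j * m + u) = 1) m =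
        lastHit (fun u => C i u ∧ C j u) m := fun i hi j hj =>
      lastHit_congr fun u hu => by rw [h₂ i hi u hu, h₂ j hj u hu]
    rw [wp_seq]
    refine wp_mono (wp_perfectMatching (adj := CommonCover m C)
      (by rw [hf₃.nat rV (by decide), hf₂.nat rV (by decide), hV₁]) hVL (fun x hx y hy => ?_)
      (fun x y => CommonCover.symm)) fun s₄ hf₄ h₄ => ?_
    · rw [h₃ x hx y hy, CommonCover]
      split_ifs with h
      · simp [h]
      · rw [hcongr x hx y hy, lastHit_ne_zero]
        simp [h]
    · refine wp_ite (fun hb => ?_) (fun hb => ?_)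
      · simp only [Test.holds_natEq, NatExp.eval_var, NatExp.eval] at hb
        obtain ⟨-, hM, hne⟩ := h₄.resolve_right (by rintro ⟨h, -⟩; omega)
        rw [wp_seq]
        refine wp_mono (wp_writeOutput (V := V) (m := m)
          (by rw [hf₄.nat rV (by decide), hf₃.nat rV (by decide), hf₂.nat rV (by decide), hV₁])
          (by rw [hf₄.nat 0 (by decide), hf₃.nat 0 (by decide), hf₂.nat 0 (by decide), hm₁])
          (by omega) hmL) fun s₅ hf₅ h₅ => ?_
        simp only [wp_seq, wp_setNum, wp_setVar]
        refine .inl ⟨by simp, ?_, cnt, sel, s₄.nat rMate, G, ht, hM, hne, ?_⟩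
        · simp [hf₅.num nR (by decide), hf₄.num nR (by decide), hf₃.num nR (by decide),
            hf₂.num nR (by decide), hnum₁]
        · intro u hu
          rw [Memory.setNat_nat_of_ne _ _ _ (by decide), Memory.setNum_nat, h₅ u hu]
          refine exists_congr fun i => and_congr_right fun hi => ?_
          rw [hf₄.nat rAdj (by decide), h₃ i hi _ (hM.lt i hi), if_neg (hne i hi).symm,
            hcongr i hi _ (hM.lt i hi)]
      · simp only [Test.holds_natEq, NatExp.eval_var, NatExp.eval] at hb
        obtain ⟨-, hno⟩ := h₄.resolve_left (by rintro ⟨h, -⟩; omega)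
        rw [wp_skip]
        refine .inr ⟨?_, ?_, ?_, cnt, sel, G, .inr hno⟩
        · rw [hf₄.nat rHit (by decide), hf₃.nat rHit (by decide), hf₂.nat rHit (by decide), hhit₁]
        · rw [hf₄.nat 1 (by decide), hf₃.nat 1 (by decide), hf₂.nat 1 (by decide), hout₁]
        · rw [hf₄.num nBest (by decide), hf₃.num nBest (by decide), hf₂.num nBest (by decide),
            hnum₁]
  · simp only [Test.Holds, NatExp.eval_var, hV₁, ← hcnt] at ht
    rw [wp_skip]
    exact .inr ⟨hhit₁, hout₁, hnum₁ _, cnt, sel, G, .inl (by omega)⟩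

/-- What the algorithm computes: `PW` and `PE` are the squares of the weighted distances. -/
theorem wp_algorithm {s : Memory K} {n m k d V : ℕ} {PW PE : ℕ → ℕ → K}
    (hm : s.nat 0 0 = m) (hn : s.nat 0 1 = n) (hk : s.nat 0 2 = k) (hd : s.nat 0 3 = d)
    (hV : V = 2 * min k n) (hmL : m ≤ L) (hnL : n ≤ L) (hdL : d ≤ L) (hVL : 2 * V + 1 ≤ L)
    (hnmL : n * m ≤ L) (hzero : ∀ a, 3 ≤ a → ∀ j, s.num a j = 0) (hhit : s.nat rHit 0 = 0)
    (hPW : ∀ v u, PW v u = ∑ i ∈ Finset.range d, (s.num 2 v * s.num 2 v) *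
        ((s.num 1 (v * d + i) - s.num 0 (u * d + i)) *
          (s.num 1 (v * d + i) - s.num 0 (u * d + i))))
    (hPE : ∀ v u, PE v u = ∑ i ∈ Finset.range d, (s.num 2 v * s.num 2 v) *
        ((s.num 1 (v * d + i) - s.num 1 (u * d + i)) *
          (s.num 1 (v * d + i) - s.num 1 (u * d + i))))
    (hdiag : ∀ v < n, ∀ u < m, ∀ w < n, PE w w ≤ PW v u + PW v u + PW v u) :
    wp L algorithm (fun s' =>
      (s'.nat 1 = s.nat 1 ∧
        ∀ v < n, ∀ u < m, ∃ PE' PW' : ℕ → ℕ → K, (∀ w < n, ∀ x < n, PE' w x = PE w x) ∧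
          (∀ w < n, ∀ x < m, PW' w x = PW w x) ∧
          Infeasible n m V (s.num 2) PE' PW' (PW v u)) ∨
      (∃ R, (∃ v < n, ∃ u < m, R = PW v u) ∧
        (∃ PE' PW' : ℕ → ℕ → K, (∀ w < n, ∀ x < n, PE' w x = PE w x) ∧
          (∀ w < n, ∀ x < m, PW' w x = PW w x) ∧
          Feasible n m V (s.num 2) PE' PW' R (s'.nat 1)) ∧
        ∀ v < n, ∀ u < m, R ≤ PW v u ∨ ∃ PE' PW' : ℕ → ℕ → K,
          (∀ w < n, ∀ x < n, PE' w x = PE w x) ∧ (∀ w < n, ∀ x < m, PW' w x = PW w x) ∧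
          Infeasible n m V (s.num 2) PE' PW' (PW v u))) s := by
  rw [algorithm, wp_seq]
  -- Only the binary length of `k` counts towards the input size, so a graph on `2 * k` vertices
  -- could be exponentially large. Capping `k` at `n` loses nothing, as `n` suppliers can serve `n`
  -- clients.
  have hstart : wp L (.ite (.natLe .budget .numClients) (.setVar rV (.add .budget .budget))
      (.setVar rV (.add .numClients .numClients))) (fun s' => s'.nat rV 0 = V) s := by
    refine wp_ite (fun ht => ?_) (fun ht => ?_)
    · simp only [Test.Holds, NatExp.eval, hk, hn] at ht
      simp [hk, hV]; omega
    · simp only [Test.Holds, NatExp.eval, hk, hn] at ht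
      simp [hn, hV]; omega
  refine wp_mono hstart fun s₁ hf₁ h₁ => ?_
  have a₁ : s₁.nat 0 = s.nat 0 := hf₁.nat 0 (by decide)
  have b₁ : ∀ c, s₁.num c = s.num c := fun c => hf₁.num c (by
    simp [Program.numWrites, Program.setVar])
  rw [wp_seq]
  refine wp_mono (wp_distances (cell := 0) (n := n) (c := m) (d := d) (by omega) (by omega)
    (by rw [a₁, hn]) (by rw [a₁, hm]) (by rw [a₁, hd]) hnL hmL hdL
    (fun j => by rw [b₁]; exact hzero _ (by omega) j)) fun s₂ hf₂ h₂ => ?_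
  have a₂ : s₂.nat 0 = s.nat 0 := by rw [hf₂.nat 0 (by decide), a₁]
  have b₂ : ∀ c, c ≠ nPW → s₂.num c = s.num c := fun c hc => by
    rw [hf₂.num c (by simp [distances, Program.numWrites, hc]), b₁]
  rw [wp_seq]
  refine wp_mono (wp_distances (cell := 1) (n := n) (c := n) (d := d) (by omega) (by omega)
    (by rw [a₂, hn]) (by rw [a₂, hn]) (by rw [a₂, hd]) hnL hnL hdL
    (fun j => by rw [b₂ _ (by omega)]; exact hzero _ (by omega) j)) fun s₃ hf₃ h₃ => ?_
  have a₃ : s₃.nat 0 = s.nat 0 := by rw [hf₃.nat 0 (by decide), a₂]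
  have b₃ : ∀ c, c ≠ nPW → c ≠ nPE → s₃.num c = s.num c := fun c hc hc' => by
    rw [hf₃.num c (by simp [distances, Program.numWrites, hc']), b₂ c hc]
  have hV₃ : s₃.nat rV 0 = V := by rw [hf₃.nat rV (by decide), hf₂.nat rV (by decide), h₁]
  have hhit₃ : s₃.nat rHit 0 = 0 := by
    rw [hf₃.nat rHit (by decide), hf₂.nat rHit (by decide), hf₁.nat rHit (by decide), hhit]
  have hout₃ : s₃.nat 1 = s.nat 1 := by
    rw [hf₃.nat 1 (by decide), hf₂.nat 1 (by decide), hf₁.nat 1 (by decide)]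
  have hPW₃ : ∀ v < n, ∀ u < m, s₃.num nPW (v * m + u) = PW v u := by
    intro v hv u hu
    rw [hf₃.num nPW (by decide), h₂ v hv u hu, hPW, b₁, b₁, b₁]
  have hPE₃ : ∀ v < n, ∀ u < n, s₃.num nPE (v * n + u) = PE v u := by
    intro v hv u hu
    rw [h₃ v hv u hu, hPE, b₂ 2 (by omega), b₂ 1 (by omega)]
  -- The tables in memory agree with `PE` and `PW` for indices in range only; hence the quantified
  -- tables in the conclusion.
  set PE' : ℕ → ℕ → K := fun w v => s₃.num nPE (w * n + v) with hPE'
  set PW' : ℕ → ℕ → K := fun v u => s₃.num nPW (v * m + u) with hPW'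
  have hdec : ∀ c < n * m, ∃ v < n, ∃ u < m, c = v * m + u := by
    intro c hc
    have hm0 : 0 < m := Nat.pos_of_ne_zero (by rintro rfl; simp at hc)
    exact ⟨c / m, Nat.div_lt_of_lt_mul (by rwa [mul_comm]), c % m, Nat.mod_lt _ hm0,
      by rw [mul_comm, Nat.div_add_mod]⟩
  -- Either every threshold so far was rejected and the output is untouched, or the output belongs
  -- to `nBest`, and every smaller threshold so far was rejected. Thresholds not below `nBest` are
  -- skipped.
  refine wp_forLoop (n * m) (fun c s' =>
      (s'.nat rHit 0 = 0 ∧ s'.nat 1 = s.nat 1 ∧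
        ∀ i < c, Infeasible n m V (s.num 2) PE' PW' (s₃.num nPW i)) ∨
      (s'.nat rHit 0 = 1 ∧ (∃ i < n * m, s'.num nBest 0 = s₃.num nPW i) ∧
        Feasible n m V (s.num 2) PE' PW' (s'.num nBest 0) (s'.nat 1) ∧
        ∀ i < c, s'.num nBest 0 ≤ s₃.num nPW i ∨
          Infeasible n m V (s.num 2) PE' PW' (s₃.num nPW i))) hnmL (by decide)
    (fun s' hf => by simp [hf.nat 0 (by decide), a₃, hn, hm]) ?_ ?_ ?_
  · exact .inl ⟨by simpa using hhit₃, by simpa using hout₃, by simp⟩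
  · intro c s₄ hc hf₄ hsc h₄
    have a₄ : s₄.nat 0 = s.nat 0 := by rw [hf₄.nat 0 (by decide), a₃]
    have b₄ : ∀ c, c ≠ nR → c ≠ nBest → s₄.num c = s₃.num c := fun c hc hc' => by
      refine hf₄.num c ?_
      simp [tryThreshold, greedy, pickBest, selectBest, coverTable, adjTable, writeOutput,
        perfectMatching, search, searchStep, findEdge, augmentStep, growStep, shrinkStep, walkStep,
        Program.rowSet, Program.numWrites, Program.setVar, hc, hc']
    have hV₄ : s₄.nat rV 0 = V := by rw [hf₄.nat rV (by decide), hV₃]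
    rw [wp_seq, wp_setNum]
    simp only [NumExp.eval, NatExp.eval_var, NatExp.eval, hsc, b₄ nPW (by decide) (by decide)]
    set R := s₃.num nPW c with hR
    set s₅ := s₄.setNum nR 0 R with hs₅
    have b₅ : ∀ c, c ≠ nR → c ≠ nBest → s₅.num c = s₃.num c := fun c hc hc' => by
      rw [hs₅, Memory.setNum_num_of_ne _ _ _ hc, b₄ c hc hc']
    have hbest₅ : s₅.num nBest 0 = s₄.num nBest 0 := by simp [hs₅]
    have hR₅ : s₅.num nR 0 = R := by simp [hs₅]
    have hhit₅ : s₅.nat rHit 0 = s₄.nat rHit 0 := by simp [hs₅]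
    have hlast : ∀ {P : ℕ → Prop}, (∀ i < c, P i) → P c → ∀ i < c + 1, P i := by
      intro P h h' i hi
      rcases Nat.lt_succ_iff_lt_or_eq.mp hi with h'' | rfl
      exacts [h i h'', h']
    refine wp_ite (fun ht => ?_) (fun ht => ?_)
    · simp only [Test.Holds, Test.holds_or, Test.holds_natEq, NatExp.eval_var, NatExp.eval,
        NumExp.eval_var, hhit₅, hbest₅, hR₅, not_le] at ht
      refine wp_mono (wp_tryThreshold (V := V) (n := n) (m := m) (by rw [hs₅]; exact hV₄)
        (by rw [hs₅, Memory.setNum_nat, a₄, hn]) (by rw [hs₅, Memory.setNum_nat, a₄, hm]) hVL hnL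
        hmL ?_) fun s₆ hf₆ h₆ => ?_
      · intro w hw
        obtain ⟨v, hv, u, hu, rfl⟩ := hdec c hc
        rw [hR₅, b₅ nPE (by decide) (by decide), hPE₃ w hw w hw, hR, hPW₃ v hv u hu]
        exact hdiag v hv u hu w hw
      · rw [hR₅, b₅ nPE (by decide) (by decide), b₅ nPW (by decide) (by decide),
          b₅ 2 (by decide) (by decide), b₃ 2 (by decide) (by decide)] at h₆
        simp only [Memory.setNat_num]
        rw [Memory.setNat_nat_of_ne _ _ _ (by decide), Memory.setNat_nat_of_ne _ _ _ (by decide)]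
        rcases h₆ with ⟨k₁, k₂, k₃⟩ | ⟨k₁, k₂, k₃, k₄⟩
        · refine .inr ⟨k₁, ⟨c, hc, k₂⟩, by rw [k₂]; exact k₃, ?_⟩
          rw [k₂]
          refine hlast (fun i hi => ?_) (.inl le_rfl)
          rcases h₄ with ⟨l₁, l₂, l₃⟩ | ⟨l₁, l₂, l₃, l₄⟩
          · exact .inr (l₃ i hi)
          · exact (l₄ i hi).imp (fun h => (ht.resolve_left (by omega)).le.trans h) id
        · rcases h₄ with ⟨l₁, l₂, l₃⟩ | ⟨l₁, l₂, l₃, l₄⟩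
          · exact .inl ⟨by rw [k₁, hhit₅, l₁], by rw [k₂, hs₅]; exact l₂, hlast l₃ k₄⟩
          · have : s₆.num nBest 0 = s₄.num nBest 0 := by rw [k₃, hbest₅]
            rw [this, k₂, k₁, hhit₅]
            exact .inr ⟨l₁, l₂, l₃, hlast l₄ (.inr k₄)⟩
    · simp only [Test.Holds, Test.holds_or, Test.holds_natEq, NatExp.eval_var, NatExp.eval,
        NumExp.eval_var, hhit₅, hbest₅, hR₅, not_or, not_not] at ht
      rw [wp_skip]
      obtain ⟨l₁, l₂, l₃, l₄⟩ := h₄.resolve_left (by rintro ⟨h, -⟩; exact ht.1 h)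
      refine .inr ⟨?_, ?_, ?_, ?_⟩
      · simpa [hs₅] using l₁
      · simpa [hs₅] using l₂
      · simpa [hs₅] using l₃
      · simp only [Memory.setNat_num, hbest₅]
        exact hlast l₄ (.inl ht.2)
  · intro s₄ hf₄ h₄
    have hlt : ∀ v < n, ∀ u < m, v * m + u < n * m := fun v hv u hu => by
      calc v * m + u < v * m + m := by omega
        _ = (v + 1) * m := by ring
        _ ≤ n * m := Nat.mul_le_mul_right m hv
    rcases h₄ with ⟨k₁, k₂, k₃⟩ | ⟨k₁, ⟨i, hi, k₂⟩, k₃, k₄⟩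
    · refine .inl ⟨k₂, fun v hv u hu => ⟨PE', PW', hPE₃, hPW₃, ?_⟩⟩
      rw [← hPW₃ v hv u hu]
      exact k₃ _ (hlt v hv u hu)
    · refine .inr ⟨s₄.num nBest 0, ?_, ⟨PE', PW', hPE₃, hPW₃, k₃⟩, fun v hv u hu => ?_⟩
      · obtain ⟨v, hv, u, hu, rfl⟩ := hdec i hi
        exact ⟨v, hv, u, hu, by rw [k₂, hPW₃ v hv u hu]⟩
      · rw [← hPW₃ v hv u hu]
        exact (k₄ _ (hlt v hv u hu)).imp id fun h => ⟨PE', PW', hPE₃, hPW₃, h⟩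

end

/-! ### Correctness of the thresholds -/

/-- A set of `2 * N` vertices, some of which carry colors, at most two vertices of each color and at
most `N` colors in all, can be partitioned into pairs such that two colored vertices of a pair have
the same color. -/
theorem exists_pairing (g : ℕ → ℕ) (N : ℕ) : ∀ T A : Finset ℕ, T.card = 2 * N → A ⊆ T →
    (A.image g).card ≤ N → (∀ c, (A.filter fun x => g x = c).card ≤ 2) →
    ∃ M : ℕ → ℕ, ∀ x ∈ T, M x ∈ T ∧ M (M x) = x ∧ M x ≠ x ∧
      (x ∈ A → M x ∈ A → g x = g (M x)) := by
  induction N with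
  | zero =>
    intro T A hT _ _ _
    obtain rfl : T = ∅ := Finset.card_eq_zero.mp (by omega)
    exact ⟨id, by simp⟩
  | succ N ih =>
    intro T A hT hA him hfib
    -- It suffices to split off one admissible pair whose removal leaves at most `N` colors.
    have hpair : ∃ x ∈ T, ∃ y ∈ T, x ≠ y ∧ (x ∈ A → y ∈ A → g x = g y) ∧
        ((A \ {x, y}).image g).card ≤ N := by
      rcases A.eq_empty_or_nonempty with rfl | ⟨x, hx⟩
      · obtain ⟨x, hx, y, hy, hxy⟩ := Finset.one_lt_card.mp (by omega : 1 < T.card)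
        exact ⟨x, hx, y, hy, hxy, by simp, by simp⟩
      have hsub : ∀ B ⊆ A, (∀ z ∈ B, g z ≠ g x) → (B.image g).card ≤ N := by
        intro B hB h
        have : (B.image g) ⊆ (A.image g).erase (g x) := by
          intro c hc
          obtain ⟨z, hz, rfl⟩ := Finset.mem_image.mp hc
          exact Finset.mem_erase.mpr ⟨h z hz, Finset.mem_image_of_mem g (hB hz)⟩
        have h' := Finset.card_le_card this
        rw [Finset.card_erase_of_mem (Finset.mem_image_of_mem g hx)] at h'
        omega
      by_cases hy : ∃ y ∈ A, y ≠ x ∧ g y = g x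
      · obtain ⟨y, hy, hne, hg⟩ := hy
        refine ⟨x, hA hx, y, hA hy, hne.symm, fun _ _ => hg.symm,
          hsub _ Finset.sdiff_subset fun z hz h => ?_⟩
        simp only [Finset.mem_sdiff, Finset.mem_insert, Finset.mem_singleton, not_or] at hz
        -- A third vertex of this color is excluded, so removing `x` and `y` uses the color up.
        have : 2 < (A.filter fun z => g z = g x).card := Finset.two_lt_card.mpr
          ⟨x, by simp [hx], y, by simp [hy, hg], z, by simp [hz.1, h], hne.symm,
            Ne.symm hz.2.1, Ne.symm hz.2.2⟩
        exact absurd (hfib (g x)) (by omega)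
      · push Not at hy
        have hcard := hsub (A.erase x) (Finset.erase_subset _ _) fun z hz =>
          hy z (Finset.mem_of_mem_erase hz) (Finset.ne_of_mem_erase hz)
        -- If `x` is alone in its color, the at most `N` other colors account for at most `2 * N`
        -- vertices. So `A` has fewer than `2 * (N + 1)` elements, and `x` finds an uncolored
        -- partner.
        have hle : (A.erase x).card ≤ 2 * ((A.erase x).image g).card := by
          refine Finset.card_le_mul_card_image _ 2 fun c _ => ?_
          exact (Finset.card_le_card (Finset.filter_subset_filter _ (Finset.erase_subset _ _))).trans
            (hfib c)
        rw [Finset.card_erase_of_mem hx] at hle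
        obtain ⟨y, hyT, hyA⟩ : ∃ y ∈ T, y ∉ A := by
          by_contra! h
          have := Finset.card_le_card (s := T) (t := A) h
          omega
        refine ⟨x, hA hx, y, hyT, ne_of_mem_of_not_mem hx hyA, fun _ h => absurd h hyA, ?_⟩
        refine hsub _ Finset.sdiff_subset fun z hz => ?_
        simp only [Finset.mem_sdiff, Finset.mem_insert, Finset.mem_singleton, not_or] at hz
        exact hy z hz.1 hz.2.1
    obtain ⟨x, hx, y, hy, hxy, hg, hcard⟩ := hpair
    obtain ⟨M, hM⟩ := ih (T \ {x, y}) (A \ {x, y}) (by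
      rw [Finset.card_sdiff_of_subset (by simp [Finset.insert_subset_iff, hx, hy]),
        Finset.card_pair hxy, hT]
      omega) (Finset.sdiff_subset_sdiff hA subset_rfl) hcard
      fun c => (Finset.card_le_card (Finset.filter_subset_filter _ Finset.sdiff_subset)).trans
        (hfib c)
    simp only [Finset.mem_sdiff, Finset.mem_insert, Finset.mem_singleton, not_or] at hM
    refine ⟨fun z => if z = x then y else if z = y then x else M z, fun z hz => ?_⟩
    by_cases hzx : z = x
    · subst hzx
      simp [hy, hxy.symm]
      exact fun h h' => hg h h'
    by_cases hzy : z = y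
    · subst hzy
      simp [hx, hxy, hzx]
      exact fun h h' => (hg h' h).symm
    obtain ⟨⟨h₁, h₂, h₃⟩, h₄, h₅, h₆⟩ := hM z ⟨hz, hzx, hzy⟩
    simp only [hzx, hzy, h₂, h₃, if_false]
    exact ⟨h₁, h₄, h₅, fun h h' => h₆ ⟨h, hzx, hzy⟩ ⟨h', h₂, h₃⟩⟩

section

variable {K : Type} [Ring K] [LinearOrder K]

/-- Color the selected clients by the supplier that serves them. By `hgeo` no color occurs three
times, and there are at most `min k n` colors; thus `cnt ≤ V`, and pairing equal colors gives a
perfect matching of the graph. The geometry enters through `hgeo` only. -/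
theorem not_infeasible {n m k V : ℕ} {p : ℕ → K} {PE PW : ℕ → ℕ → K} {R : K} {f : ℕ → ℕ}
    {C : Finset ℕ} (hV : V = 2 * min k n) (hC : C.card ≤ k) (hm : 0 < m)
    (hf : ∀ v < n, f v ∈ C ∧ f v < m ∧ PW v (f v) ≤ R)
    (hgeo : ∀ a < n, ∀ b < n, ∀ c < n, ∀ u < m, p b ≤ p a → p c ≤ p b → PW a u ≤ R → PW b u ≤ R →
      PW c u ≤ R → R + R + R < PE b a → R + R + R < PE c a → ¬ R + R + R < PE c b) :
    ¬ Infeasible n m V p PE PW R := by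
  rintro ⟨cnt, sel, G, h⟩
  set g : ℕ → ℕ := fun i => f (sel i) with hg
  have hsorted : ∀ i j l, i < j → j < l → l < cnt → ¬ (g j = g i ∧ g l = g i) := by
    rintro i j l hij hjl hl ⟨e₁, e₂⟩
    have a := hf _ (G.lt i (by omega))
    have b := hf _ (G.lt j (by omega))
    have c := hf _ (G.lt l hl)
    refine hgeo _ (G.lt i (by omega)) _ (G.lt j (by omega)) _ (G.lt l hl) (g i) a.2.1
      (G.mono j (by omega) i hij) (G.mono l hl j hjl) a.2.2 (e₁ ▸ b.2.2) (e₂ ▸ c.2.2)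
      (G.far j (by omega) i hij) (G.far l hl i (by omega)) (G.far l hl j hjl)
  have hfib : ∀ c, ((Finset.range cnt).filter fun x => g x = c).card ≤ 2 := by
    intro c
    by_contra! h
    obtain ⟨x, hx, y, hy, z, hz, hxy, hxz, hyz⟩ := Finset.two_lt_card.mp h
    simp only [Finset.mem_filter, Finset.mem_range] at hx hy hz
    obtain ⟨hx, ex⟩ := hx
    obtain ⟨hy, ey⟩ := hy
    obtain ⟨hz, ez⟩ := hz
    have key : ∀ i j l, i < j → j < l → l < cnt → g i = c → g j = c → g l = c → False :=
      fun i j l h₁ h₂ h₃ e₁ e₂ e₃ => hsorted i j l h₁ h₂ h₃ ⟨e₂.trans e₁.symm, e₃.trans e₁.symm⟩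
    rcases lt_or_gt_of_ne hxy with h₁ | h₁ <;> rcases lt_or_gt_of_ne hxz with h₂ | h₂ <;>
      rcases lt_or_gt_of_ne hyz with h₃ | h₃
    · exact key x y z h₁ h₃ hz ex ey ez
    · exact key x z y h₂ h₃ hy ex ez ey
    · omega
    · exact key z x y h₂ h₁ hy ez ex ey
    · exact key y x z h₁ h₂ hz ey ex ez
    · omega
    · exact key y z x h₃ h₂ hx ey ez ex
    · exact key z y x h₃ h₁ hx ez ey ex
  have him : ((Finset.range cnt).image g).card ≤ min k n := by
    refine le_min ((Finset.card_le_card ?_).trans hC) ?_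
    · intro c hc
      obtain ⟨i, hi, rfl⟩ := Finset.mem_image.mp hc
      exact (hf _ (G.lt i (by simpa using hi))).1
    · have : (Finset.range cnt).image g ⊆ (Finset.range n).image f := by
        intro c hc
        obtain ⟨i, hi, rfl⟩ := Finset.mem_image.mp hc
        exact Finset.mem_image_of_mem f (by simpa using G.lt i (by simpa using hi))
      simpa using (Finset.card_le_card this).trans Finset.card_image_le
  have hcnt : cnt ≤ V := by
    have := Finset.card_le_mul_card_image (s := Finset.range cnt) (f := g) 2 fun c _ => hfib c
    rw [Finset.card_range] at this
    omega
  obtain ⟨M, hM⟩ := exists_pairing g (min k n) (Finset.range V) (Finset.range cnt) (by simp [hV])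
    (by simpa using hcnt) him hfib
  simp only [Finset.mem_range] at hM
  rcases h with h | h
  · omega
  obtain ⟨x, hx, hMx⟩ := h M ⟨fun x hx => (hM x hx).1, fun x hx => (hM x hx).2.1, fun x hx hne => by
    refine ⟨hne.symm, ?_⟩
    have hcov : ∀ i < cnt, Covers PW R cnt sel i (g i) := fun i hi => .inr (hf _ (G.lt i hi)).2.2
    by_cases h₁ : x < cnt
    · refine ⟨g x, (hf _ (G.lt x h₁)).2.1, hcov x h₁, ?_⟩
      by_cases h₂ : M x < cnt
      · rw [(hM x hx).2.2.2 h₁ h₂]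
        exact hcov _ h₂
      · exact .inl (by omega)
    · by_cases h₂ : M x < cnt
      · exact ⟨g (M x), (hf _ (G.lt _ h₂)).2.1, .inl (by omega), hcov _ h₂⟩
      -- Two dummies are covered by any supplier, but one has to exist.
      · exact ⟨0, hm, .inl (by omega), .inl (by omega)⟩⟩
  exact (hM x hx).2.2.1 hMx

/-- Both ends of a matching edge determine the same supplier, so there are at most `V / 2` of them.
-/
theorem Feasible.card_le {n m V : ℕ} {p : ℕ → K} {PE PW : ℕ → ℕ → K} {R : K} {out : ℕ → ℕ}
    (h : Feasible n m V p PE PW R out) :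
    2 * ((Finset.range m).filter fun u => out u ≠ 0).card ≤ V := by
  obtain ⟨cnt, sel, M, -, -, hM, hne, hout⟩ := h
  set C := Covers PW R cnt sel
  set g : ℕ → ℕ := fun i => lastHit (fun u => C i u ∧ C (M i) u) m - 1 with hg
  have hgM : ∀ i < V, g (M i) = g i := by
    intro i hi
    simp only [hg, hM.invol i hi]
    rw [lastHit_congr fun u _ => and_comm]
  set S := (Finset.range V).filter fun i => i < M i with hS
  have hsub : ((Finset.range m).filter fun u => out u ≠ 0) ⊆ S.image g := by
    intro u hu
    simp only [Finset.mem_filter, Finset.mem_range] at hu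
    obtain ⟨i, hi, rfl⟩ := (hout u hu.1).mp hu.2
    rcases lt_or_gt_of_ne (hne i hi) with h | h
    · exact Finset.mem_image.mpr ⟨M i, by simp [hS, hM.lt i hi, hM.invol i hi, h], hgM i hi⟩
    · exact Finset.mem_image.mpr ⟨i, by simp [hS, hi, h], rfl⟩
  have hcard : S.card = ((Finset.range V).filter fun i => ¬ i < M i).card := by
    refine Finset.card_bij' (fun i _ => M i) (fun i _ => M i) ?_ ?_ ?_ ?_ <;> intro i hi <;>
      simp only [hS, Finset.mem_filter, Finset.mem_range] at hi ⊢
    · exact ⟨hM.lt i hi.1, by rw [hM.invol i hi.1]; omega⟩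
    · have := hne i hi.1
      exact ⟨hM.lt i hi.1, by rw [hM.invol i hi.1]; omega⟩
    · exact hM.invol i hi.1
    · exact hM.invol i hi.1
  have hsum : S.card + ((Finset.range V).filter fun i => ¬ i < M i).card = V := by
    rw [hS, Finset.card_filter_add_card_filter_not, Finset.card_range]
  have := (Finset.card_le_card hsub).trans Finset.card_image_le
  omega

/-- Take the selected client near `w`. It is no dummy, so the supplier of its matching edge serves
it within `R`. -/
theorem Feasible.exists_close {n m V : ℕ} {p : ℕ → K} {PE PW : ℕ → ℕ → K} {R : K} {out : ℕ → ℕ}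
    (h : Feasible n m V p PE PW R out) {w : ℕ} (hw : w < n) :
    ∃ v < n, ∃ u < m, out u ≠ 0 ∧ p w ≤ p v ∧ PE w v ≤ R + R + R ∧ PW v u ≤ R := by
  obtain ⟨cnt, sel, M, G, hcnt, hM, hne, hout⟩ := h
  obtain ⟨i, hi, hp, hE⟩ := G.close w hw
  have hadj := (hM.adj i (by omega) (hne i (by omega))).2
  obtain ⟨u, hu⟩ := Nat.exists_eq_succ_of_ne_zero (lastHit_ne_zero.mpr hadj)
  have hspec := lastHit_spec hu
  refine ⟨sel i, G.lt i hi, u, hspec.1, (hout u hspec.1).mpr ⟨i, by omega, by rw [hu]; rfl⟩, hp, hE,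
    hspec.2.1.resolve_left (by omega)⟩

end

/-! ### Angles at a supplier, and the approximation ratio. -/

section Geometry

variable {E : Type*} [NormedAddCommGroup E] [InnerProductSpace ℝ E]

/-- Law of cosines: `q² (‖a‖² + ‖b‖² + ‖a‖ ‖b‖) ≤ 3R`, as the product of the norms is at most the
mean of their squares. The hypotheses force `q ≠ 0`. The factor `3` is exactly what yields 120
degrees. -/
theorem inner_lt_of_far {a b : E} {q R : ℝ} (ha : q ^ 2 * ‖a‖ ^ 2 ≤ R)
    (hb : q ^ 2 * ‖b‖ ^ 2 ≤ R) (hab : 3 * R < q ^ 2 * ‖b - a‖ ^ 2) :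
    2 * inner ℝ a b < -(‖a‖ * ‖b‖) := by
  have hexp := norm_sub_sq_real b a
  rw [real_inner_comm] at hexp
  have hq2 : 0 < q ^ 2 := by
    refine lt_of_le_of_ne (sq_nonneg q) fun h => ?_
    rw [← h] at ha hab
    linarith
  have h : q ^ 2 * (2 * inner ℝ a b) < q ^ 2 * -(‖a‖ * ‖b‖) := by
    rw [hexp] at hab
    nlinarith [mul_nonneg hq2.le (sq_nonneg (‖a‖ - ‖b‖))]
  exact lt_of_mul_lt_mul_left h hq2.le

/-- Three vectors in a real inner product space cannot pairwise enclose angles above 120 degrees. -/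
theorem false_of_three_far {a b c : E} (hab : 2 * inner ℝ a b < -(‖a‖ * ‖b‖))
    (hac : 2 * inner ℝ a c < -(‖a‖ * ‖c‖)) (hbc : 2 * inner ℝ b c < -(‖b‖ * ‖c‖)) : False := by
  have pos : ∀ {x y : E}, 2 * inner ℝ x y < -(‖x‖ * ‖y‖) → 0 < ‖x‖ ∧ 0 < ‖y‖ := by
    intro x y h
    constructor <;> rw [norm_pos_iff] <;> rintro rfl <;> simp at h
  obtain ⟨ha, hb⟩ := pos hab
  have hc := (pos hac).2
  -- This is the sum of the three unit vectors, scaled by `‖a‖ * ‖b‖ * ‖c‖` to avoid division. Its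
  -- squared norm would be a positive multiple of a number below `3 - 3`.
  have key := real_inner_self_nonneg (x := (‖b‖ * ‖c‖) • a + (‖a‖ * ‖c‖) • b + (‖a‖ * ‖b‖) • c)
  simp only [inner_add_left, inner_add_right, real_inner_smul_left, real_inner_smul_right,
    real_inner_self_eq_norm_sq, real_inner_comm a b, real_inner_comm a c,
    real_inner_comm b c, norm_smul, norm_mul, norm_norm, mul_pow] at key
  have h₁ := mul_lt_mul_of_pos_left hab (by positivity : 0 < ‖b‖ * ‖c‖ * (‖a‖ * ‖c‖))
  have h₂ := mul_lt_mul_of_pos_left hac (by positivity : 0 < ‖b‖ * ‖c‖ * (‖a‖ * ‖b‖))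
  have h₃ := mul_lt_mul_of_pos_left hbc (by positivity : 0 < ‖a‖ * ‖c‖ * (‖a‖ * ‖b‖))
  nlinarith

/-- The distance of two clients is weighted by the lower of their priorities. Lowering a priority
preserves the bound towards the supplier, so each pair can be treated with one common weight. -/
theorem false_of_three_far_priorities {a b c x : E} {p q r R : ℝ} (hr : 0 ≤ r) (hrq : r ≤ q)
    (hqp : q ≤ p) (ha : p ^ 2 * ‖a - x‖ ^ 2 ≤ R) (hb : q ^ 2 * ‖b - x‖ ^ 2 ≤ R)
    (hc : r ^ 2 * ‖c - x‖ ^ 2 ≤ R) (hab : 3 * R < q ^ 2 * ‖b - a‖ ^ 2)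
    (hac : 3 * R < r ^ 2 * ‖c - a‖ ^ 2) (hbc : 3 * R < r ^ 2 * ‖c - b‖ ^ 2) : False := by
  have mono : ∀ {s t : ℝ} {y : E}, 0 ≤ s → s ≤ t → t ^ 2 * ‖y‖ ^ 2 ≤ R → s ^ 2 * ‖y‖ ^ 2 ≤ R :=
    fun hs hst h => le_trans (by gcongr) h
  have hq := hr.trans hrq
  refine false_of_three_far (a := a - x) (b := b - x) (c := c - x)
    (inner_lt_of_far (mono hq hqp ha) hb ?_)
    (inner_lt_of_far (mono hr (hrq.trans hqp) ha) hc ?_)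
    (inner_lt_of_far (mono hr hrq hb) hc ?_) <;> rwa [sub_sub_sub_cancel_right]

/-- The triangle inequality through the selected client `v`; since `p ≤ q`, the detour from `v` to
`u` costs at most `√R` under the smaller weight too. -/
theorem priority_mul_dist_le {w v u : E} {p q R : ℝ} (hp : 0 ≤ p) (hpq : p ≤ q)
    (hwv : p ^ 2 * ‖w - v‖ ^ 2 ≤ 3 * R) (hvu : q ^ 2 * ‖v - u‖ ^ 2 ≤ R) :
    p * ‖w - u‖ ≤ (1 + √3) * √R := by
  have h₁ : p * ‖w - v‖ ≤ √3 * √R := by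
    rw [← Real.sqrt_mul (by norm_num)]
    exact Real.le_sqrt_of_sq_le (by rwa [mul_pow])
  have h₂ : p * ‖v - u‖ ≤ √R := by
    refine Real.le_sqrt_of_sq_le (le_trans ?_ hvu)
    rw [mul_pow]
    gcongr
  have h₃ : ‖w - u‖ ≤ ‖w - v‖ + ‖v - u‖ := by simpa using norm_add_le (w - v) (v - u)
  nlinarith [mul_le_mul_of_nonneg_left h₃ hp]

end Geometry

/-! ### Cost of the computation -/

theorem sizeModel_unitSize : SizeModel unitSize fun _ => 1 where
  sz_le _ := by simp [unitSize]
  le_sz _ := by simp [unitSize]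
  cast _ := by omega
  add _ _ := by omega
  sub _ _ := by omega
  mul _ _ := by omega

/-- The larger one of the lengths of the numerator and of the denominator. -/
def ratHeight (x : ℚ) : ℕ := max (Nat.size x.num.natAbs) (Nat.size x.den)

theorem size_num_le (x : ℚ) : Nat.size x.num.natAbs ≤ ratHeight x := le_max_left _ _

theorem size_den_le (x : ℚ) : Nat.size x.den ≤ ratHeight x := le_max_right _ _

/-- Passing to lowest terms replaces numerator and denominator by divisors, so any representation as
a fraction bounds the height. -/
theorem ratHeight_le_of_eq_div {x : ℚ} {a : ℤ} {b B : ℕ} (hb : b ≠ 0) (hx : x = a / b)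
    (ha : Nat.size a.natAbs ≤ B) (hB : Nat.size b ≤ B) : ratHeight x ≤ B := by
  have hx' : x = Rat.divInt a (b : ℤ) := by rw [hx, Rat.divInt_eq_div]; norm_cast
  refine max_le ((Nat.size_le_size ?_).trans ha) ((Nat.size_le_size ?_).trans hB)
  · by_cases h : a = 0
    · simp [hx, h]
    · have := Rat.num_dvd a (b := (b : ℤ)) (by exact_mod_cast hb)
      rw [← hx'] at this
      exact Nat.le_of_dvd (by omega) (Int.natAbs_dvd_natAbs.mpr this)
  · have := Rat.den_dvd a (b : ℤ)
    rw [← hx'] at this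
    exact Nat.le_of_dvd (by omega) (by exact_mod_cast this)

theorem size_num_mul_den_le (x y : ℚ) :
    Nat.size (x.num * y.den).natAbs ≤ ratHeight x + ratHeight y := by
  rw [Int.natAbs_mul, Int.natAbs_natCast]
  exact (size_mul_le _ _).trans (add_le_add (size_num_le x) (size_den_le y))

theorem size_natAbs_add_le (a b : ℤ) :
    Nat.size (a + b).natAbs ≤ max (Nat.size a.natAbs) (Nat.size b.natAbs) + 1 :=
  (Nat.size_le_size (Int.natAbs_add_le a b)).trans (size_add_le _ _)

/-- The maximum of the two lengths is subadditive up to one bit under all three operations. Their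
sum is not: adding fractions can multiply the denominators and bring one of them into the numerator
as well. -/
theorem sizeModel_bitSize : SizeModel bitSize ratHeight where
  sz_le x := by
    have := size_num_le x
    have := size_den_le x
    rw [bitSize]
    omega
  le_sz x := by
    rw [bitSize, ratHeight]
    omega
  cast c := by
    simp only [ratHeight, Rat.num_natCast, Int.natAbs_natCast, Rat.den_natCast, Nat.size_one]
    omega
  add x y := by
    refine ratHeight_le_of_eq_div (a := x.num * y.den + y.num * x.den) (b := x.den * y.den)
      (Nat.mul_ne_zero x.den_nz y.den_nz) ?_ ?_ ?_
    · have := x.den_nz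
      have := y.den_nz
      conv_lhs => rw [← Rat.num_div_den x, ← Rat.num_div_den y]
      push_cast
      field_simp
    · refine (size_natAbs_add_le _ _).trans ?_
      have := size_num_mul_den_le x y
      have := size_num_mul_den_le y x
      omega
    · have := size_mul_le x.den y.den
      have := size_den_le x
      have := size_den_le y
      omega
  sub x y := by
    refine ratHeight_le_of_eq_div (a := x.num * y.den + -(y.num * x.den)) (b := x.den * y.den)
      (Nat.mul_ne_zero x.den_nz y.den_nz) ?_ ?_ ?_
    · have := x.den_nz
      have := y.den_nz
      conv_lhs => rw [← Rat.num_div_den x, ← Rat.num_div_den y]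
      push_cast
      field_simp
      ring
    · refine (size_natAbs_add_le _ _).trans ?_
      rw [Int.natAbs_neg]
      have := size_num_mul_den_le x y
      have := size_num_mul_den_le y x
      omega
    · have := size_mul_le x.den y.den
      have := size_den_le x
      have := size_den_le y
      omega
  mul x y := by
    refine ratHeight_le_of_eq_div (a := x.num * y.num) (b := x.den * y.den)
      (Nat.mul_ne_zero x.den_nz y.den_nz) ?_ ?_ ?_
    · have := x.den_nz
      have := y.den_nz
      conv_lhs => rw [← Rat.num_div_den x, ← Rat.num_div_den y]
      push_cast
      field_simp
    · rw [Int.natAbs_mul]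
      have := size_mul_le x.num.natAbs y.num.natAbs
      have := size_num_le x
      have := size_num_le y
      omega
    · have := size_mul_le x.den y.den
      have := size_den_le x
      have := size_den_le y
      omega

/-- A bound for the number of iterations of a loop on inputs of size `N`. -/
noncomputable def loopBound : Polynomial ℕ := .X ^ 2 + 4 * .X + 1

theorem eval_loopBound (N : ℕ) : loopBound.eval N = N ^ 2 + 4 * N + 1 := by
  simp [loopBound]

/-- A bound for the cost of a run of `P` on inputs of size `N`. -/
noncomputable def Program.costBound (P : Program) : Polynomial ℕ :=
  P.steps.comp loopBound * (4 * .C P.weight ^ 2 *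
    (.X + 1 + P.steps.comp loopBound * (.C P.weight * (.X + 1 + 1)) + 2))

/-- At the start all cells, in particular the input cells, are bounded by `N + 1`, which serves as
both `β` and `β₀` in `Runs.exec`. -/
theorem exists_exec_of_wp {K : Type} [Ring K] [LE K] {sz h : K → ℕ} (H : SizeModel sz h)
    {P : Program} (hP : P.Tame = true) {s : Memory K} {N : ℕ} (hs : s.Bounded h (N + 1))
    {Q : Memory K → Prop} (hQ : wp (loopBound.eval N) P Q s) :
    ∃ s' t, Exec sz P s s' t ∧ t ≤ P.costBound.eval N ∧ Q s' := by
  obtain ⟨s', hr, hQ⟩ := hQ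
  obtain ⟨t, he, ht, -⟩ := hr.exec H le_rfl hP hs (fun a _ i => hs.2 a i) le_rfl
  refine ⟨s', t, he, ht.trans (le_of_eq ?_), hQ⟩
  simp [Program.costBound]

/-! ### The encoding of instances in memory. -/

namespace Instance

variable {K : Type}

theorem rowMajor_apply [Zero K] {r d : ℕ} (A : Fin r → Fin d → K) (u : Fin r) (i : Fin d) :
    rowMajor A (u * d + i) = A u i := by
  have hlt : (u : ℕ) * d + i < r * d := by
    calc (u : ℕ) * d + i < u * d + d := by omega
      _ = (u + 1) * d := by ring
      _ ≤ r * d := Nat.mul_le_mul_right d u.isLt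
  rw [rowMajor, dif_pos hlt]
  have hd : 0 < d := i.pos
  congr 1
  · ext
    simp only [Fin.coe_divNat]
    rw [mul_comm, Nat.mul_add_div hd, Nat.div_eq_of_lt i.isLt, add_zero]
  · ext
    simp only [Fin.coe_modNat]
    rw [mul_comm, Nat.mul_add_mod, Nat.mod_eq_of_lt i.isLt]

theorem rowMajor_le [Zero K] {r d : ℕ} (A : Fin r → Fin d → K) {h : K → ℕ} {β : ℕ} (h₀ : h 0 ≤ β)
    (hA : ∀ u i, h (A u i) ≤ β) (i : ℕ) : h (rowMajor A i) ≤ β := by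
  rw [rowMajor]
  split_ifs
  exacts [hA _ _, h₀]

theorem input_bounded [Ring K] [LE K] {sz h : K → ℕ} (H : SizeModel sz h) (X : Instance K) :
    X.input.Bounded h (X.size sz + 1) := by
  -- The extra `1` pays for cells that hold zero, whose height may be `1`.
  have h₀ : h 0 ≤ X.size sz + 1 := by simpa using (H.cast 0).trans (by simp)
  have hsum : ∀ {r d : ℕ} (A : Fin r → Fin d → K) u i, h (A u i) ≤ ∑ u, ∑ i, sz (A u i) :=
    fun A u i => (H.le_sz _).trans <|
      (Finset.single_le_sum (f := fun i => sz (A u i)) (by simp) (Finset.mem_univ i)).trans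
      (Finset.single_le_sum (f := fun u => ∑ i, sz (A u i)) (by simp) (Finset.mem_univ u))
  refine ⟨fun a i => ?_, fun a i => ?_⟩
  · have h₁ := size_le_self X.m
    have h₂ := size_le_self X.n
    have h₃ := size_le_self X.d
    simp only [input, size]
    split_ifs
    · rcases i with _ | _ | _ | _ | i <;> simp <;> omega
    · simp
  · simp only [input]
    split_ifs
    · refine rowMajor_le _ h₀ (fun u i => (hsum X.supplier u i).trans ?_) i
      rw [size]; omega
    · refine rowMajor_le _ h₀ (fun u i => (hsum X.client u i).trans ?_) i
      rw [size]; omega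
    · have := (H.le_sz _).trans (Finset.single_le_sum (f := fun v => sz (X.priority v)) (by simp)
        (Finset.mem_univ ⟨i, by assumption⟩))
      refine this.trans ?_
      rw [size]; omega
    · exact h₀
    · exact h₀

end Instance

theorem Memory.card_chosen_le {K : Type} (s : Memory K) (m : ℕ) :
    (s.chosen m).card ≤ ((Finset.range m).filter fun u => s.nat 1 u ≠ 0).card := by
  refine Finset.card_le_card_of_injOn (fun u : Fin m => (u : ℕ)) (fun u hu => ?_)
    Fin.val_injective.injOn
  simpa [Memory.chosen] using hu

/-! ### From the program to the approximation guarantee. -/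

namespace Instance

/-- It suffices to compare with each admissible `C`: the factor passes through the infima because it
is neither zero nor infinite. -/
theorem isApproxSolution_of_forall {X : Instance ℝ} {α : ℝ} (hα : 0 < α) {S : Finset (Fin X.m)}
    (hS : S.card ≤ X.k) (h : ∀ C : Finset (Fin X.m), C.card ≤ X.k →
      X.objective S ≤ ENNReal.ofReal α * X.objective C) :
    X.IsApproxSolution α S := by
  have hα' : ENNReal.ofReal α ≠ 0 := by simpa using hα
  refine ⟨hS, ?_⟩
  rw [opt, ENNReal.mul_iInf_of_ne hα' ENNReal.ofReal_ne_top]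
  refine le_iInf fun C => ?_
  rw [ENNReal.mul_iInf_of_ne hα' ENNReal.ofReal_ne_top]
  exact le_iInf fun hC => h C hC

/-- A solution is as good as any solution that leaves some client with positive priority at infinite
distance, and any two solutions are equally good if all priorities are zero. -/
theorem objective_le_of_empty (X : Instance ℝ) {α : ℝ} (hα : 0 < α) (S : Finset (Fin X.m)) :
    X.objective S ≤ ENNReal.ofReal α * X.objective ∅ := by
  have hα' : ENNReal.ofReal α ≠ 0 := by simpa using hα
  by_cases h : ∀ v, X.priority v = 0
  · simp [objective, priorityDist, h]
  · push Not at h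
    obtain ⟨v, hv⟩ := h
    have hpos : ENNReal.ofReal (X.priority v) ≠ 0 := by
      simpa using lt_of_le_of_ne (X.priority_nonneg v) hv.symm
    have : X.objective ∅ = ⊤ := by
      refine top_le_iff.mp (le_trans (le_of_eq ?_) (le_iSup (X.priorityDist ∅) v))
      simp [priorityDist, ENNReal.mul_top hpos]
    rw [this, ENNReal.mul_top hα']
    exact le_top

variable {K : Type} [Ring K] [LinearOrder K]

/-- The image of an instance under an embedding of its ring of numbers into the real numbers. -/
def map (φ : K →+* ℝ) (hφ : StrictMono φ) (X : Instance K) : Instance ℝ where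
  m := X.m
  n := X.n
  k := X.k
  d := X.d
  supplier u i := φ (X.supplier u i)
  client v i := φ (X.client v i)
  priority v := φ (X.priority v)
  priority_nonneg v := by simpa using hφ.monotone (X.priority_nonneg v)

theorem map_sum_eq_norm_sq (φ : K →+* ℝ) {d : ℕ} (p : K) (a b : ℕ → K) :
    φ (∑ i ∈ Finset.range d, (p * p) * ((a i - b i) * (a i - b i))) =
      φ p ^ 2 * ‖(WithLp.toLp 2 fun i : Fin d => φ (a i)) -
        WithLp.toLp 2 fun i : Fin d => φ (b i)‖ ^ 2 := by
  rw [EuclideanSpace.norm_sq_eq, Finset.mul_sum, map_sum, Finset.sum_range]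
  refine Finset.sum_congr rfl fun i _ => ?_
  simp [pow_two]

/-- The program computes in `K`, while norms and square roots live in `ℝ`. Strict monotonicity of
`φ` transports all comparisons between the two. -/
theorem wp_algorithm_input (φ : K →+* ℝ) (hφ : StrictMono φ) (X : Instance K) {L : ℕ}
    (hmL : X.m ≤ L) (hnL : X.n ≤ L) (hdL : X.d ≤ L) (hVL : 4 * X.n + 1 ≤ L)
    (hnmL : X.n * X.m ≤ L) :
    wp L algorithm (fun s => (X.map φ hφ).IsApproxSolution (1 + √3) (s.chosen X.m)) X.input := by
  set num := X.input.num with hnum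
  set cl : ℕ → EuclideanSpace ℝ (Fin X.d) := fun v =>
    WithLp.toLp 2 fun i => φ (num 1 (v * X.d + i)) with hcl
  set su : ℕ → EuclideanSpace ℝ (Fin X.d) := fun u =>
    WithLp.toLp 2 fun i => φ (num 0 (u * X.d + i)) with hsu
  set PW : ℕ → ℕ → K := fun v u => ∑ i ∈ Finset.range X.d, (num 2 v * num 2 v) *
    ((num 1 (v * X.d + i) - num 0 (u * X.d + i)) *
      (num 1 (v * X.d + i) - num 0 (u * X.d + i))) with hPW
  set PE : ℕ → ℕ → K := fun v u => ∑ i ∈ Finset.range X.d, (num 2 v * num 2 v) *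
    ((num 1 (v * X.d + i) - num 1 (u * X.d + i)) *
      (num 1 (v * X.d + i) - num 1 (u * X.d + i))) with hPE
  have hPWφ : ∀ v u, φ (PW v u) = φ (num 2 v) ^ 2 * ‖cl v - su u‖ ^ 2 := fun v u =>
    map_sum_eq_norm_sq φ _ (fun i => num 1 (v * X.d + i)) fun i => num 0 (u * X.d + i)
  have hPEφ : ∀ v u, φ (PE v u) = φ (num 2 v) ^ 2 * ‖cl v - cl u‖ ^ 2 := fun v u =>
    map_sum_eq_norm_sq φ _ (fun i => num 1 (v * X.d + i)) fun i => num 1 (u * X.d + i)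
  have hclient : ∀ v : Fin X.n, (WithLp.toLp 2 ((X.map φ hφ).client v) :
      EuclideanSpace ℝ (Fin X.d)) = cl v := fun v => by
    ext i
    simp [hcl, hnum, input, rowMajor_apply, map]
  have hsupplier : ∀ u : Fin X.m, (WithLp.toLp 2 ((X.map φ hφ).supplier u) :
      EuclideanSpace ℝ (Fin X.d)) = su u := fun u => by
    ext i
    simp [hsu, hnum, input, rowMajor_apply, map]
  have hprio : ∀ v : Fin X.n, (X.map φ hφ).priority v = φ (num 2 v) := fun v => by
    simp [hnum, input, map]
  have hnonneg : ∀ v < X.n, 0 ≤ φ (num 2 v) := fun v hv =>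
    hprio ⟨v, hv⟩ ▸ (X.map φ hφ).priority_nonneg ⟨v, hv⟩
  have hthree : ∀ R, φ (R + R + R) = 3 * φ R := fun R => by rw [map_add, map_add]; ring
  have hPW0 : ∀ v u, 0 ≤ φ (PW v u) := fun v u => by rw [hPWφ]; positivity
  have hα : 0 < 1 + √3 := by positivity
  have hdist : ∀ (S : Finset (Fin X.m)) (v : Fin X.n), (X.map φ hφ).priorityDist S v =
      ENNReal.ofReal (φ (num 2 v)) * ⨅ u ∈ S, edist (cl v) (su u) := fun S v => by
    have : (X.map φ hφ).priorityDist S v = ENNReal.ofReal ((X.map φ hφ).priority v) *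
      ⨅ u ∈ S, edist (WithLp.toLp 2 ((X.map φ hφ).client v) : EuclideanSpace ℝ (Fin X.d))
        (WithLp.toLp 2 ((X.map φ hφ).supplier u)) := rfl
    rw [this, hprio, hclient]
    simp only [hsupplier]
  -- A threshold that is attained by a feasible solution is not rejected.
  have hcomplete : ∀ (C : Finset (Fin X.m)) (f : Fin X.n → Fin X.m) (R : K), C.card ≤ X.k →
      0 < X.m → (∀ v, f v ∈ C ∧ PW v (f v) ≤ R) → ∀ PE' PW' : ℕ → ℕ → K,
      (∀ w < X.n, ∀ x < X.n, PE' w x = PE w x) → (∀ w < X.n, ∀ x < X.m, PW' w x = PW w x) →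
      ¬ Infeasible X.n X.m (2 * min X.k X.n) (num 2) PE' PW' R := by
    intro C f R hC hm hf PE' PW' hE hW
    refine not_infeasible (k := X.k) (C := C.map Fin.valEmbedding)
      (f := fun v => if h : v < X.n then f ⟨v, h⟩ else 0) rfl (by simpa using hC) hm ?_ ?_
    · intro v hv
      rw [dif_pos hv, hW v hv _ (f ⟨v, hv⟩).isLt]
      exact ⟨Finset.mem_map_of_mem Fin.valEmbedding (hf ⟨v, hv⟩).1, (f ⟨v, hv⟩).isLt, (hf ⟨v, hv⟩).2⟩
    · intro a ha b hb c hc u hu hba hcb h₁ h₂ h₃ h₄ h₅ h₆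
      rw [hW a ha u hu, ← hφ.le_iff_le, hPWφ] at h₁
      rw [hW b hb u hu, ← hφ.le_iff_le, hPWφ] at h₂
      rw [hW c hc u hu, ← hφ.le_iff_le, hPWφ] at h₃
      rw [hE b hb a ha, ← hφ.lt_iff_lt, hPEφ, hthree] at h₄
      rw [hE c hc a ha, ← hφ.lt_iff_lt, hPEφ, hthree] at h₅
      rw [hE c hc b hb, ← hφ.lt_iff_lt, hPEφ, hthree] at h₆
      exact false_of_three_far_priorities (hnonneg c hc) (hφ.monotone hcb) (hφ.monotone hba)
        h₁ h₂ h₃ h₄ h₅ h₆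
  -- Every nonempty solution determines a threshold.
  have hthreshold : ∀ C : Finset (Fin X.m), C.card ≤ X.k → C.Nonempty → 0 < X.n →
      ∃ (v₀ : Fin X.n) (u₀ : Fin X.m),
        ENNReal.ofReal √(φ (PW v₀ u₀)) ≤ (X.map φ hφ).objective C ∧
        ∀ PE' PW' : ℕ → ℕ → K, (∀ w < X.n, ∀ x < X.n, PE' w x = PE w x) →
          (∀ w < X.n, ∀ x < X.m, PW' w x = PW w x) →
          ¬ Infeasible X.n X.m (2 * min X.k X.n) (num 2) PE' PW' (PW v₀ u₀) := by
    intro C hC hne hn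
    have hmin : ∀ v : Fin X.n, ∃ u ∈ C, ∀ u' ∈ C, dist (cl v) (su u) ≤ dist (cl v) (su u') :=
      fun v => Finset.exists_min_image C (fun u => dist (cl v) (su u)) hne
    choose f hfC hf using hmin
    -- With `f v` the member of `C` nearest to `v`, the worst client `v₀` provides a threshold that
    -- serves all clients and whose root is at most the objective value of `C`.
    obtain ⟨v₀, -, hv₀⟩ := Finset.exists_max_image Finset.univ
      (fun v : Fin X.n => PW v (f v)) ⟨⟨0, hn⟩, Finset.mem_univ _⟩
    refine ⟨v₀, f v₀, ?_, hcomplete C f _ hC (f v₀).pos fun v =>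
      ⟨hfC v, hv₀ v (Finset.mem_univ v)⟩⟩
    refine le_trans ?_ (le_iSup ((X.map φ hφ).priorityDist C) v₀)
    rw [hdist, hPWφ, ← mul_pow, Real.sqrt_sq (mul_nonneg (hnonneg v₀ v₀.isLt) (norm_nonneg _)),
      ENNReal.ofReal_mul (hnonneg v₀ v₀.isLt)]
    gcongr
    refine le_iInf₂ fun u hu => ?_
    rw [edist_dist, ← dist_eq_norm]
    exact ENNReal.ofReal_le_ofReal (hf v₀ u hu)
  refine wp_mono (wp_algorithm (n := X.n) (m := X.m) (k := X.k) (d := X.d) (PW := PW) (PE := PE)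
    rfl rfl rfl rfl rfl hmL hnL hdL (by omega) hnmL ?_ rfl (fun _ _ => rfl) (fun _ _ => rfl) ?_) ?_
  · intro a ha j
    simp only [input]
    rw [if_neg (by omega), if_neg (by omega), if_neg (by omega)]
  · intro v hv u hu w hw
    rw [← hφ.le_iff_le, hPEφ, hthree, sub_self, norm_zero]
    have := hPW0 v u
    simpa using this
  intro s _ hs
  -- The empty solution and instances without clients need no threshold and are settled here.
  have hreduce : (s.chosen X.m).card ≤ X.k → (∀ C : Finset (Fin X.m), C.card ≤ X.k → C.Nonempty →
      0 < X.n → (X.map φ hφ).objective (s.chosen X.m) ≤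
        ENNReal.ofReal (1 + √3) * (X.map φ hφ).objective C) →
      (X.map φ hφ).IsApproxSolution (1 + √3) (s.chosen X.m) := by
    intro hcard h
    refine isApproxSolution_of_forall hα hcard fun C hC => ?_
    rcases C.eq_empty_or_nonempty with rfl | hne
    · exact objective_le_of_empty _ hα _
    · rcases Nat.eq_zero_or_pos X.n with hn | hn
      · have : IsEmpty (Fin (X.map φ hφ).n) := by
          have : (X.map φ hφ).n = 0 := hn
          rw [this]
          infer_instance
        simp [objective]
      · exact h C hC hne hn
  rcases hs with ⟨hout, hno⟩ | ⟨R, -, ⟨PE', PW', hE, hW, hfeas⟩, hbest⟩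
  -- All thresholds were rejected: the output is the initial empty set, and a nonempty admissible
  -- `C` would contradict `hthreshold`.
  · refine hreduce ?_ fun C hC hne hn => ?_
    · have : s.chosen X.m = ∅ := by simp [Memory.chosen, hout, input]
      simp [this]
    · obtain ⟨v₀, u₀, -, h⟩ := hthreshold C hC hne hn
      obtain ⟨PE', PW', hE, hW, h'⟩ := hno v₀ v₀.isLt u₀ u₀.isLt
      exact absurd h' (h PE' PW' hE hW)
  · refine hreduce ?_ fun C hC hne hn => ?_
    · have := hfeas.card_le
      have := s.card_chosen_le X.m
      omega
    · obtain ⟨v₀, u₀, hobj, h⟩ := hthreshold C hC hne hn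
      -- The threshold belonging to `C` cannot be rejected, so the accepted `R` does not exceed it.
      have hR : R ≤ PW v₀ u₀ := (hbest v₀ v₀.isLt u₀ u₀.isLt).resolve_right
        fun ⟨PE', PW', hE, hW, h'⟩ => h PE' PW' hE hW h'
      refine le_trans ?_ (mul_le_mul_right hobj _)
      rw [← ENNReal.ofReal_mul hα.le]
      refine iSup_le fun w => ?_
      obtain ⟨v, hv, u, hu, hchosen, hp, hEw, hWv⟩ := hfeas.exists_close w.isLt
      rw [hE _ w.isLt v hv, ← hφ.le_iff_le, hPEφ, hthree] at hEw
      rw [hW v hv u hu, ← hφ.le_iff_le, hPWφ] at hWv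
      have hw := priority_mul_dist_le (hnonneg w w.isLt) (hφ.monotone hp) hEw hWv
      have hmem : (⟨u, hu⟩ : Fin X.m) ∈ s.chosen X.m := by simpa [Memory.chosen] using hchosen
      refine (hdist (s.chosen X.m) w).trans_le ?_
      calc _ ≤ ENNReal.ofReal (φ (num 2 w)) * edist (cl w) (su u) := by
            gcongr
            exact iInf₂_le (⟨u, hu⟩ : Fin X.m) hmem
        _ = ENNReal.ofReal (φ (num 2 w) * ‖cl w - su u‖) := by
            rw [ENNReal.ofReal_mul (hnonneg w w.isLt), edist_dist, dist_eq_norm]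
        _ ≤ _ := by
            refine ENNReal.ofReal_le_ofReal (hw.trans ?_)
            gcongr
            exact hφ.monotone hR

theorem exists_exec_algorithm (φ : K →+* ℝ) (hφ : StrictMono φ) {sz h : K → ℕ}
    (H : SizeModel sz h) (X : Instance K) :
    ∃ s t, Exec sz algorithm X.input s t ∧ t ≤ algorithm.costBound.eval (X.size sz) ∧
      (X.map φ hφ).IsApproxSolution (1 + √3) (s.chosen X.m) := by
  refine exists_exec_of_wp H algorithm_tame (X.input_bounded H)
    (wp_algorithm_input φ hφ X ?_ ?_ ?_ ?_ ?_)
  -- Here `loopBound` is justified: `m`, `n` and `d` are at most `N`, the loop over thresholds has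
  -- `n * m ≤ N ^ 2` rounds, and the matching program needs `4 * n + 1`.
  all_goals
    rw [eval_loopBound, size]
    generalize (∑ u, ∑ i, sz (X.supplier u i)) = x
    generalize (∑ v, ∑ i, sz (X.client v i)) = y
    generalize ∑ v, sz (X.priority v) = z
    nlinarith [Nat.zero_le (X.n * X.m), Nat.zero_le (X.d + Nat.size X.k + x + y + z)]

end Instance

end PrioritySupplier

theorem theorem1 :
    ∃ (P : PrioritySupplier.Program) (q : Polynomial ℕ),
      (∀ X : PrioritySupplier.Instance ℝ,
        ∃ (s : PrioritySupplier.Memory ℝ) (t : ℕ),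
          PrioritySupplier.Exec PrioritySupplier.unitSize P X.input s t ∧
          t ≤ q.eval (X.size PrioritySupplier.unitSize) ∧
          X.IsApproxSolution (1 + Real.sqrt 3) (s.chosen X.m)) ∧
      (∀ X : PrioritySupplier.Instance ℚ,
        ∃ (s : PrioritySupplier.Memory ℚ) (t : ℕ),
          PrioritySupplier.Exec PrioritySupplier.bitSize P X.input s t ∧
          t ≤ q.eval (X.size PrioritySupplier.bitSize) ∧
          X.toReal.IsApproxSolution (1 + Real.sqrt 3) (s.chosen X.toReal.m)) := by
  exact ⟨PrioritySupplier.algorithm, PrioritySupplier.algorithm.costBound,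
    fun X => X.exists_exec_algorithm (RingHom.id ℝ) strictMono_id
      PrioritySupplier.sizeModel_unitSize,
    fun X => X.exists_exec_algorithm (Rat.castHom ℝ) Rat.cast_strictMono
      PrioritySupplier.sizeModel_bitSize⟩
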